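/- **Setting.** Let $d\ge 1$ be an integer, let $d\le\alpha<\infty$ and $s>d$. Let $\kappa>0$, $r_0\ge 0$, and let $w:\mathbb R^d\to\mathbb R\cup\{+\infty\}$ be an even lower semi-continuous function such that * (stability) $\sum_{1\le j<k\le N}w(x_j-x_k)\ge-\kappa N$ for all $N\in\mathbb N$ and $x_1,\dots,x_N\in\mathbb R^d$; * (upper regularity) $w(x)\le\kappa\Big(\mathbf 1(|x|<r_0)\big(\tfrac{r_0}{|x|}\big)^{\alpha}+\tfrac1{1+|x|^s}\Big)$ for all $x\in\mathbb R^d$, the first term being $+\infty$ at $x=0$ if $r_0>0$. For a positive finite symmetric measure $P$ on $(\mathbb R^d)^n$ let $\rho_P$ be the sum of its $n$ marginals, $\mathcal U_n(P)=\int\sum_{j<k}w(x_j-x_k)\,dP$, and $\mathcal S_n(P)=-\int P\log(n!\,P)\,dx$, with $\mathcal S_n(P)=-\infty$ if $P$ is not absolutely continuous (for $n=0$: $P$ is a number $P_0\ge0$, $\mathcal U_0=0$, $\mathcal S_0=-P_0\log P_0$, $\rho_{P_0}=0$). For $0\le\rho\in L^1(\mathbb R^d)$ and $T\ge0$ (with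 $0\cdot(\pm\infty)=0$, so that the entropy is absent at $T=0$), the grand-canonical free energy is $$G_T[\rho]=\inf\Big\{\sum_{n\ge0}\mathcal U_n(P_n)-T\sum_{n\ge0}\mathcal S_n(P_n)\Big\},$$ the infimum being over families $(P_n)_{n\ge0}$ of symmetric positive measures $P_n$ on $(\mathbb R^d)^n$ with $\sum_nP_n((\mathbb R^d)^n)=1$ and $\sum_{n}\rho_{P_n}=\rho$. If $\int\rho=N\in\mathbb N$, the canonical free energy is $$F_T[\rho]=\inf\big\{\mathcal U_N(P)-T\,\mathcal S_N(P)\big\},$$ the infimum being over symmetric probability measures $P$ on $(\mathbb R^d)^N$ with $\rho_P=\rho$. **Theorem.** There is a constant $C>0$ depending only on $d$, $\alpha$ and $s$ such that the following holds for all $w,\kappa,r_0$ as above, all $T\ge0$ and all $0\le\rho\in L^1(\mathbb R^d)$ which satisfy $\int\rho|\log\rho|<\infty$ if $T>0$. 1. In the grand-canonical ensemble, $$G_T[\rho]\le C\kappa\int_{\mathbb R^d}\rho^2+CT\int_{\mathbb R^d}\rho+T\int_{\mathbb R^d}\rho\log\rho+\begin{cases}\displaystyle C\kappa r_0^\alpha\int_{\mathbb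 R^d}\rho^{1+\alpha/d}&\text{if }\alpha>d,\\[2mm]\displaystyle C\kappa r_0^d\Big(\int_{\mathbb R^d}\rho^2+\int_{\mathbb R^d}\rho^2\big(\log(r_0^d\rho)\big)_+\Big)&\text{if }\alpha=d.\end{cases}$$ The right-hand side may be $+\infty$; the term $T\int\rho\log\rho$ is $0$ for $T=0$, and the last term is $0$ for $r_0=0$. 2. If moreover $\int\rho\in\mathbb N$, the canonical free energy $F_T[\rho]$ is bounded above by the same right-hand side for all $T\ge0$ if $d=1$, and for $T=0$ if $d\ge2$. -/

import Mathlib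

open MeasureTheory
open scoped ENNReal Nat

/-- The integral of an extended-real function, `∫ f⁺ - ∫ f⁻`. It is used below only for functions
for which at most one of the two integrals is infinite. -/
noncomputable def eIntegral {X : Type*} [MeasurableSpace X] (μ : Measure X) (f : X → EReal) :
    EReal :=
  ((∫⁻ x, (f x).toENNReal ∂μ : ℝ≥0∞) : EReal) - ((∫⁻ x, (-f x).toENNReal ∂μ : ℝ≥0∞) : EReal)

/-- The sum of a sequence of extended reals, `∑ aₙ⁺ - ∑ aₙ⁻`. It is used below only for sequences
for which at most one of the two sums is infinite. -/
noncomputable def eSum (a : ℕ → EReal) : EReal :=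
  ((∑' n, (a n).toENNReal : ℝ≥0∞) : EReal) - ((∑' n, (-a n).toENNReal : ℝ≥0∞) : EReal)

/-- The total pair interaction `∑_{j < k} w (x_j - x_k)` of a configuration of `N` points. -/
noncomputable def pairEnergy {d : ℕ} (w : EuclideanSpace ℝ (Fin d) → EReal) {N : ℕ}
    (x : Fin N → EuclideanSpace ℝ (Fin d)) : EReal :=
  ∑ j : Fin N, ∑ k ∈ Finset.Ioi j, w (x j - x k)

/-- The singular core `1(|x| < r₀) (r₀ / |x|) ^ α`, which is `+∞` at `x = 0` when `r₀ > 0`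
and `α > 0`. -/
noncomputable def corePotential {d : ℕ} (r₀ α : ℝ) (x : EuclideanSpace ℝ (Fin d)) : ℝ≥0∞ :=
  if ‖x‖ < r₀ then (ENNReal.ofReal r₀ / ENNReal.ofReal ‖x‖) ^ α else 0

/-- The standing assumption on the interaction potential `w : ℝᵈ → ℝ ∪ {+∞}`, with constant `κ`,
core radius `r₀`, core exponent `α < ∞` and decay exponent `s > d`. -/
structure IsShortRangePotential {d : ℕ} (w : EuclideanSpace ℝ (Fin d) → EReal)
    (κ r₀ α s : ℝ) : Prop where
  kappa_pos : 0 < κ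
  r₀_nonneg : 0 ≤ r₀
  alpha_nonneg : 0 ≤ α
  dim_lt_s : (d : ℝ) < s
  ne_bot : ∀ x, w x ≠ ⊥
  even : ∀ x, w (-x) = w x
  lowerSemicontinuous : LowerSemicontinuous w
  stable : ∀ (N : ℕ) (x : Fin N → EuclideanSpace ℝ (Fin d)),
    ((-(κ * N) : ℝ) : EReal) ≤ pairEnergy w x
  upperRegular : ∀ x, w x ≤
    ((ENNReal.ofReal κ * (corePotential r₀ α x + ENNReal.ofReal (1 / (1 + ‖x‖ ^ s))) : ℝ≥0∞) :
      EReal)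

/-- Invariance of a measure on `(ℝᵈ)ᴺ` under all permutations of the particles. -/
def IsSymmetricMeasure {d N : ℕ} (P : Measure (Fin N → EuclideanSpace ℝ (Fin d))) : Prop :=
  ∀ σ : Equiv.Perm (Fin N), P.map (fun x i => x (σ i)) = P

/-- The one-body density of an `N`-particle measure: the sum of its `N` marginals. For a symmetric
measure this is `N` times the first marginal. -/
noncomputable def oneBodyDensity {d N : ℕ} (P : Measure (Fin N → EuclideanSpace ℝ (Fin d))) :
    Measure (EuclideanSpace ℝ (Fin d)) :=
  ∑ i : Fin N, P.map (fun x => x i)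

/-- The interaction energy `𝒰_N(P)`. -/
noncomputable def interactionEnergy {d : ℕ} (w : EuclideanSpace ℝ (Fin d) → EReal) {N : ℕ}
    (P : Measure (Fin N → EuclideanSpace ℝ (Fin d))) : EReal :=
  eIntegral P (pairEnergy w)

open Classical in
/-- The entropy `𝒮_N(P) = -∫ P log (N! P)`, which is `-∞` if `P` is not absolutely continuous.
For `N = 0`, the space is one point of volume `1` and this is `-P₀ log P₀`. -/
noncomputable def canonicalEntropy {d N : ℕ} (P : Measure (Fin N → EuclideanSpace ℝ (Fin d))) :
    EReal :=
  if P ≪ volume then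
    -eIntegral volume (fun x =>
      (((P.rnDeriv volume x).toReal * Real.log (N ! * (P.rnDeriv volume x).toReal) : ℝ) : EReal))
  else ⊥

/-- `P` is an `N`-particle state whose one-body density is the function `ρ`. -/
structure IsCanonicalState {d N : ℕ} (ρ : EuclideanSpace ℝ (Fin d) → ℝ)
    (P : Measure (Fin N → EuclideanSpace ℝ (Fin d))) : Prop where
  mass : P Set.univ = 1
  symmetric : IsSymmetricMeasure P
  density : oneBodyDensity P = volume.withDensity (fun x => ENNReal.ofReal (ρ x))

/-- The canonical free energy `F_T[ρ]` for a density `ρ` of mass `N`. -/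
noncomputable def canonicalFreeEnergy {d : ℕ} (w : EuclideanSpace ℝ (Fin d) → EReal) (T : ℝ)
    (N : ℕ) (ρ : EuclideanSpace ℝ (Fin d) → ℝ) : EReal :=
  ⨅ (P : Measure (Fin N → EuclideanSpace ℝ (Fin d))) (_ : IsCanonicalState ρ P),
    (interactionEnergy w P - (T : EReal) * canonicalEntropy P)

/-- `P = (Pₙ)` is a grand-canonical state whose one-body density is the function `ρ`. -/
structure IsGrandCanonicalState {d : ℕ} (ρ : EuclideanSpace ℝ (Fin d) → ℝ)
    (P : (n : ℕ) → Measure (Fin n → EuclideanSpace ℝ (Fin d))) : Prop where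
  mass : ∑' n, P n Set.univ = 1
  symmetric : ∀ n, IsSymmetricMeasure (P n)
  density : Measure.sum (fun n => oneBodyDensity (P n)) =
    volume.withDensity (fun x => ENNReal.ofReal (ρ x))

/-- The grand-canonical free energy `G_T[ρ]`. -/
noncomputable def grandCanonicalFreeEnergy {d : ℕ} (w : EuclideanSpace ℝ (Fin d) → EReal) (T : ℝ)
    (ρ : EuclideanSpace ℝ (Fin d) → ℝ) : EReal :=
  ⨅ (P : (n : ℕ) → Measure (Fin n → EuclideanSpace ℝ (Fin d))) (_ : IsGrandCanonicalState ρ P),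
    (eSum (fun n => interactionEnergy w (P n)) -
      (T : EReal) * eSum (fun n => canonicalEntropy (P n)))

/-- The contribution of the core to the upper bound: `κ r₀^α ∫ ρ^(1+α/d)` for `α > d` and
`κ r₀^d (∫ ρ² + ∫ ρ² (log (r₀^d ρ))₊)` for `α = d`, possibly `+∞`. -/
noncomputable def coreTerm {d : ℕ} (κ r₀ α : ℝ) (ρ : EuclideanSpace ℝ (Fin d) → ℝ) : ℝ≥0∞ :=
  if (d : ℝ) < α then
    ENNReal.ofReal (κ * r₀ ^ α) * ∫⁻ x, ENNReal.ofReal (ρ x ^ (1 + α / d))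
  else
    ENNReal.ofReal (κ * r₀ ^ d) *
      ((∫⁻ x, ENNReal.ofReal (ρ x ^ 2)) +
        ∫⁻ x, ENNReal.ofReal (ρ x ^ 2 * max (Real.log (r₀ ^ d * ρ x)) 0))

/-- The local upper bound
`C κ ∫ ρ² + C T ∫ ρ + T ∫ ρ log ρ + C (core term)`, with values in `(-∞, +∞]`. -/
noncomputable def localUpperBound {d : ℕ} (C κ r₀ α T : ℝ) (ρ : EuclideanSpace ℝ (Fin d) → ℝ) :
    EReal :=
  ((ENNReal.ofReal (C * κ) * ∫⁻ x, ENNReal.ofReal (ρ x ^ 2) : ℝ≥0∞) : EReal) +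
    ((C * T * ∫ x, ρ x : ℝ) : EReal) +
    ((T * ∫ x, ρ x * Real.log (ρ x) : ℝ) : EReal) +
    ((ENNReal.ofReal C * coreTerm κ r₀ α ρ : ℝ≥0∞) : EReal)

/-!
Write `μ` for the measure with density `ρ`, and let the local radius `R x` be the supremum of the
radii for which the ball around `x` has `μ`-mass at most a small constant `c` (`localRadius`). It is
`1`-Lipschitz. The upper bound comes from a state in which any two particles satisfy
`η max (R x, R y) ≤ |x - y|` for a constant `η > 0`. If the total mass is at most `c`, then `R` makes
no sense, but a grand-canonical state with at most one particle has no interaction energy.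

**Energy.** In a separated configuration each pair is charged to its particle of smaller radius. The
particles charged to `x` are then at distance at least `η R x` from each other and from `x`, so that
the sum of the decreasing upper bound on `w` over them is comparable with its integral. Hence the
energy is at most `∑ i, e (x i)` (`exists_pairEnergy_le`), where `e x` is `R x ^ (-d)` plus a core
term in `R x` (`coreSum`). This is linear in the one-body density, so that every separated state has
energy at most `∫ e ∂μ`. By the Besicovitch covering theorem, `μ {R < t}` is bounded by a constant
times the mass of the region where `ρ` exceeds a constant times `t ^ (-d)`
(`exists_measure_radius_lt_le`): a ball of mass `c` and radius less than `t` gets at least half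
of its mass from that region. Integrating this over `t`, one may replace `R ^ (-d)` by a multiple of `ρ` in
`∫ e ∂μ`, which gives the local terms (`exists_lintegral_radius_le`).

**Entropy.** Cut space into finitely many cells and take states whose density with respect to
`μ ⊗ ⋯ ⊗ μ` is a symmetric weight `W` of the labels of the cells. The one-body density is `ρ` as
soon as the expected number of particles in every cell is its mass, and if `n! W ≤ K ^ n`, then `-S` is
at most `log K ∫ ρ + ∫ ρ log ρ` (`grandCanonicalFreeEnergy_le_of_weights`,
`canonicalFreeEnergy_le_of_weights`). It remains to find cells and weights with separation.

* In the grand-canonical case the cells are cubes of side comparable to `R`, coloured by the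
  parities of their dyadic level and position, so that cubes of one colour are separated
  (`separated_of_truncColor_eq`). With `K` colours and cells of mass at most `1 / K`, choose one
  colour at random and occupy each of its cells `j` independently with probability `K μ(j)`
  (`occupationWeight`).
* For `d = 1` and `∫ ρ = N`, the cells are `2 N` consecutive intervals of mass `1 / 2` with two
  colours (`exists_interval_labels`). The occupation probabilities are all `1`, so the state above
  has exactly `N` particles.
* For `T = 0` and `∫ ρ = N`, the weights need no bound. The cells form a fine grid, and two cells are
  in conflict if they contain points that are too close; every cell is in conflict with cells of
  total mass at most `2 c` (`exists_grid_labels`). Among the distributions of `N`-tuples of cells with the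
  right frequencies, one with the least expected number of conflicts has none: otherwise a
  conflicting cell could be exchanged with a cell of another tuple
  (`exists_conflictFree_distribution`).
-/

/-! ### The local radius of a measure -/

section LocalRadius

open Metric Set Filter Topology

/-- The supremum of the radii for which the closed ball around `x` has mass at most `c`. It is a positive
real number when `0 < c < μ univ` and `μ` has no atoms. -/
noncomputable def localRadius {E : Type*} [PseudoMetricSpace E] [MeasurableSpace E]
    (μ : Measure E) (c : ℝ≥0∞) (x : E) : ℝ :=
  sSup {r : ℝ | μ (closedBall x r) ≤ c}

variable {E : Type*} [MetricSpace E] [MeasurableSpace E] {μ : Measure E} {c : ℝ≥0∞}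

theorem exists_lt_measure_closedBall (hc : c < μ univ) (x : E) : ∃ r, c < μ (closedBall x r) := by
  have hU : (⋃ n : ℕ, closedBall x (n : ℝ)) = univ := iUnion_closedBall_nat x
  have hm : Monotone fun n : ℕ => closedBall x (n : ℝ) := fun a b h =>
    closedBall_subset_closedBall (by exact_mod_cast h)
  have ht := tendsto_measure_iUnion_atTop (μ := μ) hm
  rw [hU] at ht
  obtain ⟨n, hn⟩ := (ht.eventually (lt_mem_nhds hc)).exists
  exact ⟨n, hn⟩

theorem bddAbove_localRadius (hc : c < μ univ) (x : E) :
    BddAbove {r : ℝ | μ (closedBall x r) ≤ c} := by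
  obtain ⟨r, hr⟩ := exists_lt_measure_closedBall hc x
  refine ⟨r, fun r' hr' => ?_⟩
  by_contra! h
  exact absurd hr (not_lt.2 ((measure_mono (closedBall_subset_closedBall h.le)).trans hr'))

theorem lt_measure_closedBall_of_localRadius_lt (hc : c < μ univ) {x : E} {r : ℝ}
    (hr : localRadius μ c x < r) : c < μ (closedBall x r) := by
  by_contra! h
  exact absurd (le_csSup (bddAbove_localRadius hc x) h) (not_le.2 hr)

theorem measure_closedBall_le_of_lt_localRadius [NullSingletonClass μ] {x : E} {r : ℝ}
    (hr : r < localRadius μ c x) : μ (closedBall x r) ≤ c := by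
  obtain ⟨r', hr', hlt⟩ := exists_lt_of_lt_csSup ⟨0, by simp⟩ hr
  exact (measure_mono (closedBall_subset_closedBall hlt.le)).trans hr'

theorem localRadius_le_add_dist [NullSingletonClass μ] (hc : c < μ univ) (x y : E) :
    localRadius μ c x ≤ localRadius μ c y + dist x y := by
  refine csSup_le ⟨0, by simp⟩ fun r hr => ?_
  by_contra! h
  have h1 : c < μ (closedBall y (r - dist x y)) :=
    lt_measure_closedBall_of_localRadius_lt hc (by linarith)
  refine absurd (h1.trans_le (measure_mono ?_)) (not_lt.2 hr)
  refine closedBall_subset_closedBall' ?_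
  rw [dist_comm y x]; linarith

theorem continuous_localRadius [NullSingletonClass μ] (hc : c < μ univ) :
    Continuous (localRadius μ c) := by
  have : LipschitzWith 1 (localRadius μ c) :=
    LipschitzWith.of_le_add fun x y => localRadius_le_add_dist hc x y
  exact this.continuous

variable [BorelSpace E] [IsFiniteMeasure μ]

theorem tendsto_measure_closedBall (x : E) (r : ℝ) :
    Tendsto (fun n : ℕ => μ (closedBall x (r + 1 / (n + 1)))) atTop (𝓝 (μ (closedBall x r))) := by
  have hanti : Antitone fun n : ℕ => closedBall x (r + 1 / ((n : ℝ) + 1)) := fun a b h => by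
    refine closedBall_subset_closedBall ?_
    have : (a : ℝ) ≤ b := by exact_mod_cast h
    gcongr
  have hI : (⋂ n : ℕ, closedBall x (r + 1 / ((n : ℝ) + 1))) = closedBall x r := by
    ext y
    simp only [mem_iInter, mem_closedBall]
    constructor
    · intro h
      refine le_of_forall_pos_le_add fun ε hε => ?_
      obtain ⟨n, hn⟩ := exists_nat_one_div_lt hε
      linarith [h n]
    · intro h n
      have : (0 : ℝ) < 1 / ((n : ℝ) + 1) := by positivity
      linarith
  rw [← hI]
  exact tendsto_measure_iInter_atTop (fun n => measurableSet_closedBall.nullMeasurableSet) hanti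
    ⟨0, measure_ne_top _ _⟩

theorem le_measure_closedBall_localRadius (hc : c < μ univ) (x : E) :
    c ≤ μ (closedBall x (localRadius μ c x)) := by
  refine ge_of_tendsto (tendsto_measure_closedBall x _) (Eventually.of_forall fun n => ?_)
  refine (lt_measure_closedBall_of_localRadius_lt hc ?_).le
  have : (0 : ℝ) < 1 / ((n : ℝ) + 1) := by positivity
  linarith

theorem localRadius_pos [NullSingletonClass μ] (hc0 : 0 < c) (hc : c < μ univ) (x : E) :
    0 < localRadius μ c x := by
  have h := tendsto_measure_closedBall (μ := μ) x 0
  rw [closedBall_zero, measure_singleton] at h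
  obtain ⟨n, hn⟩ := (h.eventually (gt_mem_nhds hc0)).exists
  have : (0 : ℝ) < 0 + 1 / ((n : ℝ) + 1) := by positivity
  exact this.trans_le (le_csSup (bddAbove_localRadius hc x) hn.le)

end LocalRadius

/-! ### A weak-type estimate for the local radius -/

section WeakType

open Metric Set Module

variable {E : Type*} [NormedAddCommGroup E] [NormedSpace ℝ E] [FiniteDimensional ℝ E]
  [MeasurableSpace E] [BorelSpace E]

/-- If balls of radius `r x < t` around all points of a set carry mass at least `c`, then half of
the mass of each such ball comes from the region where the density exceeds `b t⁻ᵈ`, the rest having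
too little volume. The Besicovitch covering theorem sums this up over the set. -/
theorem exists_measure_radius_lt_le (ν : Measure E) [ν.IsAddHaarMeasure] :
    ∃ K : ℕ, ∀ (f : E → ℝ≥0∞), Measurable f → ∀ (c b : ℝ≥0∞), c ≠ ∞ →
      2 * (b * ν (ball 0 1)) ≤ c → ∀ (r : E → ℝ), (∀ x, 0 < r x) →
      (∀ x, c ≤ ν.withDensity f (closedBall x (r x))) →
      IsFiniteMeasure (ν.withDensity f) → ∀ t : ℝ,
      ν.withDensity f {x | r x < t} ≤
        K * ν.withDensity f {x | b < f x * ENNReal.ofReal t ^ finrank ℝ E} := by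
  obtain ⟨N, τ, hτ, hN⟩ := HasBesicovitchCovering.no_satelliteConfig (α := E)
  refine ⟨2 * N, fun f hf c b hctop hb r hr0 hr hfin t => ?_⟩
  set μ := ν.withDensity f with hμ
  set H : Set E := {x | b < f x * ENNReal.ofReal t ^ finrank ℝ E} with hH
  have hHm : MeasurableSet H := measurableSet_lt measurable_const (hf.mul_const _)
  -- Outside `H` the density is at most `b t⁻ᵈ`.
  have key : ∀ x, r x < t → μ (closedBall x (r x)) ≤ 2 * μ (closedBall x (r x) ∩ H) := by
    intro x hx
    have ht : 0 < t := (hr0 x).trans hx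
    have hlow : μ (closedBall x (r x) ∩ Hᶜ) ≤ b * ν (ball 0 1) := by
      have ht0 : ENNReal.ofReal t ^ finrank ℝ E ≠ 0 := by positivity
      have htt : ENNReal.ofReal t ^ finrank ℝ E ≠ ∞ := by finiteness
      calc μ (closedBall x (r x) ∩ Hᶜ)
          = ∫⁻ y in closedBall x (r x) ∩ Hᶜ, f y ∂ν :=
            withDensity_apply _ (measurableSet_closedBall.inter hHm.compl)
        _ ≤ ∫⁻ y in closedBall x (r x) ∩ Hᶜ, b / ENNReal.ofReal t ^ finrank ℝ E ∂ν := by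
            refine setLIntegral_mono measurable_const fun y hy => ?_
            rw [ENNReal.le_div_iff_mul_le (Or.inl ht0) (Or.inl htt)]
            exact not_lt.1 hy.2
        _ = b / ENNReal.ofReal t ^ finrank ℝ E * ν (closedBall x (r x) ∩ Hᶜ) := by
            rw [setLIntegral_const]
        _ ≤ b / ENNReal.ofReal t ^ finrank ℝ E * ν (closedBall x t) := by
            gcongr
            exact inter_subset_left.trans (closedBall_subset_closedBall hx.le)
        _ = b * ν (ball 0 1) := by
            rw [Measure.addHaar_closedBall _ _ ht.le, ENNReal.ofReal_pow ht.le, ← mul_assoc,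
              ENNReal.div_mul_cancel ht0 htt]
    have hsplit : μ (closedBall x (r x)) = μ (closedBall x (r x) ∩ H) +
        μ (closedBall x (r x) ∩ Hᶜ) := by
      rw [← sdiff_eq, measure_inter_add_sdiff _ hHm]
    set A := μ (closedBall x (r x) ∩ H)
    set B := μ (closedBall x (r x) ∩ Hᶜ)
    have hBA : B ≤ A := by
      have h1 : B + B ≤ A + B := by
        calc B + B = 2 * B := (two_mul B).symm
          _ ≤ 2 * (b * ν (ball 0 1)) := by gcongr
          _ ≤ c := hb
          _ ≤ μ (closedBall x (r x)) := hr x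
          _ = A + B := hsplit
      exact (ENNReal.add_le_add_iff_right (measure_ne_top _ _)).1 h1
    rw [hsplit, two_mul]; gcongr
  let q : Besicovitch.BallPackage {x | r x < t} E :=
    { c := fun x => x
      r := fun x => r x
      rpos := fun x => hr0 x
      r_bound := t
      r_le := fun x => le_of_lt x.2 }
  obtain ⟨s, hs, hcov⟩ := Besicovitch.exist_disjoint_covering_families hτ hN q
  have hcount : ∀ i, (s i).Countable := fun i =>
    (hs i).countable_of_nonempty_interior fun j _ =>
      ⟨(j : E), by
        have : (j : E) ∈ ball (j : E) (r j) := mem_ball_self (hr0 _)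
        exact ball_subset_interior_closedBall this⟩
  have hsub : {x | r x < t} ⊆ ⋃ i : Fin N, ⋃ j ∈ s i, closedBall (q.c j) (q.r j) := by
    intro x hx
    have hx' := hcov ⟨⟨x, hx⟩, rfl⟩
    simp only [mem_iUnion] at hx' ⊢
    obtain ⟨i, j, hj, h⟩ := hx'
    exact ⟨i, j, hj, ball_subset_closedBall h⟩
  calc μ {x | r x < t} ≤ μ (⋃ i : Fin N, ⋃ j ∈ s i, closedBall (q.c j) (q.r j)) :=
        measure_mono hsub
    _ ≤ ∑ i : Fin N, μ (⋃ j ∈ s i, closedBall (q.c j) (q.r j)) := measure_iUnion_fintype_le _ _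
    _ ≤ ∑ i : Fin N, 2 * μ H := by
        refine Finset.sum_le_sum fun i _ => ?_
        calc μ (⋃ j ∈ s i, closedBall (q.c j) (q.r j))
            ≤ ∑' j : s i, μ (closedBall (q.c j) (q.r j)) := measure_biUnion_le _ (hcount i) _
          _ ≤ ∑' j : s i, 2 * μ (closedBall (q.c j) (q.r j) ∩ H) :=
              ENNReal.tsum_le_tsum fun j => key _ j.1.2
          _ = 2 * ∑' j : s i, μ (closedBall (q.c j) (q.r j) ∩ H) := ENNReal.tsum_mul_left
          _ = 2 * μ (⋃ j ∈ s i, closedBall (q.c j) (q.r j) ∩ H) := by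
              rw [measure_biUnion (hcount i)
                (fun j hj k hk hjk => (hs i hj hk hjk).mono inter_subset_left inter_subset_left)
                fun j _ => measurableSet_closedBall.inter hHm]
          _ ≤ 2 * μ H := by
              gcongr
              simp
    _ = ((2 * N : ℕ) : ℝ≥0∞) * μ H := by
        simp [mul_comm, mul_assoc]

/-- A weak-type comparison of two functions, `μ {t < X} ≤ K μ {t < Y}`, passes to the integrals of
every continuous monotone function of them. -/
theorem lintegral_comp_le_of_measure_lt_le {Ω : Type*} [MeasurableSpace Ω] {μ : Measure Ω}
    {X Y : Ω → ℝ} {K : ℕ} (hX : Measurable X) (hY : Measurable Y) (hX0 : ∀ ω, 0 ≤ X ω)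
    (hY0 : ∀ ω, 0 ≤ Y ω)
    (h : ∀ t : ℝ, 0 < t → μ {ω | t < X ω} ≤ K * μ {ω | t < Y ω}) {Ψ : ℝ → ℝ}
    (hΨ : Continuous Ψ) (hmono : MonotoneOn Ψ (Ici 0)) (hΨ0 : Ψ 0 = 0) :
    ∫⁻ ω, ENNReal.ofReal (Ψ (X ω)) ∂μ ≤ K * ∫⁻ ω, ENNReal.ofReal (Ψ (Y ω)) ∂μ := by
  have hnn : ∀ a, 0 ≤ a → 0 ≤ Ψ a := fun a ha => hΨ0 ▸ hmono (by simp) ha ha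
  rw [lintegral_eq_lintegral_meas_lt μ (Filter.Eventually.of_forall fun ω => hnn _ (hX0 ω))
      (hΨ.measurable.comp hX).aemeasurable,
    lintegral_eq_lintegral_meas_lt μ (Filter.Eventually.of_forall fun ω => hnn _ (hY0 ω))
      (hΨ.measurable.comp hY).aemeasurable, ← lintegral_const_mul']
  rotate_left
  · exact ENNReal.natCast_ne_top K
  refine setLIntegral_mono' measurableSet_Ioi fun t ht => ?_
  -- By continuity, a superlevel set of `Ψ ∘ X` is a directed union of superlevel sets of `X`.
  have hset : {ω | t < Ψ (X ω)} = ⋃ q : {q : ℚ // 0 < (q : ℝ) ∧ t < Ψ q}, {ω | (q : ℝ) < X ω} := by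
    ext ω
    simp only [mem_ofPred_eq, mem_iUnion]
    constructor
    · intro hω
      have hXpos : 0 < X ω := by
        rcases (hX0 ω).eq_or_lt with h0 | h0
        · rw [← h0, hΨ0] at hω
          exact absurd hω (not_lt.2 (le_of_lt ht))
        · exact h0
      have hev : ∀ᶠ a in nhdsWithin (X ω) (Iio (X ω)), t < Ψ a ∧ 0 < a :=
        ((hΨ.continuousAt.eventually (lt_mem_nhds hω)).and (lt_mem_nhds hXpos)).filter_mono
          nhdsWithin_le_nhds
      obtain ⟨a, ha, ha'⟩ := (mem_nhdsLT_iff_exists_Ioo_subset.1 hev)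
      obtain ⟨q, hq1, hq2⟩ := exists_rat_btwn (show a < X ω from ha)
      obtain ⟨h1, h2⟩ := ha' ⟨hq1, hq2⟩
      exact ⟨⟨q, h2, h1⟩, hq2⟩
    · rintro ⟨⟨q, hq0, hq⟩, hqX⟩
      exact hq.trans_le (hmono hq0.le (hX0 ω) (le_of_lt hqX))
  rw [hset, Directed.measure_iUnion]
  · refine iSup_le fun q => (h _ q.2.1).trans ?_
    refine mul_le_mul_right (measure_mono fun ω hω => ?_) _
    exact q.2.2.trans_le (hmono (le_of_lt q.2.1) (hY0 _) (le_of_lt hω))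
  · intro p q
    rcases le_total p.1 q.1 with hpq | hpq
    · refine ⟨p, le_rfl, fun ω hω => lt_of_le_of_lt ?_ (show (q : ℝ) < X ω from hω)⟩
      exact_mod_cast hpq
    · refine ⟨q, fun ω hω => lt_of_le_of_lt ?_ (show (p : ℝ) < X ω from hω), le_rfl⟩
      exact_mod_cast hpq

end WeakType

/-! ### Sums of decreasing pair potentials over separated points -/

section Packing

open Metric Set Module Real

/-- The profile of `corePotential` as a function of the distance. -/
noncomputable def coreProfile (r₀ α t : ℝ) : ℝ≥0∞ :=
  if t < r₀ then (ENNReal.ofReal r₀ / ENNReal.ofReal t) ^ α else 0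

theorem antitone_coreProfile {r₀ α : ℝ} (hα : 0 ≤ α) : Antitone (coreProfile r₀ α) := by
  intro t t' h
  unfold coreProfile
  split_ifs with h1 h2
  · gcongr
  · linarith
  · exact zero_le
  · exact le_rfl

/-- The value of the integral of `t ↦ (b / t) ^ α` over the shell `a ≤ |y| ≤ b`, in units of the
volume of the ball of radius `a`, as a function of `Z = (b / a) ^ d`; for `α > d` it is rounded up
to the integral over `a ≤ |y|`. -/
noncomputable def coreSum (d : ℕ) (α Z : ℝ) : ℝ :=
  if (d : ℝ) < α then d / (α - d) * Z ^ (α / d) else Z * log⁺ Z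

theorem continuous_coreSum (d : ℕ) {α : ℝ} (hα : 0 ≤ α) : Continuous (coreSum d α) := by
  unfold coreSum
  split_ifs with h
  · exact continuous_const.mul (continuous_id.rpow_const fun _ => Or.inr (by positivity))
  · fun_prop

theorem monotoneOn_coreSum (d : ℕ) {α : ℝ} (hα : 0 ≤ α) : MonotoneOn (coreSum d α) (Ici 0) := by
  intro a ha b hb hab
  simp only [mem_Ici] at ha hb
  unfold coreSum
  split_ifs with h
  · have : 0 ≤ (d : ℝ) / (α - d) := div_nonneg (by positivity) (by linarith)
    gcongr
  · exact mul_le_mul hab (posLog_le_posLog ha hab) posLog_nonneg hb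

theorem coreSum_zero {d : ℕ} {α : ℝ} (hd : 1 ≤ d) : coreSum d α 0 = 0 := by
  have hd' : (1 : ℝ) ≤ d := by exact_mod_cast hd
  unfold coreSum
  split_ifs with h
  · rw [zero_rpow (div_pos (by linarith) (by linarith)).ne', mul_zero]
  · simp

theorem coreSum_nonneg {d : ℕ} {α Z : ℝ} (hd : 1 ≤ d) (hα : 0 ≤ α) (hZ : 0 ≤ Z) :
    0 ≤ coreSum d α Z :=
  coreSum_zero (α := α) hd ▸ monotoneOn_coreSum d hα (mem_Ici.2 le_rfl) hZ hZ

theorem mul_integral_le_coreSum {d : ℕ} {α a b : ℝ} (hd : 1 ≤ d) (hα : (d : ℝ) ≤ α) (ha : 0 < a)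
    (hab : a ≤ b) :
    b ^ α * (d * ∫ t in a..b, t ^ ((d : ℝ) - 1 - α)) ≤ a ^ d * coreSum d α ((b / a) ^ d) := by
  have hd0 : (0 : ℝ) < d := by exact_mod_cast hd
  have hb : 0 < b := ha.trans_le hab
  have hn : (0 : ℝ) ∉ uIcc a b := notMem_uIcc_of_lt ha hb
  unfold coreSum
  split_ifs with h
  · have hαd : 0 < α - d := by linarith
    rw [integral_rpow (Or.inr ⟨by linarith, hn⟩), show (d : ℝ) - 1 - α + 1 = -(α - d) by ring,
      ← rpow_natCast (b / a) d, ← rpow_mul (by positivity), mul_div_cancel₀ _ hd0.ne']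
    have h1 : a ^ (-(α - d)) = a ^ d / a ^ α := by
      rw [neg_sub, rpow_sub ha, rpow_natCast]
    have h2 : (b ^ (-(α - d)) - a ^ (-(α - d))) / -(α - d) ≤ a ^ (-(α - d)) / (α - d) := by
      rw [div_neg, ← neg_div]
      gcongr
      have : 0 ≤ b ^ (-(α - d)) := by positivity
      linarith
    calc b ^ α * (d * ((b ^ (-(α - d)) - a ^ (-(α - d))) / -(α - d)))
        ≤ b ^ α * (d * (a ^ (-(α - d)) / (α - d))) := by gcongr
      _ = a ^ d * (d / (α - d) * (b / a) ^ α) := by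
          rw [h1, div_rpow hb.le ha.le]
          ring
  · obtain rfl : α = d := le_antisymm (not_lt.1 h) hα
    have h1 : ∫ t in a..b, t ^ ((d : ℝ) - 1 - d) = log (b / a) := by
      rw [← integral_inv_of_pos ha hb]
      refine intervalIntegral.integral_congr fun t ht => ?_
      rw [show (d : ℝ) - 1 - d = -1 by ring, rpow_neg_one]
    rw [h1, posLog_pow, rpow_natCast, div_pow]
    have h2 : log (b / a) ≤ log⁺ (b / a) := le_max_right _ _
    have : a ^ d * (b ^ d / a ^ d * (d * log⁺ (b / a))) = b ^ d * (d * log⁺ (b / a)) := by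
      field_simp
    rw [this]
    gcongr

/-- The decay profile `1 / (1 + t ^ s)`, continued by `1` to negative `t`. -/
noncomputable def tailProfile (s t : ℝ) : ℝ≥0∞ :=
  ENNReal.ofReal (1 / (1 + max t 0 ^ s))

theorem antitone_tailProfile {s : ℝ} (hs : 0 ≤ s) : Antitone (tailProfile s) := by
  intro t t' h
  unfold tailProfile
  gcongr

theorem tailProfile_norm {E : Type*} [SeminormedAddGroup E] (s : ℝ) (y : E) :
    tailProfile s ‖y‖ = ENNReal.ofReal (1 / (1 + ‖y‖ ^ s)) := by
  rw [tailProfile, max_eq_left (norm_nonneg _)]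

/-- A sum of a decreasing potential over points that are `2 a` apart, and at distance at least
`2 a` from `z`, is bounded by the integral of the potential, in units of the volume of the balls of
radius `a` around the points. -/
theorem sum_antitone_mul_ball_le {E : Type*} [NormedAddCommGroup E] [MeasurableSpace E]
    [BorelSpace E] (ν : Measure E) [ν.IsAddHaarMeasure] {ι : Type*} (S : Finset ι) (x : ι → E)
    (z : E) {a : ℝ}
    {v : ℝ → ℝ≥0∞} (hv : Antitone v) (hz : ∀ k ∈ S, 2 * a ≤ ‖z - x k‖)
    (hx : ∀ k ∈ S, ∀ l ∈ S, k ≠ l → 2 * a ≤ ‖x k - x l‖) :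
    (∑ k ∈ S, v ‖z - x k‖) * ν (ball 0 a) ≤ ∫⁻ y in {y : E | a ≤ ‖y‖}, v (2 / 3 * ‖y‖) ∂ν := by
  have hdisj : (S : Set ι).PairwiseDisjoint fun k => ball (x k - z) a := by
    intro k hk l hl hkl
    refine ball_disjoint_ball ?_
    rw [dist_sub_right, dist_eq_norm]
    linarith [hx k hk l hl hkl]
  calc (∑ k ∈ S, v ‖z - x k‖) * ν (ball 0 a)
      = ∑ k ∈ S, ∫⁻ _ in ball (x k - z) a, v ‖z - x k‖ ∂ν := by
        rw [Finset.sum_mul]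
        refine Finset.sum_congr rfl fun k _ => ?_
        rw [setLIntegral_const, Measure.addHaar_ball_center ν (x k - z)]
    _ ≤ ∑ k ∈ S, ∫⁻ y in ball (x k - z) a, v (2 / 3 * ‖y‖) ∂ν := by
        refine Finset.sum_le_sum fun k hk => setLIntegral_mono' measurableSet_ball fun y hy => ?_
        refine hv ?_
        rw [mem_ball, dist_eq_norm] at hy
        have h1 : ‖y‖ ≤ ‖y - (x k - z)‖ + ‖x k - z‖ := norm_le_norm_sub_add _ _
        have h2 := hz k hk
        rw [norm_sub_rev] at h2 ⊢
        linarith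
    _ = ∫⁻ y in ⋃ k ∈ S, ball (x k - z) a, v (2 / 3 * ‖y‖) ∂ν :=
        (lintegral_biUnion_finset hdisj (fun _ _ => measurableSet_ball) _).symm
    _ ≤ ∫⁻ y in {y : E | a ≤ ‖y‖}, v (2 / 3 * ‖y‖) ∂ν := by
        refine lintegral_mono_set (iUnion₂_subset fun k hk y hy => ?_)
        rw [mem_ball, dist_eq_norm] at hy
        have h1 : ‖x k - z‖ ≤ ‖x k - z - y‖ + ‖y‖ := norm_le_norm_sub_add _ _
        have h2 := hz k hk
        rw [norm_sub_rev] at h2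
        rw [norm_sub_rev] at hy
        simp only [mem_ofPred_eq]
        linarith

variable {E : Type*} [NormedAddCommGroup E] [NormedSpace ℝ E] [FiniteDimensional ℝ E]
  [MeasurableSpace E] [BorelSpace E] (ν : Measure E) [ν.IsAddHaarMeasure]

theorem lintegral_shell_rpow [Nontrivial E] {a b : ℝ} (β : ℝ) (ha : 0 < a) (hab : a ≤ b) :
    ∫⁻ y in {y : E | a ≤ ‖y‖ ∧ ‖y‖ ≤ b}, ENNReal.ofReal (‖y‖ ^ β) ∂ν =
      ν (ball 0 1) * ENNReal.ofReal (finrank ℝ E *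
        ∫ t in a..b, t ^ ((finrank ℝ E : ℝ) - 1 + β)) := by
  have hd : 1 ≤ finrank ℝ E := finrank_pos
  set f : ℝ → ℝ := (Icc a b).indicator fun t => t ^ β with hf
  have hm : MeasurableSet {y : E | a ≤ ‖y‖ ∧ ‖y‖ ≤ b} :=
    (measurableSet_le measurable_const measurable_norm).inter
      (measurableSet_le measurable_norm measurable_const)
  have hsub : Icc a b ⊆ Ioi 0 := fun t ht => ha.trans_le ht.1
  have hfun : (fun y : ℝ => y ^ (finrank ℝ E - 1) • f y) =
      (Icc a b).indicator fun t => t ^ ((finrank ℝ E : ℝ) - 1 + β) := by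
    ext t
    by_cases ht : t ∈ Icc a b
    · have ht0 : 0 < t := hsub ht
      rw [hf, indicator_of_mem ht, indicator_of_mem ht, smul_eq_mul, rpow_add ht0,
        ← rpow_natCast t (finrank ℝ E - 1), Nat.cast_sub hd, Nat.cast_one]
    · rw [hf, indicator_of_notMem ht, indicator_of_notMem ht, smul_zero]
  have hcont : ContinuousOn (fun t : ℝ => t ^ ((finrank ℝ E : ℝ) - 1 + β)) (Icc a b) := fun t ht =>
    (continuousAt_rpow_const _ _ (Or.inl (hsub ht).ne')).continuousWithinAt
  have hint : Integrable (fun y : E => f ‖y‖) ν := by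
    rw [integrable_fun_norm_addHaar, hfun]
    exact ((hcont.integrableOn_compact isCompact_Icc).integrable_indicator
      measurableSet_Icc).integrableOn
  have hf0 : ∀ t, 0 ≤ f t := fun t =>
    indicator_nonneg (fun t ht => rpow_nonneg (hsub ht).le _) t
  calc ∫⁻ y in {y : E | a ≤ ‖y‖ ∧ ‖y‖ ≤ b}, ENNReal.ofReal (‖y‖ ^ β) ∂ν
      = ∫⁻ y, ENNReal.ofReal (f ‖y‖) ∂ν := by
        rw [← lintegral_indicator hm]
        refine lintegral_congr fun y => ?_
        by_cases hy : a ≤ ‖y‖ ∧ ‖y‖ ≤ b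
        · rw [indicator_of_mem (by exact hy), hf, indicator_of_mem (by exact hy)]
        · rw [indicator_of_notMem (by exact hy), hf, indicator_of_notMem (by exact hy),
            ENNReal.ofReal_zero]
    _ = ENNReal.ofReal (∫ y, f ‖y‖ ∂ν) :=
        (ofReal_integral_eq_lintegral_ofReal hint (Filter.Eventually.of_forall fun y => hf0 _)).symm
    _ = ν (ball 0 1) * ENNReal.ofReal (finrank ℝ E *
        ∫ t in a..b, t ^ ((finrank ℝ E : ℝ) - 1 + β)) := by
        rw [integral_fun_norm_addHaar, hfun, setIntegral_indicator measurableSet_Icc,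
          inter_eq_right.2 hsub, integral_Icc_eq_integral_Ioc, ← intervalIntegral.integral_of_le hab,
          nsmul_eq_mul, smul_eq_mul, mul_left_comm, ENNReal.ofReal_mul measureReal_nonneg,
          ofReal_measureReal measure_ball_lt_top.ne]

theorem lintegral_coreProfile_le [Nontrivial E] {r₀ α a : ℝ} (hα : (finrank ℝ E : ℝ) ≤ α)
    (ha : 0 < a) (hr : 0 ≤ r₀) :
    ∫⁻ y in {y : E | a ≤ ‖y‖}, coreProfile r₀ α (2 / 3 * ‖y‖) ∂ν ≤
      ν (ball 0 a) * ENNReal.ofReal (coreSum (finrank ℝ E) α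
        ((3 * r₀ / (2 * a)) ^ finrank ℝ E)) := by
  have hd : 1 ≤ finrank ℝ E := finrank_pos
  set b := 3 * r₀ / 2 with hb
  have hα0 : 0 ≤ α := (Nat.cast_nonneg _).trans hα
  have hm : MeasurableSet {y : E | a ≤ ‖y‖} := measurableSet_le measurable_const measurable_norm
  have hm' : MeasurableSet {y : E | a ≤ ‖y‖ ∧ ‖y‖ ≤ b} :=
    hm.inter (measurableSet_le measurable_norm measurable_const)
  rcases lt_or_ge b a with hba | hab
  · refine le_of_eq_of_le ?_ zero_le
    rw [setLIntegral_congr_fun (g := fun _ => 0) hm, lintegral_zero]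
    intro y hy
    have : ¬ 2 / 3 * ‖y‖ < r₀ := by
      have : a ≤ ‖y‖ := hy
      linarith
    simp only [coreProfile, if_neg this]
  calc ∫⁻ y in {y : E | a ≤ ‖y‖}, coreProfile r₀ α (2 / 3 * ‖y‖) ∂ν
      ≤ ∫⁻ y in {y : E | a ≤ ‖y‖ ∧ ‖y‖ ≤ b}, ENNReal.ofReal (b ^ α) *
          ENNReal.ofReal (‖y‖ ^ (-α)) ∂ν := by
        rw [← lintegral_indicator hm, ← lintegral_indicator hm']
        refine lintegral_mono fun y => ?_
        by_cases hy : a ≤ ‖y‖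
        swap
        · rw [indicator_of_notMem (by exact hy)]; exact zero_le
        rw [indicator_of_mem (by exact hy), coreProfile]
        split_ifs with hlt
        swap
        · exact zero_le
        have hy0 : 0 < ‖y‖ := ha.trans_le hy
        rw [indicator_of_mem (show y ∈ {y : E | a ≤ ‖y‖ ∧ ‖y‖ ≤ b} from ⟨hy, by linarith⟩),
          ← ENNReal.ofReal_div_of_pos (by positivity),
          ENNReal.ofReal_rpow_of_nonneg (by positivity) hα0, ← ENNReal.ofReal_mul
            (rpow_nonneg (by positivity) _), rpow_neg hy0.le, ← div_eq_mul_inv,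
          ← div_rpow (by positivity) hy0.le]
        refine le_of_eq ?_
        congr 2
        rw [hb]; field_simp
    _ = ENNReal.ofReal (b ^ α) * (ν (ball 0 1) * ENNReal.ofReal (finrank ℝ E *
        ∫ t in a..b, t ^ ((finrank ℝ E : ℝ) - 1 - α))) := by
        rw [lintegral_const_mul' _ _ ENNReal.ofReal_ne_top, lintegral_shell_rpow ν _ ha hab,
          sub_eq_add_neg _ α]
    _ = ν (ball 0 1) * ENNReal.ofReal (b ^ α * (finrank ℝ E *
        ∫ t in a..b, t ^ ((finrank ℝ E : ℝ) - 1 - α))) := by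
        rw [ENNReal.ofReal_mul (p := b ^ α) (rpow_nonneg (by positivity) _), mul_left_comm]
    _ ≤ ν (ball 0 1) * ENNReal.ofReal (a ^ finrank ℝ E *
        coreSum (finrank ℝ E) α ((b / a) ^ finrank ℝ E)) := by
        exact mul_le_mul_right (ENNReal.ofReal_le_ofReal
          (mul_integral_le_coreSum hd hα ha hab)) _
    _ = _ := by
        rw [ENNReal.ofReal_mul (by positivity), Measure.addHaar_ball _ _ ha.le, hb, div_div]
        ring

theorem exists_lintegral_tail_le {s : ℝ} (hs : (finrank ℝ E : ℝ) < s) :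
    ∃ C : ℝ, 0 < C ∧ ∫⁻ y : E, ENNReal.ofReal (1 / (1 + (2 / 3 * ‖y‖) ^ s)) ∂ν ≤
      ν (ball 0 1) * ENNReal.ofReal C := by
  have hs0 : 0 < s := (Nat.cast_nonneg _).trans_lt hs
  have hfin := finite_integral_one_add_norm (μ := ν) hs
  have hball : ν (ball (0 : E) 1) ≠ 0 := (measure_ball_pos _ _ one_pos).ne'
  set I := ∫⁻ x : E, ENNReal.ofReal ((1 + ‖x‖) ^ (-s)) ∂ν with hI
  have hpt : ∀ t : ℝ, 0 ≤ t → 1 / (1 + (2 / 3 * t) ^ s) ≤ 3 ^ s * (1 + t) ^ (-s) := by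
    intro t ht
    rw [rpow_neg (by positivity), ← div_eq_mul_inv, div_le_div_iff₀ (by positivity) (by positivity),
      one_mul, mul_add, mul_one, ← mul_rpow (by norm_num) (by positivity)]
    rcases le_total t 1 with h | h
    · have h1 : (1 + t) ^ s ≤ 3 ^ s := by gcongr; linarith
      have h2 : 0 ≤ (3 * (2 / 3 * t)) ^ s := by positivity
      linarith
    · have h1 : (1 + t) ^ s ≤ (3 * (2 / 3 * t)) ^ s := by gcongr; linarith
      have h2 : 0 ≤ (3 : ℝ) ^ s := by positivity
      linarith
  have hlt : ENNReal.ofReal (3 ^ s) * I / ν (ball 0 1) < ∞ :=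
    ENNReal.div_lt_top (ENNReal.mul_ne_top ENNReal.ofReal_ne_top hfin.ne) hball
  refine ⟨(ENNReal.ofReal (3 ^ s) * I / ν (ball 0 1)).toReal + 1, by positivity, ?_⟩
  calc ∫⁻ y : E, ENNReal.ofReal (1 / (1 + (2 / 3 * ‖y‖) ^ s)) ∂ν
      ≤ ∫⁻ y : E, ENNReal.ofReal (3 ^ s) * ENNReal.ofReal ((1 + ‖y‖) ^ (-s)) ∂ν := by
        refine lintegral_mono fun y => ?_
        rw [← ENNReal.ofReal_mul (by positivity)]
        exact ENNReal.ofReal_le_ofReal (hpt _ (norm_nonneg _))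
    _ = ENNReal.ofReal (3 ^ s) * I := lintegral_const_mul' _ _ ENNReal.ofReal_ne_top
    _ = ν (ball 0 1) * (ENNReal.ofReal (3 ^ s) * I / ν (ball 0 1)) :=
        (ENNReal.mul_div_cancel hball measure_ball_lt_top.ne).symm
    _ ≤ _ := by
        gcongr
        rw [← ENNReal.ofReal_toReal hlt.ne]
        refine ENNReal.ofReal_le_ofReal ?_
        rw [ENNReal.ofReal_toReal hlt.ne]
        linarith


/-- Summing `f j k` over the pairs `j < k` of a symmetric `f`, each pair may be counted from the
point with the smaller value of `R`. -/
theorem sum_pairs_le_sum_radius_le {n : ℕ} (f : Fin n → Fin n → ℝ≥0∞)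
    (hf : ∀ j k, f j k = f k j) (R : Fin n → ℝ) :
    ∑ j, ∑ k ∈ Finset.Ioi j, f j k ≤ ∑ i, ∑ k with k ≠ i ∧ R i ≤ R k, f i k := by
  have h1 : ∀ j k : Fin n, (if j < k then f j k else 0) ≤
      (if j < k ∧ R j ≤ R k then f j k else 0) + (if j < k ∧ R k ≤ R j then f k j else 0) := by
    intro j k
    by_cases hjk : j < k
    · rcases le_total (R j) (R k) with h | h
      · simp [hjk, h]
      · simp [hjk, h, hf j k]
    · simp [hjk]
  calc ∑ j, ∑ k ∈ Finset.Ioi j, f j k = ∑ j, ∑ k, if j < k then f j k else 0 := by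
        refine Finset.sum_congr rfl fun j _ => ?_
        rw [← Finset.sum_filter]
        congr 1
        ext k; simp
    _ ≤ ∑ j, ∑ k, ((if j < k ∧ R j ≤ R k then f j k else 0) +
          (if j < k ∧ R k ≤ R j then f k j else 0)) :=
        Finset.sum_le_sum fun j _ => Finset.sum_le_sum fun k _ => h1 j k
    _ = ∑ i, ∑ k, ((if i < k ∧ R i ≤ R k then f i k else 0) +
          (if k < i ∧ R i ≤ R k then f i k else 0)) := by
        simp_rw [Finset.sum_add_distrib]
        congr 1
        exact Finset.sum_comm
    _ = ∑ i, ∑ k with k ≠ i ∧ R i ≤ R k, f i k := by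
        refine Finset.sum_congr rfl fun i _ => ?_
        rw [Finset.sum_filter]
        refine Finset.sum_congr rfl fun k _ => ?_
        rcases lt_trichotomy i k with h | h | h
        · simp [h, h.ne', h.not_gt]
        · simp [h]
        · simp [h, h.ne, h.not_gt]

end Packing

/-- In a configuration whose points are separated by `η` times the larger of their radii, the
interaction energy is bounded by a sum of one-body terms: each pair is charged to the point of
smaller radius, and the points of larger radius around it are then sparse enough for their total
potential to be compared with an integral. -/
theorem exists_pairEnergy_le {d : ℕ} (hd : 1 ≤ d) {α s : ℝ} (hα : (d : ℝ) ≤ α)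
    (hs : (d : ℝ) < s) :
    ∃ C : ℝ, 0 < C ∧ ∀ (w : EuclideanSpace ℝ (Fin d) → EReal) (κ r₀ : ℝ),
      IsShortRangePotential w κ r₀ α s → ∀ η : ℝ, 0 < η → ∀ (n : ℕ)
      (x : Fin n → EuclideanSpace ℝ (Fin d)) (R : Fin n → ℝ), (∀ i, 0 < R i) →
      (∀ i j, i ≠ j → η * max (R i) (R j) ≤ ‖x i - x j‖) →
      (pairEnergy w x).toENNReal ≤ ∑ i, ENNReal.ofReal (κ * (C * (2 / (η * R i)) ^ d +
        coreSum d α ((3 * r₀ / (η * R i)) ^ d))) := by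
  have hfr : Module.finrank ℝ (EuclideanSpace ℝ (Fin d)) = d := finrank_euclideanSpace_fin
  have : Nontrivial (EuclideanSpace ℝ (Fin d)) :=
    Module.nontrivial_of_finrank_pos (R := ℝ) (by omega)
  obtain ⟨C, hC, hCle⟩ := exists_lintegral_tail_le
    (volume : Measure (EuclideanSpace ℝ (Fin d))) (s := s) (by rw [hfr]; exact hs)
  refine ⟨C, hC, fun w κ r₀ hw η hη n x R hR hsep => ?_⟩
  have hα0 : 0 ≤ α := hw.alpha_nonneg
  have hs0 : 0 ≤ s := ((Nat.cast_nonneg d).trans_lt hs).le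
  set v : ℝ → ℝ≥0∞ := fun t => coreProfile r₀ α t + tailProfile s t with hv
  have hanti : Antitone v := fun a b h =>
    add_le_add (antitone_coreProfile hα0 h) (antitone_tailProfile hs0 h)
  have hwv : ∀ y, w y ≤ ((ENNReal.ofReal κ * v ‖y‖ : ℝ≥0∞) : EReal) := by
    intro y
    rw [hv]
    simp only [tailProfile_norm]
    exact hw.upperRegular y
  have hone : ∀ i, ∑ k with k ≠ i ∧ R i ≤ R k, v ‖x i - x k‖ ≤
      ENNReal.ofReal (C * (2 / (η * R i)) ^ d + coreSum d α ((3 * r₀ / (η * R i)) ^ d)) := by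
    intro i
    set a := η * R i / 2 with ha
    have ha0 : 0 < a := by have := hR i; positivity
    have hball : volume (Metric.ball (0 : EuclideanSpace ℝ (Fin d)) a) ≠ 0 :=
      (Metric.measure_ball_pos _ _ ha0).ne'
    have hball' : volume (Metric.ball (0 : EuclideanSpace ℝ (Fin d)) a) ≠ ∞ :=
      measure_ball_lt_top.ne
    refine (ENNReal.mul_le_mul_iff_left hball hball').1 ?_
    calc (∑ k with k ≠ i ∧ R i ≤ R k, v ‖x i - x k‖) *
          volume (Metric.ball (0 : EuclideanSpace ℝ (Fin d)) a)
        ≤ ∫⁻ y in {y : EuclideanSpace ℝ (Fin d) | a ≤ ‖y‖}, v (2 / 3 * ‖y‖) := by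
          refine sum_antitone_mul_ball_le volume _ x (x i) hanti ?_ ?_
          · intro k hk
            simp only [Finset.mem_filter, Finset.mem_univ, true_and] at hk
            refine le_trans ?_ (hsep i k hk.1.symm)
            rw [ha, mul_div_cancel₀ _ two_ne_zero]
            gcongr
            exact le_max_left _ _
          · intro k hk l hl hkl
            simp only [Finset.mem_filter, Finset.mem_univ, true_and] at hk
            refine le_trans ?_ (hsep k l hkl)
            rw [ha, mul_div_cancel₀ _ two_ne_zero]
            gcongr
            exact hk.2.trans (le_max_left _ _)
      _ = (∫⁻ y in {y : EuclideanSpace ℝ (Fin d) | a ≤ ‖y‖}, coreProfile r₀ α (2 / 3 * ‖y‖)) +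
          ∫⁻ y in {y : EuclideanSpace ℝ (Fin d) | a ≤ ‖y‖}, tailProfile s (2 / 3 * ‖y‖) := by
          refine lintegral_add_right _ ?_
          exact (antitone_tailProfile hs0).measurable.comp (measurable_norm.const_mul _)
      _ ≤ volume (Metric.ball (0 : EuclideanSpace ℝ (Fin d)) a) *
            ENNReal.ofReal (coreSum d α ((3 * r₀ / (2 * a)) ^ d)) +
          volume (Metric.ball (0 : EuclideanSpace ℝ (Fin d)) 1) * ENNReal.ofReal C := by
          refine add_le_add ?_ ?_
          · have := lintegral_coreProfile_le (volume : Measure (EuclideanSpace ℝ (Fin d)))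
              (α := α) (by rw [hfr]; exact hα) ha0 hw.r₀_nonneg
            rwa [hfr] at this
          · refine (setLIntegral_le_lintegral _ _).trans (le_trans (le_of_eq ?_) hCle)
            refine lintegral_congr fun y => ?_
            rw [tailProfile, max_eq_left (by positivity)]
      _ = ENNReal.ofReal (C * (2 / (η * R i)) ^ d + coreSum d α ((3 * r₀ / (η * R i)) ^ d)) *
          volume (Metric.ball (0 : EuclideanSpace ℝ (Fin d)) a) := by
          have hRi := hR i
          have hr0 := hw.r₀_nonneg
          rw [ENNReal.ofReal_add (by positivity) (coreSum_nonneg hd hα0 (by positivity)), add_mul,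
            add_comm, Measure.addHaar_ball volume (0 : EuclideanSpace ℝ (Fin d)) ha0.le, hfr,
            ha, mul_div_cancel₀ _ two_ne_zero]
          congr 1
          · rw [← mul_assoc, ← ENNReal.ofReal_mul (by positivity), mul_comm]
            congr 2
            rw [mul_assoc, ← mul_pow, div_mul_div_cancel₀ (by positivity), div_self two_ne_zero,
              one_pow, mul_one]
          · rw [mul_comm]
  calc (pairEnergy w x).toENNReal
      ≤ ∑ j, ∑ k ∈ Finset.Ioi j, ENNReal.ofReal κ * v ‖x j - x k‖ := by
        rw [← EReal.toENNReal_coe (x := ∑ j, ∑ k ∈ Finset.Ioi j, ENNReal.ofReal κ * v ‖x j - x k‖)]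
        refine EReal.toENNReal_le_toENNReal ?_
        have hcoe : ∀ {ι : Type} (S : Finset ι) (f : ι → ℝ≥0∞),
            ((∑ i ∈ S, f i : ℝ≥0∞) : EReal) = ∑ i ∈ S, (f i : EReal) := fun S f =>
          map_sum (⟨⟨fun y : ℝ≥0∞ => (y : EReal), rfl⟩, EReal.coe_ennreal_add⟩ :
            ℝ≥0∞ →+ EReal) f S
        rw [hcoe]
        refine Finset.sum_le_sum fun j _ => ?_
        rw [hcoe]
        exact Finset.sum_le_sum fun k _ => hwv _
    _ ≤ ∑ i, ∑ k with k ≠ i ∧ R i ≤ R k, ENNReal.ofReal κ * v ‖x i - x k‖ :=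
        sum_pairs_le_sum_radius_le _ (fun j k => by rw [norm_sub_rev]) R
    _ ≤ _ := by
        refine Finset.sum_le_sum fun i _ => ?_
        rw [← Finset.mul_sum, ENNReal.ofReal_mul hw.kappa_pos.le]
        gcongr
        exact hone i

/-! ### The one-body bound in terms of the density -/

section OneBody

open Metric Set Module Real

theorem mul_coreSum_le_of_lt {d : ℕ} {α η b r₀ t : ℝ} (hd : 1 ≤ d) (hα : (d : ℝ) < α) (hη : 0 < η)
    (hb : 0 < b) (hr : 0 ≤ r₀) (ht : 0 ≤ t) :
    t * coreSum d α ((3 * r₀ / η) ^ d * (t / b)) =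
      d / (α - d) * ((3 / η) ^ d / b) ^ (α / d) * (r₀ ^ α * t ^ (1 + α / d)) := by
  have hd0 : (0 : ℝ) < d := by exact_mod_cast hd
  have hα0 : 0 < α := hd0.trans hα
  have h1 : (3 * r₀ / η) ^ d * (t / b) = ((3 / η) ^ d / b) * (r₀ ^ d * t) := by
    rw [show 3 * r₀ / η = 3 / η * r₀ by ring, mul_pow]; ring
  have h2 : (r₀ ^ d) ^ (α / d) = r₀ ^ α := by
    rw [← rpow_natCast, ← rpow_mul hr, mul_div_cancel₀ _ hd0.ne']
  rw [coreSum, if_pos hα, h1, mul_rpow (by positivity) (by positivity),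
    mul_rpow (by positivity) ht, h2, rpow_add_of_nonneg ht zero_le_one (by positivity), rpow_one]
  ring

theorem mul_coreSum_self_le {d : ℕ} {η b r₀ t : ℝ} (hη : 0 < η)
    (hb : 0 < b) (hr : 0 ≤ r₀) (ht : 0 ≤ t) :
    t * coreSum d d ((3 * r₀ / η) ^ d * (t / b)) ≤
      (3 / η) ^ d / b * (1 + log⁺ ((3 / η) ^ d / b)) *
        (r₀ ^ d * (t ^ 2 + t ^ 2 * max (log (r₀ ^ d * t)) 0)) := by
  set D := (3 / η) ^ d / b with hD
  have hD0 : 0 < D := by positivity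
  have h1 : (3 * r₀ / η) ^ d * (t / b) = D * (r₀ ^ d * t) := by
    rw [show 3 * r₀ / η = 3 / η * r₀ by ring, mul_pow, hD]; ring
  have h2 : log⁺ (D * (r₀ ^ d * t)) ≤ log⁺ D + log⁺ (r₀ ^ d * t) := posLog_mul
  rw [coreSum, if_neg (lt_irrefl _), h1, max_comm, ← posLog_apply]
  set L := log⁺ D
  set M := log⁺ (r₀ ^ d * t)
  have hL : 0 ≤ L := posLog_nonneg
  have hM : 0 ≤ M := posLog_nonneg
  calc t * (D * (r₀ ^ d * t) * log⁺ (D * (r₀ ^ d * t)))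
      ≤ t * (D * (r₀ ^ d * t) * (L + M)) := by gcongr
    _ = D * (r₀ ^ d * t ^ 2) * (L + M) := by ring
    _ ≤ D * (r₀ ^ d * t ^ 2) * ((1 + L) * (1 + M)) := by
        gcongr
        nlinarith
    _ = _ := by ring

/-- The pointwise core bounds, integrated. -/
theorem exists_lintegral_coreSum_le {d : ℕ} (hd : 1 ≤ d) {α η b : ℝ} (hα : (d : ℝ) ≤ α)
    (hη : 0 < η) (hb : 0 < b) :
    ∃ B : ℝ, 0 ≤ B ∧ ∀ κ r₀ : ℝ, 0 ≤ κ → 0 ≤ r₀ → ∀ ρ : EuclideanSpace ℝ (Fin d) → ℝ,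
      Measurable ρ → (∀ x, 0 ≤ ρ x) →
      ∫⁻ x, ENNReal.ofReal (κ * (ρ x * coreSum d α ((3 * r₀ / η) ^ d * (ρ x / b)))) ≤
        ENNReal.ofReal B * coreTerm κ r₀ α ρ := by
  rcases hα.lt_or_eq with hlt | rfl
  · have hαd : 0 < α - d := by linarith
    refine ⟨d / (α - d) * ((3 / η) ^ d / b) ^ (α / d), by positivity,
      fun κ r₀ hκ hr ρ hρm hρ => ?_⟩
    rw [coreTerm, if_pos hlt, ← lintegral_const_mul' _ _ ENNReal.ofReal_ne_top,
      ← lintegral_const_mul' _ _ ENNReal.ofReal_ne_top]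
    refine lintegral_mono fun x => ?_
    rw [← ENNReal.ofReal_mul (by positivity), ← ENNReal.ofReal_mul (by positivity),
      mul_coreSum_le_of_lt hd hlt hη hb hr (hρ x)]
    refine ENNReal.ofReal_le_ofReal (le_of_eq ?_)
    ring
  · refine ⟨(3 / η) ^ d / b * (1 + log⁺ ((3 / η) ^ d / b)),
      mul_nonneg (by positivity) (add_nonneg zero_le_one posLog_nonneg),
      fun κ r₀ hκ hr ρ hρm hρ => ?_⟩
    have hB : 0 ≤ (3 / η) ^ d / b * (1 + log⁺ ((3 / η) ^ d / b)) :=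
      mul_nonneg (by positivity) (add_nonneg zero_le_one posLog_nonneg)
    rw [coreTerm, if_neg (lt_irrefl _), ← lintegral_add_left (by fun_prop),
      ← lintegral_const_mul' _ _ ENNReal.ofReal_ne_top,
      ← lintegral_const_mul' _ _ ENNReal.ofReal_ne_top]
    refine lintegral_mono fun x => ?_
    have h0 : 0 ≤ ρ x ^ 2 * max (log (r₀ ^ d * ρ x)) 0 :=
      mul_nonneg (by positivity) (le_max_right _ _)
    rw [← ENNReal.ofReal_add (by positivity) h0, ← ENNReal.ofReal_mul (by positivity),
      ← ENNReal.ofReal_mul hB]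
    refine ENNReal.ofReal_le_ofReal ?_
    calc _ ≤ κ * ((3 / η) ^ d / b * (1 + log⁺ ((3 / η) ^ d / b)) *
        (r₀ ^ d * (ρ x ^ 2 + ρ x ^ 2 * max (log (r₀ ^ d * ρ x)) 0))) :=
          mul_le_mul_of_nonneg_left (mul_coreSum_self_le hη hb hr (hρ x)) hκ
      _ = _ := by ring

/-- If the balls of radius `r x` around all points carry a fixed amount of mass, then the integral
of the one-body energy at radius `r` is bounded locally in terms of the density. -/
theorem exists_lintegral_radius_le {d : ℕ} (hd : 1 ≤ d) {α η c A : ℝ} (hα : (d : ℝ) ≤ α)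
    (hη : 0 < η) (hc : 0 < c) (hA : 0 ≤ A) :
    ∃ C : ℝ, 0 < C ∧ ∀ κ r₀ : ℝ, 0 < κ → 0 ≤ r₀ → ∀ ρ : EuclideanSpace ℝ (Fin d) → ℝ,
      Measurable ρ → (∀ x, 0 ≤ ρ x) → Integrable ρ → ∀ r : EuclideanSpace ℝ (Fin d) → ℝ,
      Measurable r → (∀ x, 0 < r x) →
      (∀ x, ENNReal.ofReal c ≤
        volume.withDensity (fun x => ENNReal.ofReal (ρ x)) (closedBall x (r x))) →
      ∫⁻ x, ENNReal.ofReal (κ * (A * (2 / (η * r x)) ^ d +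
          coreSum d α ((3 * r₀ / (η * r x)) ^ d)))
          ∂(volume.withDensity fun x => ENNReal.ofReal (ρ x)) ≤
        ENNReal.ofReal (C * κ) * (∫⁻ x, ENNReal.ofReal (ρ x ^ 2)) +
          ENNReal.ofReal C * coreTerm κ r₀ α ρ := by
  have hd0 : (0 : ℝ) < d := by exact_mod_cast hd
  have hα0 : 0 ≤ α := hd0.le.trans hα
  have hfr : finrank ℝ (EuclideanSpace ℝ (Fin d)) = d := finrank_euclideanSpace_fin
  set ω := (volume : Measure (EuclideanSpace ℝ (Fin d))).real (ball 0 1) with hω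
  have hωball : volume (ball (0 : EuclideanSpace ℝ (Fin d)) 1) = ENNReal.ofReal ω :=
    (ofReal_measureReal measure_ball_lt_top.ne).symm
  have hω0 : 0 < ω := by
    rw [← ENNReal.ofReal_pos, ← hωball]
    exact measure_ball_pos _ _ one_pos
  set b := c / (2 * ω) with hb
  have hb0 : 0 < b := by positivity
  obtain ⟨K, hK⟩ := exists_measure_radius_lt_le (volume : Measure (EuclideanSpace ℝ (Fin d)))
  obtain ⟨B, hB0, hB⟩ := exists_lintegral_coreSum_le hd hα hη hb0
  set A' := A * (2 / η) ^ d / b with hA'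
  have hA'0 : 0 ≤ A' := by positivity
  refine ⟨(K + 1) * (A' + B + 1), by positivity, fun κ r₀ hκ hr₀ ρ hρm hρ hρi r hrm hr hball => ?_⟩
  set μ := volume.withDensity fun x => ENNReal.ofReal (ρ x) with hμ
  have hfin : IsFiniteMeasure μ := isFiniteMeasure_withDensity_ofReal hρi.2
  set Ψ : ℝ → ℝ := fun X => κ * (A * ((2 / η) ^ d * X) + coreSum d α ((3 * r₀ / η) ^ d * X))
    with hΨ
  have hΨX : ∀ x, κ * (A * (2 / (η * r x)) ^ d + coreSum d α ((3 * r₀ / (η * r x)) ^ d)) =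
      Ψ ((r x ^ d)⁻¹) := by
    intro x
    simp only [hΨ]
    rw [← div_div, ← div_div, div_pow _ (r x), div_pow _ (r x)]
    rfl
  have hΨc : Continuous Ψ := by
    have := continuous_coreSum d hα0
    fun_prop
  have hΨm : MonotoneOn Ψ (Ici 0) := by
    intro X hX Y hY hXY
    have hX' : 0 ≤ X := hX
    have hY' : 0 ≤ Y := hY
    have h1 : coreSum d α ((3 * r₀ / η) ^ d * X) ≤ coreSum d α ((3 * r₀ / η) ^ d * Y) :=
      monotoneOn_coreSum d hα0 (mem_Ici.2 (by positivity)) (mem_Ici.2 (by positivity)) (by gcongr)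
    simp only [hΨ]
    gcongr
  have hΨ0 : Ψ 0 = 0 := by simp [hΨ, coreSum_zero hd]
  have hweak : ∀ t : ℝ, 0 < t → μ {x | t < (r x ^ d)⁻¹} ≤ K * μ {x | t < ρ x / b} := by
    intro t ht
    set τ := (t⁻¹) ^ ((d : ℝ)⁻¹) with hτ
    have hτ0 : 0 < τ := by positivity
    have hτd : τ ^ d = t⁻¹ := rpow_inv_natCast_pow (by positivity) (by omega)
    have hE := hK (fun x => ENNReal.ofReal (ρ x)) (by fun_prop) (ENNReal.ofReal c)
      (ENNReal.ofReal b) ENNReal.ofReal_ne_top (by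
        rw [hωball, ← ENNReal.ofReal_mul hb0.le, ← ENNReal.ofReal_ofNat,
          ← ENNReal.ofReal_mul (by norm_num)]
        refine ENNReal.ofReal_le_ofReal (le_of_eq ?_)
        rw [hb]; field_simp) r hr hball hfin τ
    convert hE using 3
    · ext x
      rw [lt_inv_comm₀ ht (pow_pos (hr x) d), ← hτd,
        pow_lt_pow_iff_left₀ (hr x).le hτ0.le (by omega)]
    · ext x
      rw [mem_ofPred_eq, mem_ofPred_eq, hfr, ← ENNReal.ofReal_pow hτ0.le,
        ← ENNReal.ofReal_mul (hρ x), ENNReal.ofReal_lt_ofReal_iff_of_nonneg hb0.le, hτd,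
        lt_div_iff₀ hb0, ← div_eq_mul_inv, lt_div_iff₀ ht, mul_comm]
  have hmain := lintegral_comp_le_of_measure_lt_le (μ := μ) (X := fun x => (r x ^ d)⁻¹)
    (Y := fun x => ρ x / b) (by fun_prop) (by fun_prop)
    (fun x => inv_nonneg.2 (pow_nonneg (hr x).le d)) (fun x => div_nonneg (hρ x) hb0.le)
    hweak hΨc hΨm hΨ0
  simp only [hΨX]
  refine hmain.trans ?_
  have hsplit : ∫⁻ x, ENNReal.ofReal (Ψ (ρ x / b)) ∂μ ≤
      ENNReal.ofReal (A' * κ) * (∫⁻ x, ENNReal.ofReal (ρ x ^ 2)) +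
        ENNReal.ofReal B * coreTerm κ r₀ α ρ := by
    have hΨm' : Measurable fun x => ENNReal.ofReal (Ψ (ρ x / b)) :=
      (hΨc.measurable.comp (hρm.div_const b)).ennreal_ofReal
    rw [hμ, lintegral_withDensity_eq_lintegral_mul _ hρm.ennreal_ofReal hΨm']
    calc _ = ∫⁻ x, (ENNReal.ofReal (A' * κ) * ENNReal.ofReal (ρ x ^ 2) +
          ENNReal.ofReal (κ * (ρ x * coreSum d α ((3 * r₀ / η) ^ d * (ρ x / b))))) := by
          refine lintegral_congr fun x => ?_
          have hx := hρ x
          have h1 : 0 ≤ coreSum d α ((3 * r₀ / η) ^ d * (ρ x / b)) :=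
            coreSum_nonneg hd hα0 (by positivity)
          rw [Pi.mul_apply, ← ENNReal.ofReal_mul hx, ← ENNReal.ofReal_mul (by positivity),
            ← ENNReal.ofReal_add (by positivity) (by positivity)]
          congr 1
          simp only [hΨ, hA']
          ring
      _ = ENNReal.ofReal (A' * κ) * (∫⁻ x, ENNReal.ofReal (ρ x ^ 2)) +
          ∫⁻ x, ENNReal.ofReal (κ * (ρ x * coreSum d α ((3 * r₀ / η) ^ d * (ρ x / b)))) := by
          rw [lintegral_add_left (by fun_prop), lintegral_const_mul' _ _ ENNReal.ofReal_ne_top]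
      _ ≤ _ := by
          gcongr
          exact hB κ r₀ hκ.le hr₀ ρ hρm hρ
  calc (K : ℝ≥0∞) * ∫⁻ x, ENNReal.ofReal (Ψ (ρ x / b)) ∂μ
      ≤ ENNReal.ofReal (K : ℝ) * (ENNReal.ofReal (A' * κ) * (∫⁻ x, ENNReal.ofReal (ρ x ^ 2)) +
        ENNReal.ofReal B * coreTerm κ r₀ α ρ) := by
        rw [ENNReal.ofReal_natCast]
        gcongr
    _ = ENNReal.ofReal (K * (A' * κ)) * (∫⁻ x, ENNReal.ofReal (ρ x ^ 2)) +
        ENNReal.ofReal (K * B) * coreTerm κ r₀ α ρ := by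
        rw [mul_add, ← mul_assoc, ← mul_assoc, ← ENNReal.ofReal_mul (by positivity),
          ← ENNReal.ofReal_mul (by positivity)]
    _ ≤ _ := by
        have hK0 : (0 : ℝ) ≤ K := by positivity
        have h1 : K * A' ≤ (K + 1) * (A' + B + 1) := by gcongr <;> linarith
        have h2 : K * B ≤ (K + 1) * (A' + B + 1) := by gcongr <;> linarith
        refine add_le_add (mul_le_mul_left (ENNReal.ofReal_le_ofReal ?_) _)
          (mul_le_mul_left (ENNReal.ofReal_le_ofReal h2) _)
        rw [← mul_assoc]
        exact mul_le_mul_of_nonneg_right h1 hκ.le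

end OneBody

/-! ### States given by weights on labels -/

section LabelState

open Set

variable {E : Type*} [MeasurableSpace E] {J : Type*} [MeasurableSpace J]

/-- The measure on `n`-particle configurations whose density with respect to `μ ⊗ ⋯ ⊗ μ` depends on
the labels `g x₁, …, g xₙ` only, through the weight `W`. -/
noncomputable def labelState (μ : Measure E) (g : E → J) {n : ℕ} (W : (Fin n → J) → ℝ≥0∞) :
    Measure (Fin n → E) :=
  (Measure.pi fun _ => μ).withDensity fun x => W fun i => g (x i)

variable [Fintype J] [DiscreteMeasurableSpace J] {μ : Measure E}
  {g : E → J} {n : ℕ} {W : (Fin n → J) → ℝ≥0∞}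

theorem measurable_comp_labels (hg : Measurable g) (W : (Fin n → J) → ℝ≥0∞) :
    Measurable fun x : Fin n → E => W fun i => g (x i) := by
  have h : Measurable fun (x : Fin n → E) (i : Fin n) => g (x i) :=
    measurable_pi_lambda _ fun i => hg.comp (measurable_pi_apply i)
  exact (Measurable.of_discrete (f := W)).comp h

theorem labelState_ae (hg : Measurable g) : ∀ᵐ x ∂labelState μ g W, W (fun i => g (x i)) ≠ 0 := by
  rw [labelState, ae_withDensity_iff (measurable_comp_labels hg W)]
  exact Filter.Eventually.of_forall fun x hx => hx

theorem measure_eq_sum_labels (hg : Measurable g) {B : Set E} (hB : MeasurableSet B) :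
    μ B = ∑ j, μ (B ∩ g ⁻¹' {j}) := by
  rw [← measure_biUnion_finset]
  · congr 1
    ext x; simp
  · intro j _ k _ hjk
    refine Disjoint.mono inter_subset_right inter_subset_right ?_
    exact Disjoint.preimage _ (by simpa using hjk)
  · exact fun j _ => hB.inter (hg (measurableSet_singleton _))

variable [IsFiniteMeasure μ]

theorem labelState_pi (hg : Measurable g) {B : Fin n → Set E} (hB : ∀ i, MeasurableSet (B i)) :
    labelState μ g W (univ.pi B) = ∑ f, W f * ∏ k, μ (B k ∩ g ⁻¹' {f k}) := by
  have hbox : MeasurableSet (univ.pi B) := MeasurableSet.univ_pi hB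
  have hlab : ∀ f : Fin n → J, MeasurableSet (univ.pi fun k => g ⁻¹' {f k}) := fun f =>
    MeasurableSet.univ_pi fun k => hg (measurableSet_singleton _)
  classical
  have hW : ∀ x : Fin n → E, W (fun i => g (x i)) =
      ∑ f : Fin n → J, (univ.pi fun k => g ⁻¹' {f k}).indicator (fun _ => W f) x := by
    intro x
    rw [Finset.sum_eq_single fun i => g (x i)]
    · rw [indicator_of_mem]
      simp
    · intro f _ hf
      rw [indicator_of_notMem]
      intro hx
      exact hf (funext fun k => (hx k (mem_univ k)).symm)
    · simp
  rw [labelState, withDensity_apply _ hbox]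
  simp_rw [hW]
  rw [lintegral_finsetSum _ fun f _ => measurable_const.indicator (hlab f)]
  refine Finset.sum_congr rfl fun f _ => ?_
  rw [lintegral_indicator_const (hlab f), Measure.restrict_apply (hlab f), ← pi_inter_distrib,
    Measure.pi_pi]
  simp_rw [inter_comm]

theorem labelState_univ (hg : Measurable g) :
    labelState μ g W univ = ∑ f, W f * ∏ k, μ (g ⁻¹' {f k}) := by
  rw [← pi_univ univ, labelState_pi hg fun _ => MeasurableSet.univ]
  simp

theorem labelState_marginal [DecidableEq J] (hg : Measurable g) (i : Fin n) {B : Set E}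
    (hB : MeasurableSet B) :
    (labelState μ g W).map (fun x => x i) B =
      ∑ f, W f * (∏ k, μ (g ⁻¹' {f k})) * (μ (B ∩ g ⁻¹' {f i}) / μ (g ⁻¹' {f i})) := by
  have hpre : (fun x : Fin n → E => x i) ⁻¹' B =
      univ.pi (Function.update (fun _ => univ) i B) := by
    rw [univ_pi_update_univ]
  rw [Measure.map_apply (measurable_pi_apply i) hB, hpre, labelState_pi hg]
  · refine Finset.sum_congr rfl fun f _ => ?_
    rw [mul_assoc]
    congr 1
    rw [← Finset.mul_prod_erase _ _ (Finset.mem_univ i), Function.update_self,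
      ← Finset.mul_prod_erase _ (fun k => μ (g ⁻¹' {f k})) (Finset.mem_univ i)]
    have hrest : ∏ k ∈ Finset.univ.erase i,
        μ (Function.update (fun _ => univ) i B k ∩ g ⁻¹' {f k}) =
        ∏ k ∈ Finset.univ.erase i, μ (g ⁻¹' {f k}) := by
      refine Finset.prod_congr rfl fun k hk => ?_
      rw [Function.update_of_ne (Finset.ne_of_mem_erase hk), univ_inter]
    rw [hrest]
    by_cases h0 : μ (g ⁻¹' {f i}) = 0
    · rw [h0, measure_mono_null inter_subset_right h0]
      simp
    · rw [mul_right_comm, ENNReal.mul_div_cancel h0 (measure_ne_top _ _)]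
  · intro k
    rcases eq_or_ne k i with rfl | hk
    · rwa [Function.update_self]
    · rw [Function.update_of_ne hk]; exact MeasurableSet.univ

/-- The expected number of particles with label `j`. -/
noncomputable def labelMean (μ : Measure E) (g : E → J) {n : ℕ} (W : (Fin n → J) → ℝ≥0∞)
    [DecidableEq J] (j : J) : ℝ≥0∞ :=
  ∑ f : Fin n → J, ∑ i : Fin n, if f i = j then W f * ∏ k, μ (g ⁻¹' {f k}) else 0

theorem sum_labelState_marginal [DecidableEq J] (hg : Measurable g) {B : Set E}
    (hB : MeasurableSet B) :
    (∑ i : Fin n, (labelState μ g W).map (fun x => x i)) B =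
      ∑ j, labelMean μ g W j * (μ (B ∩ g ⁻¹' {j}) / μ (g ⁻¹' {j})) := by
  rw [Measure.finsetSum_apply]
  simp_rw [labelState_marginal hg _ hB, labelMean, Finset.sum_mul]
  rw [Finset.sum_comm, Finset.sum_comm (s := (Finset.univ : Finset J))]
  refine Finset.sum_congr rfl fun f _ => ?_
  rw [Finset.sum_comm]
  refine Finset.sum_congr rfl fun i _ => ?_
  simp

theorem measurePreserving_comp_perm (μ : Measure E) [IsFiniteMeasure μ] (σ : Equiv.Perm (Fin n)) :
    MeasurePreserving (fun (x : Fin n → E) i => x (σ i)) (Measure.pi fun _ => μ)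
      (Measure.pi fun _ => μ) := by
  have hm : Measurable fun (x : Fin n → E) i => x (σ i) :=
    measurable_pi_lambda _ fun i => measurable_pi_apply _
  refine ⟨hm, (Measure.pi_eq fun s hs => ?_).symm⟩
  rw [Measure.map_apply hm (MeasurableSet.univ_pi hs)]
  have : (fun (x : Fin n → E) i => x (σ i)) ⁻¹' univ.pi s = univ.pi fun i => s (σ.symm i) := by
    ext x
    simp only [mem_preimage, mem_pi, mem_univ, true_imp_iff]
    exact ⟨fun h i => by simpa using h (σ.symm i), fun h i => by simpa using h (σ i)⟩
  rw [this, Measure.pi_pi]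
  exact Equiv.prod_comp σ.symm fun i => μ (s i)

theorem labelState_map_perm (hg : Measurable g)
    (hW : ∀ (σ : Equiv.Perm (Fin n)) f, W (fun i => f (σ i)) = W f) (σ : Equiv.Perm (Fin n)) :
    (labelState μ g W).map (fun x i => x (σ i)) = labelState μ g W := by
  have hp := measurePreserving_comp_perm μ σ
  ext S hS
  rw [Measure.map_apply hp.measurable hS, labelState, withDensity_apply _ hS,
    withDensity_apply _ (hp.measurable hS),
    ← hp.setLIntegral_comp_preimage hS (measurable_comp_labels hg W)]
  refine lintegral_congr fun x => ?_
  exact (hW σ fun i => g (x i)).symm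

end LabelState

section LabelStateEuclidean

variable {d : ℕ} {J : Type*} [MeasurableSpace J] [Fintype J] [DiscreteMeasurableSpace J]
  [DecidableEq J] {ρ : EuclideanSpace ℝ (Fin d) → ℝ} {g : EuclideanSpace ℝ (Fin d) → J}

theorem isCanonicalState_labelState {N : ℕ} {W : (Fin N → J) → ℝ≥0∞} {μ}
    (hμ : μ = volume.withDensity fun x => ENNReal.ofReal (ρ x)) [IsFiniteMeasure μ]
    (hg : Measurable g) (hW : ∀ (σ : Equiv.Perm (Fin N)) f, W (fun i => f (σ i)) = W f)
    (hmass : ∑ f, W f * ∏ k, μ (g ⁻¹' {f k}) = 1)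
    (hmean : ∀ j, labelMean μ g W j = μ (g ⁻¹' {j})) :
    IsCanonicalState ρ (labelState μ g W) where
  mass := (labelState_univ hg).trans hmass
  symmetric := labelState_map_perm hg hW
  density := by
    rw [← hμ]
    ext B hB
    rw [oneBodyDensity, sum_labelState_marginal hg hB, measure_eq_sum_labels hg hB]
    refine Finset.sum_congr rfl fun j _ => ?_
    rw [hmean, ENNReal.mul_div_cancel' (fun h => measure_mono_null Set.inter_subset_right h)
      (fun h => absurd h (measure_ne_top _ _))]

theorem isGrandCanonicalState_labelState {W : (n : ℕ) → (Fin n → J) → ℝ≥0∞} {μ}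
    (hμ : μ = volume.withDensity fun x => ENNReal.ofReal (ρ x)) [IsFiniteMeasure μ]
    (hg : Measurable g) (hW : ∀ n (σ : Equiv.Perm (Fin n)) f, W n (fun i => f (σ i)) = W n f)
    (hmass : ∑' n, ∑ f, W n f * ∏ k, μ (g ⁻¹' {f k}) = 1)
    (hmean : ∀ j, ∑' n, labelMean μ g (W n) j = μ (g ⁻¹' {j})) :
    IsGrandCanonicalState ρ fun n => labelState μ g (W n) where
  mass := by simp_rw [labelState_univ hg]; exact hmass
  symmetric n := labelState_map_perm hg (hW n)
  density := by
    rw [← hμ]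
    ext B hB
    rw [Measure.sum_apply _ hB]
    simp_rw [oneBodyDensity, sum_labelState_marginal hg hB]
    rw [measure_eq_sum_labels hg hB, Summable.tsum_finsetSum fun _ _ => ENNReal.summable]
    refine Finset.sum_congr rfl fun j _ => ?_
    rw [ENNReal.tsum_mul_right, hmean, ENNReal.mul_div_cancel'
      (fun h => measure_mono_null Set.inter_subset_right h)
      (fun h => absurd h (measure_ne_top _ _))]

end LabelStateEuclidean

/-! ### Energy and entropy of such states -/

section FreeEnergy

open Real

variable {d n : ℕ}

theorem interactionEnergy_toENNReal_le {w : EuclideanSpace ℝ (Fin d) → EReal}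
    {P : Measure (Fin n → EuclideanSpace ℝ (Fin d))} {e : EuclideanSpace ℝ (Fin d) → ℝ≥0∞}
    (he : Measurable e) (h : ∀ᵐ x ∂P, (pairEnergy w x).toENNReal ≤ ∑ i, e (x i)) :
    (interactionEnergy w P).toENNReal ≤ ∫⁻ x, e x ∂(oneBodyDensity P) := by
  have h1 : interactionEnergy w P ≤ ((∫⁻ x, (pairEnergy w x).toENNReal ∂P : ℝ≥0∞) : EReal) := by
    rw [interactionEnergy, eIntegral]
    exact EReal.sub_le_of_le_add (le_add_of_nonneg_right (EReal.coe_ennreal_nonneg _))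
  calc (interactionEnergy w P).toENNReal ≤ ∫⁻ x, (pairEnergy w x).toENNReal ∂P := by
        simpa using EReal.toENNReal_le_toENNReal h1
    _ ≤ ∫⁻ x, ∑ i, e (x i) ∂P := lintegral_mono_ae h
    _ = ∫⁻ x, e x ∂(oneBodyDensity P) := by
        rw [oneBodyDensity, lintegral_finsetSum_measure,
          lintegral_finsetSum (f := fun i (x : Fin n → EuclideanSpace ℝ (Fin d)) => e (x i)) _
            fun i _ => he.comp (measurable_pi_apply i)]
        refine Finset.sum_congr rfl fun i _ => ?_
        rw [lintegral_map he (measurable_pi_apply i)]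

theorem eIntegral_coe_le {X : Type*} [MeasurableSpace X] {μ : Measure X} {h G : X → ℝ}
    (hG : Integrable G μ) (hle : ∀ᵐ x ∂μ, h x ≤ G x) :
    eIntegral μ (fun x => (h x : EReal)) ≤ ((∫ x, G x ∂μ : ℝ) : EReal) := by
  have hp : ∫⁻ x, ENNReal.ofReal (G x) ∂μ ≠ ∞ := hG.lintegral_lt_top.ne
  have hn : ∫⁻ x, ENNReal.ofReal (-G x) ∂μ ≠ ∞ := hG.neg.lintegral_lt_top.ne
  rw [integral_eq_lintegral_pos_part_sub_lintegral_neg_part hG, EReal.coe_sub,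
    EReal.coe_ennreal_toReal hp, EReal.coe_ennreal_toReal hn, eIntegral]
  refine EReal.sub_le_sub ?_ ?_
  · refine EReal.coe_ennreal_le_coe_ennreal_iff.2 (lintegral_mono_ae ?_)
    filter_upwards [hle] with x hx
    exact ENNReal.ofReal_le_ofReal hx
  · refine EReal.coe_ennreal_le_coe_ennreal_iff.2 (lintegral_mono_ae ?_)
    filter_upwards [hle] with x hx
    rw [← EReal.coe_neg, EReal.real_coe_toENNReal]
    exact ENNReal.ofReal_le_ofReal (neg_le_neg hx)

theorem eSum_mono {a b : ℕ → EReal} (h : ∀ n, a n ≤ b n) : eSum a ≤ eSum b := by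
  refine EReal.sub_le_sub ?_ ?_
  · exact EReal.coe_ennreal_le_coe_ennreal_iff.2
      (ENNReal.tsum_le_tsum fun n => EReal.toENNReal_le_toENNReal (h n))
  · exact EReal.coe_ennreal_le_coe_ennreal_iff.2
      (ENNReal.tsum_le_tsum fun n => EReal.toENNReal_le_toENNReal (EReal.neg_le_neg_iff.2 (h n)))

theorem eSum_coe {a : ℕ → ℝ} {S : ℝ} (h : HasSum a S) : eSum (fun n => (a n : EReal)) = S := by
  have hpos : Summable fun n => max (a n) 0 :=
    Summable.of_nonneg_of_le (fun n => le_max_right _ _)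
      (fun n => max_le (le_abs_self _) (abs_nonneg _)) h.summable.abs
  have hneg : Summable fun n => max (-a n) 0 :=
    Summable.of_nonneg_of_le (fun n => le_max_right _ _)
      (fun n => max_le (neg_le_abs _) (abs_nonneg _)) h.summable.abs
  have hmax : ∀ b : ℝ, ENNReal.ofReal b = ENNReal.ofReal (max b 0) := fun b => by
    rw [ENNReal.ofReal_max]; simp
  have hS : S = ∑' n, max (a n) 0 - ∑' n, max (-a n) 0 := by
    rw [← hpos.tsum_sub hneg, ← h.tsum_eq]
    refine tsum_congr fun n => ?_
    rcases le_total 0 (a n) with h0 | h0 <;> simp [h0]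
  rw [eSum]
  simp_rw [← EReal.coe_neg, EReal.real_coe_toENNReal]
  simp_rw [hmax (a _), hmax (-a _)]
  rw [← ENNReal.ofReal_tsum_of_nonneg (fun n => le_max_right _ _) hpos,
    ← ENNReal.ofReal_tsum_of_nonneg (fun n => le_max_right _ _) hneg, EReal.coe_ennreal_ofReal,
    EReal.coe_ennreal_ofReal, max_eq_left (tsum_nonneg fun n => le_max_right _ _),
    max_eq_left (tsum_nonneg fun n => le_max_right _ _), ← EReal.coe_sub, ← hS]

/-- The product of copies of a measure with a density has the product density. -/
theorem pi_withDensity_ofReal {ρ : EuclideanSpace ℝ (Fin d) → ℝ}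
    (hρ : ∀ x, 0 ≤ ρ x) (hρi : Integrable ρ) {μ : Measure (EuclideanSpace ℝ (Fin d))}
    (hμ : μ = volume.withDensity fun x => ENNReal.ofReal (ρ x)) [IsFiniteMeasure μ] :
    (Measure.pi fun _ : Fin n => μ) =
      volume.withDensity fun x => ENNReal.ofReal (∏ i, ρ (x i)) := by
  refine Measure.pi_eq fun s hs => ?_
  have hbox : MeasurableSet (Set.univ.pi s) := MeasurableSet.univ_pi hs
  have hind : ∀ x : Fin n → EuclideanSpace ℝ (Fin d),
      (Set.univ.pi s).indicator (fun x => ENNReal.ofReal (∏ i, ρ (x i))) x =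
      ENNReal.ofReal (∏ i, (s i).indicator ρ (x i)) := by
    intro x
    by_cases hx : x ∈ Set.univ.pi s
    · rw [Set.indicator_of_mem hx]
      congr 1
      exact Finset.prod_congr rfl fun i _ => (Set.indicator_of_mem (hx i trivial) _).symm
    · rw [Set.indicator_of_notMem hx]
      simp only [Set.mem_pi, Set.mem_univ, true_imp_iff, not_forall] at hx
      obtain ⟨i, hi⟩ := hx
      rw [Finset.prod_eq_zero (Finset.mem_univ i) (Set.indicator_of_notMem hi _),
        ENNReal.ofReal_zero]
  have hii : ∀ i, Integrable ((s i).indicator ρ) := fun i => hρi.indicator (hs i)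
  have h0 : ∀ i x, 0 ≤ (s i).indicator ρ x := fun i x =>
    Set.indicator_nonneg (fun x _ => hρ x) x
  rw [withDensity_apply _ hbox, ← lintegral_indicator hbox]
  simp_rw [hind]
  rw [← ofReal_integral_eq_lintegral_ofReal]
  · rw [volume_pi, integral_fintype_prod_eq_prod (𝕜 := ℝ) (fun i x => (s i).indicator ρ x),
      ENNReal.ofReal_prod_of_nonneg fun i _ => integral_nonneg (h0 i)]
    refine Finset.prod_congr rfl fun i _ => ?_
    rw [hμ, withDensity_apply _ (hs i), ofReal_integral_eq_lintegral_ofReal (hii i)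
      (Filter.Eventually.of_forall (h0 i)), ← lintegral_indicator (hs i)]
    refine lintegral_congr fun x => ?_
    by_cases hx : x ∈ s i <;> simp [hx]
  · rw [volume_pi]
    exact Integrable.fintype_prod (𝕜 := ℝ) (f := fun i x => (s i).indicator ρ x) hii
  · exact Filter.Eventually.of_forall fun x => Finset.prod_nonneg fun i _ => h0 i _

theorem mul_log_le_of_le_prod {K : ℝ} (hK : 0 < K) {W : ℝ} (hWK : n ! * W ≤ K ^ n)
    {y : Fin n → ℝ} (hy : ∀ i, 0 ≤ y i) (hW : 0 ≤ W) :
    (∏ i, y i) * W * log (n ! * ((∏ i, y i) * W)) ≤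
      (∏ i, y i) * W * ∑ i, log (K * y i) := by
  have hp0 : 0 ≤ (∏ i, y i) * W := mul_nonneg (Finset.prod_nonneg fun i _ => hy i) hW
  rcases hp0.eq_or_lt with h0 | h0
  · rw [← h0]; simp
  refine mul_le_mul_of_nonneg_left ?_ hp0
  have hy0 : ∀ i, y i ≠ 0 := fun i hi => by
    rw [Finset.prod_eq_zero (Finset.mem_univ i) hi, zero_mul] at h0
    exact lt_irrefl _ h0
  have hprod : ∑ i, log (K * y i) = log (∏ i, K * y i) :=
    (log_prod fun i _ => mul_ne_zero hK.ne' (hy0 i)).symm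
  rw [hprod]
  refine log_le_log (by positivity) ?_
  calc n ! * ((∏ i, y i) * W) = (∏ i, y i) * (n ! * W) := by ring
    _ ≤ (∏ i, y i) * K ^ n :=
        mul_le_mul_of_nonneg_left hWK (Finset.prod_nonneg fun i _ => hy i)
    _ = ∏ i, K * y i := by
        rw [Finset.prod_mul_distrib, Finset.prod_const, Finset.card_univ, Fintype.card_fin, mul_comm]

/-- If `n!` times the weight is at most `K ^ n`, then `n!` times the density of the state is bounded
by the product of the values of `K ρ`, and the entropy is controlled by the one-body density. -/
theorem le_canonicalEntropy_labelState {J : Type*} [MeasurableSpace J] [Fintype J]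
    [DiscreteMeasurableSpace J] {ρ : EuclideanSpace ℝ (Fin d) → ℝ}
    {g : EuclideanSpace ℝ (Fin d) → J} (hg : Measurable g) (hρm : Measurable ρ)
    (hρ : ∀ x, 0 ≤ ρ x) (hρi : Integrable ρ) {μ : Measure (EuclideanSpace ℝ (Fin d))}
    (hμ : μ = volume.withDensity fun x => ENNReal.ofReal (ρ x)) [IsFiniteMeasure μ]
    {W : (Fin n → J) → ℝ≥0∞} {K : ℝ} (hK : 0 < K)
    (hW : ∀ f, (n ! : ℝ≥0∞) * W f ≤ ENNReal.ofReal K ^ n)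
    (hL : Integrable (fun x => log (K * ρ x)) μ) (hle : oneBodyDensity (labelState μ g W) ≤ μ) :
    ((-∫ x, log (K * ρ x) ∂(oneBodyDensity (labelState μ g W)) : ℝ) : EReal) ≤
      canonicalEntropy (labelState μ g W) := by
  set P := labelState μ g W with hP
  set p : (Fin n → EuclideanSpace ℝ (Fin d)) → ℝ≥0∞ :=
    fun x => ENNReal.ofReal (∏ i, ρ (x i)) * W fun i => g (x i) with hp
  have hWtop : ∀ f, W f ≠ ∞ := fun f h => by
    have h1 := hW f
    rw [h, ENNReal.mul_top (by exact_mod_cast (Nat.factorial_pos n).ne'), top_le_iff] at h1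
    exact absurd h1 (ENNReal.pow_ne_top ENNReal.ofReal_ne_top)
  have hprodm : Measurable fun x : Fin n → EuclideanSpace ℝ (Fin d) =>
      ENNReal.ofReal (∏ i, ρ (x i)) :=
    (Finset.measurable_prod _ fun i _ => hρm.comp (measurable_pi_apply i)).ennreal_ofReal
  have hpm : Measurable p := hprodm.mul (measurable_comp_labels hg W)
  have hptop : ∀ x, p x < ∞ := fun x => ENNReal.mul_lt_top ENNReal.ofReal_lt_top (hWtop _).lt_top
  have hPp : P = volume.withDensity p := by
    rw [hP, labelState, pi_withDensity_ofReal hρ hρi hμ,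
      ← withDensity_mul _ hprodm (measurable_comp_labels hg W)]
    rfl
  have hac : P ≪ volume := hPp ▸ withDensity_absolutelyContinuous _ _
  have hrn : P.rnDeriv volume =ᵐ[volume] p := hPp ▸ Measure.rnDeriv_withDensity _ hpm
  have hLi : ∀ i : Fin n, Integrable (fun x => log (K * ρ x)) (P.map fun x => x i) := fun i => by
    refine hL.mono_measure (le_trans ?_ hle)
    rw [oneBodyDensity]
    exact Finset.single_le_sum (f := fun i => P.map fun x => x i) (fun j _ => Measure.zero_le _)
      (Finset.mem_univ i)
  have hLi' : ∀ i : Fin n, Integrable (fun x => log (K * ρ (x i))) P := fun i =>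
    (hLi i).comp_measurable (measurable_pi_apply i)
  have hS : Integrable (fun x => ∑ i, log (K * ρ (x i))) P :=
    integrable_finsetSum _ fun i _ => hLi' i
  have hint : ∫ x, log (K * ρ x) ∂(oneBodyDensity P) =
      ∫ x, (p x).toReal * ∑ i, log (K * ρ (x i)) := by
    have h1 : ∫ x, ∑ i, log (K * ρ (x i)) ∂P = ∫ x, (p x).toReal * ∑ i, log (K * ρ (x i)) := by
      rw [hPp, integral_withDensity_eq_integral_toReal_smul hpm
        (Filter.Eventually.of_forall hptop)]
      rfl
    rw [← h1, oneBodyDensity, integral_finsetSum_measure fun i _ => hLi i,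
      integral_finsetSum _ fun i _ => hLi' i]
    refine Finset.sum_congr rfl fun i _ => ?_
    rw [integral_map (measurable_pi_apply i).aemeasurable (hLi i).aestronglyMeasurable]
  have hG : Integrable fun x => (p x).toReal * ∑ i, log (K * ρ (x i)) := by
    rw [hPp, integrable_withDensity_iff_integrable_smul' hpm
      (Filter.Eventually.of_forall hptop)] at hS
    exact hS
  rw [canonicalEntropy, if_pos hac, EReal.coe_neg, EReal.neg_le_neg_iff, hint]
  refine eIntegral_coe_le hG ?_
  filter_upwards [hrn] with x hx
  rw [hx]
  have hWx : (n ! : ℝ) * (W fun i => g (x i)).toReal ≤ K ^ n := by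
    have := ENNReal.toReal_mono (ENNReal.pow_ne_top ENNReal.ofReal_ne_top) (hW fun i => g (x i))
    simpa [ENNReal.toReal_mul, ENNReal.toReal_pow, ENNReal.toReal_ofReal hK.le] using this
  have hpx : (p x).toReal = (∏ i, ρ (x i)) * (W fun i => g (x i)).toReal := by
    rw [hp, ENNReal.toReal_mul, ENNReal.toReal_ofReal (Finset.prod_nonneg fun i _ => hρ _)]
  rw [hpx]
  exact mul_log_le_of_le_prod hK hWx (fun i => hρ _) ENNReal.toReal_nonneg

theorem integrable_log_mul_density {ρ : EuclideanSpace ℝ (Fin d) → ℝ} (hρm : Measurable ρ)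
    (hρ : ∀ x, 0 ≤ ρ x) (hρi : Integrable ρ) (hlog : Integrable fun x => ρ x * |log (ρ x)|)
    {μ : Measure (EuclideanSpace ℝ (Fin d))}
    (hμ : μ = volume.withDensity fun x => ENNReal.ofReal (ρ x)) {K : ℝ} (hK : 0 < K) :
    Integrable (fun x => log (K * ρ x)) μ ∧
      ∫ x, log (K * ρ x) ∂μ = log K * (∫ x, ρ x) + ∫ x, ρ x * log (ρ x) := by
  have hlog' : Integrable fun x => ρ x * log (ρ x) := by
    refine hlog.mono (by fun_prop) (Filter.Eventually.of_forall fun x => ?_)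
    simp
  have hpt : ∀ x, (ENNReal.ofReal (ρ x)).toReal • log (K * ρ x) =
      log K * ρ x + ρ x * log (ρ x) := by
    intro x
    rw [ENNReal.toReal_ofReal (hρ x), smul_eq_mul]
    rcases (hρ x).eq_or_lt with h0 | h0
    · simp [← h0]
    · rw [log_mul hK.ne' h0.ne']; ring
  constructor
  · rw [hμ, integrable_withDensity_iff_integrable_smul' hρm.ennreal_ofReal
      (Filter.Eventually.of_forall fun _ => ENNReal.ofReal_lt_top)]
    simp_rw [hpt]
    exact (hρi.const_mul _).add hlog'
  · rw [hμ, integral_withDensity_eq_integral_toReal_smul hρm.ennreal_ofReal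
      (Filter.Eventually.of_forall fun _ => ENNReal.ofReal_lt_top)]
    simp_rw [hpt]
    rw [integral_add (hρi.const_mul _) hlog', integral_const_mul]

/-- The energy and entropy bounds combine into a bound on a free energy. -/
theorem sub_mul_entropy_le {U S : EReal} {A : ℝ≥0∞} {T L : ℝ} (hT : 0 ≤ T) (hU : U ≤ (A : EReal))
    (hS : 0 < T → ((-L : ℝ) : EReal) ≤ S) :
    U - (T : EReal) * S ≤ (A : EReal) + ((T * L : ℝ) : EReal) := by
  rw [sub_eq_add_neg]
  refine add_le_add hU ?_
  rcases hT.eq_or_lt with rfl | hT0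
  · simp
  · have h1 : (T : EReal) * ((-L : ℝ) : EReal) ≤ (T : EReal) * S :=
      mul_le_mul_of_nonneg_left (hS hT0) (by exact_mod_cast hT)
    rw [← EReal.coe_mul] at h1
    refine EReal.neg_le_of_neg_le (le_trans (le_of_eq ?_) h1)
    rw [← EReal.coe_neg]
    congr 1
    ring

variable {J : Type*} [MeasurableSpace J] [Fintype J]
  [DiscreteMeasurableSpace J] [DecidableEq J] {ρ : EuclideanSpace ℝ (Fin d) → ℝ}
  {g : EuclideanSpace ℝ (Fin d) → J} {w : EuclideanSpace ℝ (Fin d) → EReal}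
  {e : EuclideanSpace ℝ (Fin d) → ℝ≥0∞} {μ : Measure (EuclideanSpace ℝ (Fin d))}
  [IsFiniteMeasure μ]

theorem canonicalFreeEnergy_le_of_weights {T : ℝ} (hT : 0 ≤ T) (hρm : Measurable ρ)
    (hρ : ∀ x, 0 ≤ ρ x) (hρi : Integrable ρ)
    (hlog : 0 < T → Integrable fun x => ρ x * |log (ρ x)|)
    (hμ : μ = volume.withDensity fun x => ENNReal.ofReal (ρ x)) (hg : Measurable g)
    {W : (Fin n → J) → ℝ≥0∞} (hW : ∀ (σ : Equiv.Perm (Fin n)) f, W (fun i => f (σ i)) = W f)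
    (hmass : ∑ f, W f * ∏ k, μ (g ⁻¹' {f k}) = 1)
    (hmean : ∀ j, labelMean μ g W j = μ (g ⁻¹' {j})) {K : ℝ} (hK : 0 < K)
    (hWK : 0 < T → ∀ f, (n ! : ℝ≥0∞) * W f ≤ ENNReal.ofReal K ^ n) (he : Measurable e)
    (hE : ∀ x : Fin n → EuclideanSpace ℝ (Fin d), W (fun i => g (x i)) ≠ 0 →
      (pairEnergy w x).toENNReal ≤ ∑ i, e (x i)) :
    canonicalFreeEnergy w T n ρ ≤ ((∫⁻ x, e x ∂μ : ℝ≥0∞) : EReal) +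
      ((T * (log K * (∫ x, ρ x) + ∫ x, ρ x * log (ρ x)) : ℝ) : EReal) := by
  have hstate := isCanonicalState_labelState hμ hg hW hmass hmean
  have hdens : oneBodyDensity (labelState μ g W) = μ := hstate.density.trans hμ.symm
  refine iInf₂_le_of_le (labelState μ g W) hstate ?_
  refine sub_mul_entropy_le hT ?_ fun hT0 => ?_
  · have h1 := interactionEnergy_toENNReal_le (w := w) he
      ((labelState_ae (μ := μ) hg).mono fun x => hE x)
    rw [hdens] at h1
    refine le_trans ?_ (EReal.coe_ennreal_le_coe_ennreal_iff.2 h1)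
    rw [EReal.coe_toENNReal_eq_max]
    exact le_max_right _ _
  · obtain ⟨hL, hLeq⟩ := integrable_log_mul_density hρm hρ hρi (hlog hT0) hμ hK
    have h1 := le_canonicalEntropy_labelState hg hρm hρ hρi hμ hK (hWK hT0) hL hdens.le
    rwa [hdens, hLeq] at h1

theorem grandCanonicalFreeEnergy_le_of_weights {T : ℝ} (hT : 0 ≤ T) (hρm : Measurable ρ)
    (hρ : ∀ x, 0 ≤ ρ x) (hρi : Integrable ρ)
    (hlog : 0 < T → Integrable fun x => ρ x * |log (ρ x)|)
    (hμ : μ = volume.withDensity fun x => ENNReal.ofReal (ρ x)) (hg : Measurable g)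
    {W : (n : ℕ) → (Fin n → J) → ℝ≥0∞}
    (hW : ∀ n (σ : Equiv.Perm (Fin n)) f, W n (fun i => f (σ i)) = W n f)
    (hmass : ∑' n, ∑ f, W n f * ∏ k, μ (g ⁻¹' {f k}) = 1)
    (hmean : ∀ j, ∑' n, labelMean μ g (W n) j = μ (g ⁻¹' {j})) {K : ℝ} (hK : 0 < K)
    (hWK : ∀ n f, (n ! : ℝ≥0∞) * W n f ≤ ENNReal.ofReal K ^ n) (he : Measurable e)
    (hE : ∀ n (x : Fin n → EuclideanSpace ℝ (Fin d)), W n (fun i => g (x i)) ≠ 0 →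
      (pairEnergy w x).toENNReal ≤ ∑ i, e (x i)) :
    grandCanonicalFreeEnergy w T ρ ≤ ((∫⁻ x, e x ∂μ : ℝ≥0∞) : EReal) +
      ((T * (log K * (∫ x, ρ x) + ∫ x, ρ x * log (ρ x)) : ℝ) : EReal) := by
  have hstate := isGrandCanonicalState_labelState hμ hg hW hmass hmean
  have hdens : Measure.sum (fun n => oneBodyDensity (labelState μ g (W n))) = μ :=
    hstate.density.trans hμ.symm
  have hle : ∀ n, oneBodyDensity (labelState μ g (W n)) ≤ μ := fun n =>
    (Measure.le_sum _ n).trans hdens.le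
  refine iInf₂_le_of_le (fun n => labelState μ g (W n)) hstate ?_
  refine sub_mul_entropy_le hT ?_ fun hT0 => ?_
  · have h1 : ∑' n, (interactionEnergy w (labelState μ g (W n))).toENNReal ≤ ∫⁻ x, e x ∂μ := by
      calc _ ≤ ∑' n, ∫⁻ x, e x ∂(oneBodyDensity (labelState μ g (W n))) :=
            ENNReal.tsum_le_tsum fun n =>
              interactionEnergy_toENNReal_le he ((labelState_ae hg).mono fun x => hE n x)
        _ = ∫⁻ x, e x ∂μ := by rw [← lintegral_sum_measure, hdens]
    refine le_trans ?_ (EReal.coe_ennreal_le_coe_ennreal_iff.2 h1)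
    exact EReal.sub_le_of_le_add (le_add_of_nonneg_right (EReal.coe_ennreal_nonneg _))
  · obtain ⟨hL, hLeq⟩ := integrable_log_mul_density hρm hρ hρi (hlog hT0) hμ hK
    have hsum := hasSum_integral_measure (μ := fun n => oneBodyDensity (labelState μ g (W n)))
      (f := fun x => log (K * ρ x)) (hdens.symm ▸ hL)
    rw [hdens, hLeq] at hsum
    rw [← eSum_coe hsum.neg]
    exact eSum_mono fun n =>
      le_canonicalEntropy_labelState hg hρm hρ hρi hμ hK (hWK n) hL (hle n)

end FreeEnergy

/-! ### Independent occupation of the cells of one colour -/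

section Occupation

open Finset

variable {J : Type*} [Fintype J] [DecidableEq J]

theorem card_injective_image_eq {n : ℕ} {S : Finset J} (hS : #S = n) :
    #{f : Fin n → J | Function.Injective f ∧ univ.image f = S} = n ! := by
  have hcard : Fintype.card (Fin n ↪ S) = n ! := by
    rw [Fintype.card_embedding_eq, Fintype.card_coe, Fintype.card_fin, hS, Nat.descFactorial_self]
  rw [← hcard, ← Finset.card_univ]
  symm
  refine Finset.card_bij (fun e _ i => (e i : J)) ?_ ?_ ?_
  · intro e _
    have hinj : Function.Injective fun i => (e i : J) := Subtype.val_injective.comp e.injective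
    simp only [mem_filter, mem_univ, true_and]
    refine ⟨hinj, Finset.eq_of_subset_of_card_le ?_ ?_⟩
    · intro j hj
      simp only [mem_image, mem_univ, true_and] at hj
      obtain ⟨i, rfl⟩ := hj
      exact (e i).2
    · rw [Finset.card_image_of_injective _ hinj, Finset.card_univ, Fintype.card_fin, hS]
  · intro e _ e' _ h
    ext i
    exact congrFun h i
  · intro f hf
    simp only [mem_filter, mem_univ, true_and] at hf
    have hmem : ∀ i, f i ∈ S := fun i => hf.2 ▸ mem_image_of_mem f (mem_univ i)
    exact ⟨⟨fun i => ⟨f i, hmem i⟩, fun i k h => hf.1 (congrArg Subtype.val h)⟩, mem_univ _, rfl⟩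

theorem sum_injective_image {n : ℕ} (F : Finset J → ℝ≥0∞) :
    (∑ f : Fin n → J, if Function.Injective f then F (univ.image f) else 0) =
      n ! * ∑ S : Finset J, if #S = n then F S else 0 := by
  have h1 : ∀ f : Fin n → J, (if Function.Injective f then F (univ.image f) else 0) =
      ∑ S : Finset J, if Function.Injective f ∧ univ.image f = S then F S else 0 := by
    intro f
    by_cases hf : Function.Injective f <;> simp [hf]
  simp_rw [h1]
  rw [sum_comm, mul_sum]
  refine sum_congr rfl fun S _ => ?_
  rw [← sum_filter, sum_const, nsmul_eq_mul]
  split_ifs with hS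
  · rw [card_injective_image_eq hS]
  · rw [mul_zero, Finset.card_eq_zero.2, Nat.cast_zero, zero_mul]
    refine filter_eq_empty_iff.2 fun f _ hf => hS ?_
    rw [← hf.2, card_image_of_injective _ hf.1, card_univ, Fintype.card_fin]

theorem tsum_sum_injective_image (F : Finset J → ℝ≥0∞) :
    ∑' n, ((n ! : ℝ≥0∞)⁻¹ * ∑ f : Fin n → J,
      if Function.Injective f then F (univ.image f) else 0) = ∑ S, F S := by
  have h1 : ∀ n : ℕ, ((n ! : ℝ≥0∞)⁻¹ * ∑ f : Fin n → J,
      if Function.Injective f then F (univ.image f) else 0) =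
      ∑ S : Finset J, if #S = n then F S else 0 := by
    intro n
    rw [sum_injective_image, ← mul_assoc, ENNReal.inv_mul_cancel
      (by exact_mod_cast (Nat.factorial_pos n).ne') (ENNReal.natCast_ne_top _), one_mul]
  simp_rw [h1]
  rw [Summable.tsum_finsetSum fun _ _ => ENNReal.summable]
  exact sum_congr rfl fun S _ => tsum_ite_eq' _ _

variable {Γ : Type*} [Fintype Γ] [DecidableEq Γ]

/-- The weight of the state in which a colour is chosen uniformly and then every cell `j` of that
colour is occupied by one particle, independently, with probability `|Γ| m j`. -/
noncomputable def occupationWeight (m : J → ℝ≥0∞) (col : J → Γ) {n : ℕ} (f : Fin n → J) : ℝ≥0∞ :=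
  (n ! : ℝ≥0∞)⁻¹ * if Function.Injective f then (Fintype.card Γ : ℝ≥0∞)⁻¹ *
    ∑ c, if ∀ i, col (f i) = c then (Fintype.card Γ : ℝ≥0∞) ^ n *
      ∏ j ∈ univ.filter (fun j => col j = c) \ univ.image f, (1 - Fintype.card Γ * m j) else 0
    else 0

/-- The probability that `S` is the set of occupied cells. -/
noncomputable def occupationProb (m : J → ℝ≥0∞) (col : J → Γ) (S : Finset J) : ℝ≥0∞ :=
  (Fintype.card Γ : ℝ≥0∞)⁻¹ * ∑ c, if S ⊆ univ.filter (fun j => col j = c) then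
    (∏ j ∈ S, Fintype.card Γ * m j) *
      ∏ j ∈ univ.filter (fun j => col j = c) \ S, (1 - Fintype.card Γ * m j) else 0

variable {m : J → ℝ≥0∞} {col : J → Γ}

theorem occupationWeight_mul_prod {n : ℕ} (f : Fin n → J) :
    occupationWeight m col f * ∏ k, m (f k) =
      (n ! : ℝ≥0∞)⁻¹ * if Function.Injective f then occupationProb m col (univ.image f) else 0 := by
  rw [occupationWeight, mul_assoc]
  congr 1
  split_ifs with hf
  swap
  · rw [zero_mul]
  rw [occupationProb, mul_assoc, sum_mul]
  congr 1
  refine sum_congr rfl fun c _ => ?_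
  have hiff : (∀ i, col (f i) = c) ↔ univ.image f ⊆ univ.filter (fun j => col j = c) := by
    simp [Finset.subset_iff]
  simp_rw [hiff]
  split_ifs with hc
  swap
  · rw [zero_mul]
  rw [prod_image fun i _ k _ h => hf h, prod_mul_distrib, prod_const, card_univ, Fintype.card_fin]
  ring

theorem occupationWeight_comp_perm {n : ℕ} (σ : Equiv.Perm (Fin n)) (f : Fin n → J) :
    occupationWeight m col (fun i => f (σ i)) = occupationWeight m col f := by
  have h1 : Function.Injective (fun i => f (σ i)) ↔ Function.Injective f :=
    Function.Injective.of_comp_iff' f σ.bijective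
  have h2 : univ.image (fun i => f (σ i)) = univ.image f := by
    ext j
    simp only [mem_image, mem_univ, true_and]
    exact ⟨fun ⟨i, hi⟩ => ⟨σ i, hi⟩, fun ⟨i, hi⟩ => ⟨σ.symm i, by simpa using hi⟩⟩
  have h3 : ∀ c, (∀ i, col (f (σ i)) = c) ↔ ∀ i, col (f i) = c := fun c =>
    ⟨fun h i => by simpa using h (σ.symm i), fun h i => h _⟩
  rw [occupationWeight, occupationWeight, h2]
  simp_rw [h1, h3]

theorem of_occupationWeight_ne_zero {n : ℕ} {f : Fin n → J} (h : occupationWeight m col f ≠ 0) :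
    Function.Injective f ∧ ∃ c, (∀ i, col (f i) = c) ∧
      ∀ j, col j = c → Fintype.card Γ * m j = 1 → ∃ i, f i = j := by
  rw [occupationWeight] at h
  have h1 := right_ne_zero_of_mul h
  by_cases hf : Function.Injective f
  swap
  · exact absurd (if_neg hf) h1
  rw [if_pos hf] at h1
  obtain ⟨c, _, hc⟩ := exists_ne_zero_of_sum_ne_zero (right_ne_zero_of_mul h1)
  refine ⟨hf, c, ?_⟩
  by_cases hcol : ∀ i, col (f i) = c
  swap
  · exact absurd (if_neg hcol) hc
  rw [if_pos hcol] at hc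
  refine ⟨hcol, fun j hj hmj => ?_⟩
  by_contra! hne
  refine right_ne_zero_of_mul hc (prod_eq_zero (i := j) ?_ ?_)
  · simp [hj, hne]
  · rw [hmj, tsub_self]

variable [Nonempty Γ]

theorem card_inv_mul_card {Γ : Type*} [Fintype Γ] [Nonempty Γ] :
    (Fintype.card Γ : ℝ≥0∞)⁻¹ * Fintype.card Γ = 1 :=
  ENNReal.inv_mul_cancel (by exact_mod_cast Fintype.card_ne_zero) (ENNReal.natCast_ne_top _)

theorem sum_occupationProb (hm : ∀ j, Fintype.card Γ * m j ≤ 1) :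
    ∑ S, occupationProb m col S = 1 := by
  simp_rw [occupationProb]
  rw [← mul_sum, sum_comm]
  have h1 : ∀ c, (∑ S : Finset J, if S ⊆ univ.filter (fun j => col j = c) then
      (∏ j ∈ S, Fintype.card Γ * m j) *
        ∏ j ∈ univ.filter (fun j => col j = c) \ S, (1 - Fintype.card Γ * m j) else 0) = 1 := by
    intro c
    rw [← sum_filter]
    have : univ.filter (fun S => S ⊆ univ.filter (fun j => col j = c)) =
        (univ.filter (fun j => col j = c)).powerset := by ext; simp
    rw [this, ← prod_add]
    exact prod_eq_one fun j _ => add_tsub_cancel_of_le (hm j)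
  simp_rw [h1]
  rw [sum_const, card_univ, nsmul_eq_mul, mul_one, card_inv_mul_card]

theorem sum_occupationProb_mem (hm : ∀ j, Fintype.card Γ * m j ≤ 1) (j₀ : J) :
    (∑ S, if j₀ ∈ S then occupationProb m col S else 0) = m j₀ := by
  have h0 : ∀ S : Finset J, (if j₀ ∈ S then occupationProb m col S else 0) =
      (Fintype.card Γ : ℝ≥0∞)⁻¹ * ∑ c, if S ⊆ univ.filter (fun j => col j = c) then
        (if j₀ ∈ S then (∏ j ∈ S, Fintype.card Γ * m j) *
      ∏ j ∈ univ.filter (fun j => col j = c) \ S, (1 - Fintype.card Γ * m j) else 0) else 0 := by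
    intro S
    by_cases h : j₀ ∈ S <;> simp [h, occupationProb]
  simp_rw [h0]
  rw [← mul_sum, sum_comm]
  have h1 : ∀ c, (∑ S : Finset J, if S ⊆ univ.filter (fun j => col j = c) then
      (if j₀ ∈ S then (∏ j ∈ S, Fintype.card Γ * m j) *
        ∏ j ∈ univ.filter (fun j => col j = c) \ S, (1 - Fintype.card Γ * m j) else 0) else 0) =
      if col j₀ = c then Fintype.card Γ * m j₀ else 0 := by
    intro c
    rw [← sum_filter]
    have : univ.filter (fun S => S ⊆ univ.filter (fun j => col j = c)) =
        (univ.filter (fun j => col j = c)).powerset := by ext; simp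
    rw [this]
    split_ifs with hc
    · -- Setting the probability of leaving `j₀` empty to zero removes the sets without `j₀`.
      have h2 : ∀ S ∈ (univ.filter (fun j => col j = c)).powerset,
          (if j₀ ∈ S then (∏ j ∈ S, Fintype.card Γ * m j) *
            ∏ j ∈ univ.filter (fun j => col j = c) \ S, (1 - Fintype.card Γ * m j) else 0) =
          (∏ j ∈ S, Fintype.card Γ * m j) * ∏ j ∈ univ.filter (fun j => col j = c) \ S,
            (if j = j₀ then 0 else (1 - Fintype.card Γ * m j)) := by
        intro S _
        split_ifs with hj
        · congr 1
          refine prod_congr rfl fun j hjS => ?_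
          rw [if_neg]
          rintro rfl
          exact (mem_sdiff.1 hjS).2 hj
        · have hmem : j₀ ∈ univ.filter (fun j => col j = c) \ S :=
            mem_sdiff.2 ⟨by simpa using hc, hj⟩
          rw [prod_eq_zero
            (f := fun j => if j = j₀ then 0 else 1 - (Fintype.card Γ : ℝ≥0∞) * m j) hmem
            (if_pos rfl), mul_zero]
      rw [sum_congr rfl h2, ← prod_add, prod_eq_single j₀]
      · simp
      · intro j _ hj
        rw [if_neg hj]
        exact add_tsub_cancel_of_le (hm j)
      · intro h
        exact absurd (by simpa using hc) h
    · refine sum_eq_zero fun S hS => if_neg fun hj => hc ?_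
      simpa using mem_powerset.1 hS hj
  simp_rw [h1]
  rw [sum_ite_eq, if_pos (mem_univ _), ← mul_assoc, card_inv_mul_card, one_mul]

theorem tsum_occupationWeight (hm : ∀ j, Fintype.card Γ * m j ≤ 1) :
    ∑' n, ∑ f : Fin n → J, occupationWeight m col f * ∏ k, m (f k) = 1 := by
  simp_rw [occupationWeight_mul_prod, ← mul_sum]
  rw [tsum_sum_injective_image, sum_occupationProb hm]

theorem tsum_labelMean_occupationWeight {E : Type*} [MeasurableSpace E] [MeasurableSpace J]
    {μ : Measure E} {g : E → J} (hm : ∀ j, Fintype.card Γ * μ (g ⁻¹' {j}) ≤ 1) (j : J) :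
    ∑' n, labelMean μ g (fun f : Fin n → J => occupationWeight (fun j => μ (g ⁻¹' {j})) col f) j =
      μ (g ⁻¹' {j}) := by
  rw [← sum_occupationProb_mem (m := fun j => μ (g ⁻¹' {j})) (col := col) hm j,
    ← tsum_sum_injective_image]
  refine tsum_congr fun n => ?_
  rw [labelMean, mul_sum]
  refine sum_congr rfl fun f _ => ?_
  simp_rw [occupationWeight_mul_prod (m := fun j => μ (g ⁻¹' {j}))]
  by_cases hf : Function.Injective f
  · simp only [if_pos hf]
    by_cases hj : j ∈ univ.image f
    · rw [if_pos hj]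
      obtain ⟨i, _, rfl⟩ := mem_image.1 hj
      simp [hf.eq_iff]
    · rw [if_neg hj, mul_zero]
      refine sum_eq_zero fun i _ => if_neg fun h => hj ?_
      exact mem_image.2 ⟨i, mem_univ i, h⟩
  · simp [hf]

theorem factorial_mul_occupationWeight_le {n : ℕ} (f : Fin n → J) :
    (n ! : ℝ≥0∞) * occupationWeight m col f ≤ (Fintype.card Γ : ℝ≥0∞) ^ n := by
  rw [occupationWeight, ← mul_assoc, ENNReal.mul_inv_cancel
    (by exact_mod_cast (Nat.factorial_pos n).ne') (ENNReal.natCast_ne_top _), one_mul]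
  split_ifs with hf
  swap
  · exact zero_le
  calc (Fintype.card Γ : ℝ≥0∞)⁻¹ * ∑ c, (if ∀ i, col (f i) = c then
        (Fintype.card Γ : ℝ≥0∞) ^ n *
          ∏ j ∈ univ.filter (fun j => col j = c) \ univ.image f, (1 - Fintype.card Γ * m j) else 0)
      ≤ (Fintype.card Γ : ℝ≥0∞)⁻¹ * ∑ _c : Γ, (Fintype.card Γ : ℝ≥0∞) ^ n := by
        gcongr with c
        split_ifs
        · exact mul_le_of_le_one_right' (prod_le_one' fun j _ => tsub_le_self)
        · exact zero_le
    _ = (Fintype.card Γ : ℝ≥0∞) ^ n := by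
        rw [sum_const, card_univ, nsmul_eq_mul, ← mul_assoc, card_inv_mul_card, one_mul]

end Occupation

/-! ### Conflict-free configurations with prescribed label frequencies -/

section Exchange

open Finset Function

variable {J : Type*} {N : ℕ}

/-- The number of ordered pairs of positions whose labels are in conflict. -/
noncomputable def conflictCount (r : J → J → Prop) [DecidableRel r] (f : Fin N → J) : ℝ :=
  ∑ p : Fin N × Fin N, if p.1 ≠ p.2 ∧ r (f p.1) (f p.2) then 1 else 0

/-- Replacing a label by one without conflicts does not create conflicting pairs. -/
theorem conflict_of_update {r : J → J → Prop} {f : Fin N → J} {a : Fin N} {y : J}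
    (hr : ∀ i, i ≠ a → ¬ r (f i) y ∧ ¬ r y (f i)) {i k : Fin N} (hik : i ≠ k)
    (h : r (update f a y i) (update f a y k)) : i ≠ a ∧ r (f i) (f k) := by
  rcases eq_or_ne i a with rfl | hi
  · rw [update_self, update_of_ne hik.symm] at h
    exact absurd h (hr k hik.symm).2
  rcases eq_or_ne k a with rfl | hk
  · rw [update_self, update_of_ne hik] at h
    exact absurd h (hr i hik).1
  · rw [update_of_ne hi, update_of_ne hk] at h
    exact ⟨hi, h⟩

theorem conflictCount_update_le {r : J → J → Prop} [DecidableRel r] {f : Fin N → J} {a : Fin N}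
    {y : J} (hr : ∀ i, i ≠ a → ¬ r (f i) y ∧ ¬ r y (f i)) :
    conflictCount r (update f a y) ≤ conflictCount r f := by
  refine sum_le_sum fun p _ => ?_
  by_cases h : p.1 ≠ p.2 ∧ r (update f a y p.1) (update f a y p.2)
  · rw [if_pos h, if_pos ⟨h.1, (conflict_of_update hr h.1 h.2).2⟩]
  · rw [if_neg h]
    split_ifs <;> norm_num

theorem conflictCount_update_lt {r : J → J → Prop} [DecidableRel r] {f : Fin N → J} {a b : Fin N}
    {y : J} (hr : ∀ i, i ≠ a → ¬ r (f i) y ∧ ¬ r y (f i)) (hab : a ≠ b) (hf : r (f a) (f b)) :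
    conflictCount r (update f a y) < conflictCount r f := by
  refine sum_lt_sum (fun p _ => ?_) ⟨(a, b), mem_univ _, ?_⟩
  · by_cases h : p.1 ≠ p.2 ∧ r (update f a y p.1) (update f a y p.2)
    · rw [if_pos h, if_pos ⟨h.1, (conflict_of_update hr h.1 h.2).2⟩]
    · rw [if_neg h]
      split_ifs <;> norm_num
  · rw [if_neg fun h => (conflict_of_update hr h.1 h.2).1 rfl, if_pos ⟨hab, hf⟩]
    norm_num

theorem sum_update_add (h : J → ℝ) (f : Fin N → J) (a : Fin N) (y : J) :
    ∑ i, h (update f a y i) + h (f a) = ∑ i, h (f i) + h y := by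
  rw [← add_sum_erase _ _ (mem_univ a), ← add_sum_erase (a := a) _ (fun i => h (f i)) (mem_univ a),
    update_self]
  have : ∑ i ∈ univ.erase a, h (update f a y i) = ∑ i ∈ univ.erase a, h (f i) :=
    sum_congr rfl fun i hi => by rw [update_of_ne (ne_of_mem_erase hi)]
  rw [this]; ring

variable [Fintype J] [DecidableEq J]

/-- The probability distributions on `N`-tuples of labels with expected label counts `m`. -/
def labelDistributions (N : ℕ) (m : J → ℝ) : Set ((Fin N → J) → ℝ) :=
  {q ∈ stdSimplex ℝ (Fin N → J) | ∀ j, ∑ f, q f * ∑ i, (if f i = j then 1 else 0) = m j}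

theorem isCompact_labelDistributions (N : ℕ) (m : J → ℝ) : IsCompact (labelDistributions N m) := by
  have h : labelDistributions N m = stdSimplex ℝ (Fin N → J) ∩
      ⋂ j, {q | ∑ f, q f * ∑ i, (if f i = j then 1 else 0) = m j} := by
    ext q
    simp [labelDistributions]
  rw [h]
  refine (isCompact_stdSimplex ℝ (Fin N → J)).inter_right ?_
  refine isClosed_iInter fun j => isClosed_eq ?_ continuous_const
  fun_prop

theorem labelDistributions_sum {m : J → ℝ} {q : (Fin N → J) → ℝ} (hq : q ∈ labelDistributions N m)
    (h : J → ℝ) : ∑ f, q f * ∑ i, h (f i) = ∑ j, h j * m j := by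
  have h1 : ∀ j, h j * m j = ∑ f, ∑ i, h j * (q f * (if f i = j then 1 else 0)) := fun j => by
    simp_rw [← hq.2 j, mul_sum]
  rw [sum_congr rfl fun j _ => h1 j, sum_comm]
  refine sum_congr rfl fun f _ => ?_
  rw [sum_comm, mul_sum]
  refine sum_congr rfl fun i _ => ?_
  simp [mul_comm]

/-- Independent labels with distribution `m / N` have expected counts `m`. -/
theorem labelDistributions_nonempty (hN : N ≠ 0) {m : J → ℝ} (hm : ∀ j, 0 ≤ m j)
    (hsum : ∑ j, m j = N) : (labelDistributions N m).Nonempty := by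
  have hN' : (N : ℝ) ≠ 0 := by exact_mod_cast hN
  have hone : ∑ j, m j / N = 1 := by rw [← sum_div, hsum, div_self hN']
  have hprod : ∑ f : Fin N → J, ∏ i, m (f i) / N = 1 := by
    rw [← Fintype.piFinset_univ, ← prod_univ_sum (fun _ => univ) (fun _ j => m j / N)]
    simp [hone]
  refine ⟨fun f => ∏ i, m (f i) / N, ⟨fun f => prod_nonneg fun i _ => by
    have := hm (f i); positivity, hprod⟩, fun j => ?_⟩
  simp_rw [mul_sum]
  rw [sum_comm]
  have h1 : ∀ i : Fin N, ∑ f : Fin N → J, (∏ k, m (f k) / N) * (if f i = j then 1 else 0) =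
      m j / N := by
    intro i
    have h2 : ∀ f : Fin N → J, (∏ k, m (f k) / N) * (if f i = j then (1 : ℝ) else 0) =
        ∏ k, (if k = i then (if f k = j then m (f k) / N else 0) else m (f k) / N) := by
      intro f
      rw [← mul_prod_erase _ _ (mem_univ i),
        ← mul_prod_erase (a := i) _ (fun k => if k = i then _ else _) (mem_univ i), if_pos rfl]
      have h3 : ∏ k ∈ univ.erase i, (if k = i then (if f k = j then m (f k) / N else 0)
          else m (f k) / N) = ∏ k ∈ univ.erase i, m (f k) / N :=
        prod_congr rfl fun k hk => if_neg (ne_of_mem_erase hk)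
      rw [h3]
      split_ifs <;> simp
    simp_rw [h2]
    rw [← Fintype.piFinset_univ, ← prod_univ_sum (fun _ => univ)
      (fun k j' => if k = i then (if j' = j then m j' / N else 0) else m j' / N),
      prod_eq_single i]
    · simp
    · intro k _ hk
      simp only [if_neg hk]
      exact hone
    · simp
  rw [sum_congr rfl fun i _ => h1 i, sum_const, card_univ, Fintype.card_fin, nsmul_eq_mul,
    mul_div_cancel₀ _ hN']

/-- If every label is in conflict with labels of total frequency less than `1/2`, there is a
distribution of `N`-tuples of labels with the given frequencies and without conflicts. In a
distribution with the least expected number of conflicts, exchanging a conflicting label with a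
suitable label of another tuple would lower that number. -/
theorem exists_conflictFree_distribution (hN : N ≠ 0) {m : J → ℝ} (hm : ∀ j, 0 ≤ m j)
    (hsum : ∑ j, m j = N) (r : J → J → Prop) [DecidableRel r] (hrefl : ∀ j, r j j)
    (hsymm : ∀ j k, r j k → r k j) {c : ℝ} (hc : c < 1 / 2)
    (hr : ∀ j, ∑ k, (if r j k then 1 else 0) * m k ≤ c) :
    ∃ q ∈ labelDistributions N m, ∀ f, q f ≠ 0 → ∀ i k, i ≠ k → ¬ r (f i) (f k) := by
  have hN' : (0 : ℝ) < N := by exact_mod_cast Nat.pos_of_ne_zero hN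
  obtain ⟨q, hq, hmin⟩ := (isCompact_labelDistributions N m).exists_isMinOn
    (labelDistributions_nonempty hN hm hsum)
    (f := fun q => ∑ f, q f * conflictCount r f) (by fun_prop)
  refine ⟨q, hq, fun f hf a b hab hconf => ?_⟩
  have hq0 : ∀ f, 0 ≤ q f := hq.1.1
  have hfpos : 0 < q f := lt_of_le_of_ne (hq0 f) (Ne.symm hf)
  -- Under `q`, the expected number of labels of `g` in conflict with `f a` is at most `c`, and so
  -- is the expected number of pairs in conflict between `f` and `g`, divided by `N`. As `2 c < 1`,
  -- some `g` avoids conflicts with `f a` and has a label `g p` without conflicts with `f`.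
  obtain ⟨g, p, hg, hgf, hfg⟩ : ∃ g p, 0 < q g ∧ (∀ i, ¬ r (f i) (g p)) ∧
      ∀ i, ¬ r (f a) (g i) := by
    by_contra! hno
    set X : (Fin N → J) → ℝ := fun g => ∑ i, if r (f a) (g i) then 1 else 0 with hX
    set Y : (Fin N → J) → ℝ := fun g => ∑ p, ∑ i, if r (f i) (g p) then 1 else 0 with hY
    have hXY : ∀ g, 0 < q g → 1 ≤ X g + Y g / N := by
      intro g hg
      have hX0 : 0 ≤ X g := sum_nonneg fun i _ => by split_ifs <;> norm_num
      have hY0 : 0 ≤ Y g := sum_nonneg fun p _ => sum_nonneg fun i _ => by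
        split_ifs <;> norm_num
      by_cases h : ∃ i, r (f a) (g i)
      · obtain ⟨i, hi⟩ := h
        have h1 : 1 ≤ X g := by
          have := single_le_sum (f := fun i => if r (f a) (g i) then (1 : ℝ) else 0)
            (fun i _ => by split_ifs <;> norm_num) (mem_univ i)
          rwa [if_pos hi] at this
        have : 0 ≤ Y g / N := by positivity
        linarith
      · push Not at h
        have h1 : (N : ℝ) ≤ Y g := by
          calc (N : ℝ) = ∑ _p : Fin N, (1 : ℝ) := by simp
            _ ≤ Y g := by
              refine sum_le_sum fun p _ => ?_
              by_cases hp : ∃ i, r (f i) (g p)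
              · obtain ⟨i, hi⟩ := hp
                have := single_le_sum (f := fun i => if r (f i) (g p) then (1 : ℝ) else 0)
                  (fun i _ => by split_ifs <;> norm_num) (mem_univ i)
                rwa [if_pos hi] at this
              · push Not at hp
                obtain ⟨i, hi⟩ := hno g p hg hp
                exact absurd hi (h i)
        have : 1 ≤ Y g / N := by rwa [le_div_iff₀ hN', one_mul]
        linarith
    have hsumX : ∑ g, q g * X g ≤ c := by
      rw [hX, labelDistributions_sum hq fun k => if r (f a) k then (1 : ℝ) else 0]
      exact hr (f a)
    have hsumY : ∑ g, q g * Y g ≤ N * c := by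
      rw [hY, labelDistributions_sum hq fun k => ∑ i, if r (f i) k then (1 : ℝ) else 0]
      simp_rw [sum_mul]
      rw [sum_comm]
      calc _ ≤ ∑ _i : Fin N, c := sum_le_sum fun i _ => hr (f i)
        _ = N * c := by simp
    have h1 : (1 : ℝ) ≤ ∑ g, q g * X g + (∑ g, q g * Y g) / N := by
      rw [← hq.1.2, sum_div, ← sum_add_distrib]
      refine sum_le_sum fun g _ => ?_
      rcases (hq0 g).eq_or_lt with h0 | h0
      · simp [← h0]
      · have := mul_le_mul_of_nonneg_left (hXY g h0) h0.le
        rw [mul_one, mul_add, ← mul_div_assoc] at this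
        exact this
    have h2 : (∑ g, q g * Y g) / N ≤ c := by
      rw [div_le_iff₀ hN', mul_comm]
      exact hsumY
    linarith
  have hne : f ≠ g := by
    rintro rfl
    exact hfg a (hrefl _)
  set f' := update f a (g p) with hf'
  set g' := update g p (f a) with hg'
  set ε := min (q f) (q g) with hε
  have hε0 : 0 < ε := lt_min hfpos hg
  set q' : (Fin N → J) → ℝ := fun h => q h + ε * ((if h = f' then 1 else 0) +
    (if h = g' then 1 else 0) - (if h = f then 1 else 0) - (if h = g then 1 else 0)) with hq'
  have hsumq' : ∀ F : (Fin N → J) → ℝ, ∑ h, q' h * F h =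
      ∑ h, q h * F h + ε * (F f' + F g' - F f - F g) := by
    intro F
    simp only [hq', add_mul, sum_add_distrib, mul_assoc, ← mul_sum, sub_mul, sum_sub_distrib,
      ite_mul, one_mul, zero_mul, sum_ite_eq', mem_univ, if_true]
  have hq'mem : q' ∈ labelDistributions N m := by
    refine ⟨⟨fun h => ?_, ?_⟩, fun j => ?_⟩
    · have h1 : (0 : ℝ) ≤ if h = f' then 1 else 0 := by split_ifs <;> norm_num
      have h2 : (0 : ℝ) ≤ if h = g' then 1 else 0 := by split_ifs <;> norm_num
      have h3 : ε * (if h = f then 1 else 0) + ε * (if h = g then 1 else 0) ≤ q h := by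
        by_cases hf1 : h = f
        · subst hf1
          rw [if_pos rfl, if_neg hne]
          rw [mul_one, mul_zero, add_zero]
          exact min_le_left _ _
        · by_cases hg1 : h = g
          · subst hg1
            rw [if_neg hf1, if_pos rfl]
            rw [mul_one, mul_zero, zero_add]
            exact min_le_right _ _
          · simpa [hf1, hg1] using hq0 h
      have h4 := mul_nonneg hε0.le h1
      have h5 := mul_nonneg hε0.le h2
      simp only [hq', mul_add, mul_sub]
      linarith
    · have := hsumq' fun _ => 1
      simp only [mul_one] at this
      rw [this, hq.1.2]
      ring
    · rw [hsumq', hq.2]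
      have h1 := sum_update_add (fun k => if k = j then (1 : ℝ) else 0) f a (g p)
      have h2 := sum_update_add (fun k => if k = j then (1 : ℝ) else 0) g p (f a)
      rw [← hf'] at h1
      rw [← hg'] at h2
      have h3 : (∑ i, if f' i = j then (1 : ℝ) else 0) + (∑ i, if g' i = j then (1 : ℝ) else 0) -
        (∑ i, if f i = j then (1 : ℝ) else 0) - (∑ i, if g i = j then (1 : ℝ) else 0) = 0 := by
        linarith
      rw [h3, mul_zero, add_zero]
  have hle : ∑ h, q h * conflictCount r h ≤ ∑ h, q' h * conflictCount r h := hmin hq'mem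
  rw [hsumq'] at hle
  have h1 : conflictCount r f' < conflictCount r f :=
    conflictCount_update_lt (fun i _ => ⟨hgf i, fun h => hgf i (hsymm _ _ h)⟩) hab hconf
  have h2 : conflictCount r g' ≤ conflictCount r g :=
    conflictCount_update_le fun i _ => ⟨fun h => hfg i (hsymm _ _ h), hfg i⟩
  nlinarith [mul_pos hε0 (show 0 < conflictCount r f + conflictCount r g - conflictCount r f' -
    conflictCount r g' by linarith)]

/-- Averaging over permutations preserves expected label counts. -/
theorem symmetrization_mem_labelDistributions {m : J → ℝ} {q : (Fin N → J) → ℝ}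
    (hq : q ∈ labelDistributions N m) :
    (fun f => (N ! : ℝ)⁻¹ * ∑ σ : Equiv.Perm (Fin N), q fun i => f (σ i)) ∈
      labelDistributions N m := by
  have hfac : (N ! : ℝ) ≠ 0 := by exact_mod_cast (Nat.factorial_pos N).ne'
  have havg : ∀ F : (Fin N → J) → ℝ, (∀ (σ : Equiv.Perm (Fin N)) f, F (fun i => f (σ i)) = F f) →
      ∑ f, ((N ! : ℝ)⁻¹ * ∑ σ : Equiv.Perm (Fin N), q fun i => f (σ i)) * F f = ∑ f, q f * F f := by
    intro F hF
    simp_rw [mul_assoc, ← mul_sum, sum_mul]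
    rw [sum_comm]
    have h1 : ∀ σ : Equiv.Perm (Fin N), ∑ f : Fin N → J, (q fun i => f (σ i)) * F f =
        ∑ f, q f * F f := by
      intro σ
      refine Fintype.sum_equiv (σ.symm.arrowCongr (Equiv.refl J)) _ _ fun f => ?_
      rw [← hF σ f]
      rfl
    rw [sum_congr rfl fun σ _ => h1 σ, sum_const, card_univ, Fintype.card_perm, Fintype.card_fin,
      nsmul_eq_mul, ← mul_assoc, inv_mul_cancel₀ hfac, one_mul]
  refine ⟨⟨fun f => mul_nonneg (by positivity) (sum_nonneg fun σ _ => hq.1.1 _), ?_⟩, fun j => ?_⟩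
  · have := havg (fun _ => 1) fun _ _ => rfl
    simp only [mul_one] at this
    exact this.trans hq.1.2
  · rw [havg (fun f => ∑ i, if f i = j then 1 else 0) fun σ f =>
      Equiv.sum_comp σ fun i => if f i = j then (1 : ℝ) else 0]
    exact hq.2 j

/-- The conflict-free distribution, as symmetric weights of a state. -/
theorem exists_conflictFree_weight {E : Type*} [MeasurableSpace E] [MeasurableSpace J]
    {μ : Measure E} [IsFiniteMeasure μ] {g : E → J} (hN : N ≠ 0)
    (hsum : ∑ j, μ (g ⁻¹' {j}) = N) (r : J → J → Prop) [DecidableRel r] (hrefl : ∀ j, r j j)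
    (hsymm : ∀ j k, r j k → r k j) {c : ℝ} (hc0 : 0 ≤ c) (hc : c < 1 / 2)
    (hr : ∀ j, (∑ k, if r j k then μ (g ⁻¹' {k}) else 0) ≤ ENNReal.ofReal c) :
    ∃ W : (Fin N → J) → ℝ≥0∞, (∀ (σ : Equiv.Perm (Fin N)) f, W (fun i => f (σ i)) = W f) ∧
      ∑ f, W f * ∏ k, μ (g ⁻¹' {f k}) = 1 ∧ (∀ j, labelMean μ g W j = μ (g ⁻¹' {j})) ∧
      ∀ f, W f ≠ 0 → ∀ i k, i ≠ k → ¬ r (f i) (f k) := by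
  set m : J → ℝ := fun j => (μ (g ⁻¹' {j})).toReal with hm
  have hm0 : ∀ j, 0 ≤ m j := fun j => ENNReal.toReal_nonneg
  have hofm : ∀ j, ENNReal.ofReal (m j) = μ (g ⁻¹' {j}) := fun j =>
    ENNReal.ofReal_toReal (measure_ne_top _ _)
  have hmsum : ∑ j, m j = N := by
    rw [← ENNReal.toReal_sum fun j _ => measure_ne_top _ _, hsum, ENNReal.toReal_natCast]
  have hmr : ∀ j, ∑ k, (if r j k then 1 else 0) * m k ≤ c := by
    intro j
    have h1 := ENNReal.toReal_mono ENNReal.ofReal_ne_top (hr j)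
    rw [ENNReal.toReal_ofReal hc0, ENNReal.toReal_sum fun k _ => by
      split_ifs <;> simp] at h1
    refine le_of_eq_of_le (sum_congr rfl fun k _ => ?_) h1
    split_ifs <;> simp [hm]
  obtain ⟨q, hq, hfree⟩ := exists_conflictFree_distribution hN hm0 hmsum r hrefl hsymm hc hmr
  set Q : (Fin N → J) → ℝ := fun f => (N ! : ℝ)⁻¹ * ∑ σ : Equiv.Perm (Fin N), q fun i => f (σ i)
    with hQ
  have hQmem : Q ∈ labelDistributions N m := symmetrization_mem_labelDistributions hq
  have hQ0 : ∀ f, 0 ≤ Q f := hQmem.1.1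
  have hQm : ∀ f i, m (f i) = 0 → Q f = 0 := by
    intro f i hfi
    have h1 := hQmem.2 (f i)
    rw [hfi] at h1
    have hnn : ∀ f', 0 ≤ Q f' * ∑ k, (if f' k = f i then (1 : ℝ) else 0) := fun f' =>
      mul_nonneg (hQ0 f') (sum_nonneg fun k _ => by split_ifs <;> norm_num)
    have h2 := (sum_eq_zero_iff_of_nonneg fun f' _ => hnn f').1 h1 f (mem_univ f)
    refine (mul_eq_zero.1 h2).resolve_right (ne_of_gt ?_)
    refine lt_of_lt_of_le one_pos ?_
    have := single_le_sum (f := fun k => if f k = f i then (1 : ℝ) else 0)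
      (fun k _ => by split_ifs <;> norm_num) (mem_univ i)
    rwa [if_pos rfl] at this
  have hWprod : ∀ f : Fin N → J, ENNReal.ofReal (Q f) / (∏ k, μ (g ⁻¹' {f k})) *
      ∏ k, μ (g ⁻¹' {f k}) = ENNReal.ofReal (Q f) := by
    intro f
    refine ENNReal.div_mul_cancel' (fun h => ?_) fun h =>
      absurd h (ENNReal.prod_ne_top fun k _ => measure_ne_top _ _)
    obtain ⟨k, _, hk⟩ := prod_eq_zero_iff.1 h
    rw [hQm f k (by rw [hm]; simp [hk]), ENNReal.ofReal_zero]
  refine ⟨fun f => ENNReal.ofReal (Q f) / ∏ k, μ (g ⁻¹' {f k}), fun σ f => ?_, ?_, fun j => ?_,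
    fun f hf i k hik => ?_⟩
  · have h1 : Q (fun i => f (σ i)) = Q f := by
      have h3 := Equiv.sum_comp (Equiv.mulLeft σ)
        fun τ : Equiv.Perm (Fin N) => q fun i => f (τ i)
      simp only [hQ, ← h3]
      rfl
    have h2 : ∏ k, μ (g ⁻¹' {f (σ k)}) = ∏ k, μ (g ⁻¹' {f k}) :=
      Equiv.prod_comp σ fun k => μ (g ⁻¹' {f k})
    simp only [h1, h2]
  · simp_rw [hWprod]
    rw [← ENNReal.ofReal_sum_of_nonneg fun f _ => hQ0 f, hQmem.1.2, ENNReal.ofReal_one]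
  · simp_rw [labelMean, hWprod]
    rw [← hofm j, ← hQmem.2 j, ENNReal.ofReal_sum_of_nonneg fun f _ => mul_nonneg (hQ0 f)
      (sum_nonneg fun k _ => by split_ifs <;> norm_num)]
    refine sum_congr rfl fun f _ => ?_
    rw [mul_sum, ENNReal.ofReal_sum_of_nonneg fun i _ => mul_nonneg (hQ0 f)
      (by split_ifs <;> norm_num)]
    refine sum_congr rfl fun i _ => ?_
    split_ifs <;> simp
  · have h1 : Q f ≠ 0 := fun h => hf (by simp [h])
    obtain ⟨σ, _, hσ⟩ := exists_ne_zero_of_sum_ne_zero (right_ne_zero_of_mul h1)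
    simpa using hfree _ hσ (σ.symm i) (σ.symm k) (by simpa using hik)

end Exchange

/-! ### Labellings by cubes of side comparable to the local radius -/

section Cells

open Set Filter Topology Metric

/-- The labelling that keeps the labels in the finite set `F` and merges all others. -/
def truncLabel {E Λ : Type*} [DecidableEq Λ] (ℓ : E → Λ) (F : Finset Λ) (x : E) : Option F :=
  if h : ℓ x ∈ F then some ⟨ℓ x, h⟩ else none

section Trunc

variable {E Λ : Type*} [DecidableEq Λ] {ℓ : E → Λ} {F : Finset Λ}

theorem truncLabel_eq_some {x : E} {l : F} : truncLabel ℓ F x = some l ↔ ℓ x = l := by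
  unfold truncLabel
  split_ifs with h
  · simp [Subtype.ext_iff]
  · simp only [false_iff]
    exact fun h' => h (h' ▸ l.2)

theorem truncLabel_eq_none {x : E} : truncLabel ℓ F x = none ↔ ℓ x ∉ F := by
  unfold truncLabel
  split_ifs with h <;> simp [h]

theorem measurable_truncLabel [MeasurableSpace E] [MeasurableSpace Λ] [Countable Λ]
    [MeasurableSingletonClass Λ] [MeasurableSpace (Option F)] (hℓ : Measurable ℓ) :
    Measurable (truncLabel ℓ F) := by
  have h : truncLabel ℓ F = (fun l : Λ => if h : l ∈ F then some (⟨l, h⟩ : F) else none) ∘ ℓ := rfl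
  rw [h]
  exact Measurable.of_discrete.comp hℓ

/-- All but a small part of the mass lies in finitely many of countably many cells. -/
theorem exists_measure_truncLabel_none_le [MeasurableSpace E] [MeasurableSpace Λ] [Countable Λ]
    [MeasurableSingletonClass Λ] {μ : Measure E} [IsFiniteMeasure μ] (hℓ : Measurable ℓ)
    {c : ℝ≥0∞} (hc : 0 < c) : ∃ F : Finset Λ, μ (truncLabel ℓ F ⁻¹' {none}) ≤ c := by
  have hsum : ∑' l, μ (ℓ ⁻¹' {l}) ≠ ∞ := by
    rw [← measure_iUnion]
    · exact measure_ne_top _ _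
    · intro l l' h
      exact Disjoint.preimage _ (by simpa using h)
    · exact fun l => hℓ (measurableSet_singleton l)
  obtain ⟨F, hF⟩ := ((ENNReal.tendsto_tsum_compl_atTop_zero hsum).eventually
    (gt_mem_nhds hc)).exists
  refine ⟨F, le_trans ?_ hF.le⟩
  have hsub : truncLabel ℓ F ⁻¹' {none} ⊆ ⋃ l : {l // l ∉ F}, ℓ ⁻¹' {(l : Λ)} := by
    intro x hx
    have : ℓ x ∉ F := truncLabel_eq_none.1 hx
    exact mem_iUnion.2 ⟨⟨ℓ x, this⟩, rfl⟩
  exact (measure_mono hsub).trans (measure_iUnion_le _)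

end Trunc

variable {d : ℕ}

theorem norm_le_mul_of_coord_le {x : EuclideanSpace ℝ (Fin d)} {h : ℝ} (hh : 0 ≤ h)
    (hx : ∀ i, |x i| ≤ h) : ‖x‖ ≤ d * h := by
  have h1 : ∑ i, ‖x i‖ ^ 2 ≤ ∑ _i : Fin d, h ^ 2 := by
    refine Finset.sum_le_sum fun i _ => ?_
    rw [Real.norm_eq_abs]
    exact pow_le_pow_left₀ (abs_nonneg _) (hx i) 2
  rw [EuclideanSpace.norm_eq]
  refine Real.sqrt_le_iff.2 ⟨by positivity, h1.trans ?_⟩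
  rw [Finset.sum_const, Finset.card_univ, Fintype.card_fin, nsmul_eq_mul, mul_pow]
  have h2 : (d : ℝ) ≤ (d : ℝ) ^ 2 := by exact_mod_cast Nat.le_self_pow two_ne_zero d
  gcongr

theorem abs_sub_lt_of_floor_div_eq {a b h : ℝ} (hh : 0 < h) (hab : ⌊a / h⌋ = ⌊b / h⌋) :
    |a - b| < h := by
  have h1 := Int.abs_sub_lt_one_of_floor_eq_floor hab
  rwa [← sub_div, abs_div, abs_of_pos hh, div_lt_one hh] at h1

theorem le_abs_sub_of_floor_div {a b h : ℝ} (hh : 0 < h) (hne : ⌊a / h⌋ ≠ ⌊b / h⌋)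
    (hmod : ((⌊a / h⌋ : ℤ) : ZMod 2) = ((⌊b / h⌋ : ℤ) : ZMod 2)) : h ≤ |a - b| := by
  have hdvd : (2 : ℤ) ∣ ⌊a / h⌋ - ⌊b / h⌋ := by
    have := (ZMod.intCast_eq_intCast_iff_dvd_sub _ _ 2).1 hmod.symm
    exact_mod_cast this
  have h2 : (2 : ℤ) ≤ |⌊a / h⌋ - ⌊b / h⌋| :=
    Int.le_of_dvd (abs_pos.2 (sub_ne_zero.2 hne)) ((dvd_abs _ _).2 hdvd)
  have h3 : (1 : ℝ) ≤ |a / h - b / h| := by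
    have ha := Int.floor_le (a / h)
    have ha' := Int.lt_floor_add_one (a / h)
    have hb := Int.floor_le (b / h)
    have hb' := Int.lt_floor_add_one (b / h)
    rcases le_abs.1 h2 with h4 | h4
    · have h5 : (2 : ℝ) ≤ (⌊a / h⌋ : ℝ) - ⌊b / h⌋ := by exact_mod_cast h4
      exact (by linarith : (1 : ℝ) ≤ a / h - b / h).trans (le_abs_self _)
    · have h5 : (2 : ℝ) ≤ -((⌊a / h⌋ : ℝ) - ⌊b / h⌋) := by exact_mod_cast h4
      exact (by linarith : (1 : ℝ) ≤ -(a / h - b / h)).trans (neg_le_abs _)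
  rwa [← sub_div, abs_div, abs_of_pos hh, le_div_iff₀ hh, one_mul] at h3

/-- The dyadic level of a positive number. -/
noncomputable def dyadicLevel (t : ℝ) : ℤ := ⌊Real.logb 2 t⌋

theorem rpow_dyadicLevel_le {t : ℝ} (ht : 0 < t) : (2 : ℝ) ^ (dyadicLevel t : ℝ) ≤ t := by
  rw [← Real.le_logb_iff_rpow_le one_lt_two ht]
  exact Int.floor_le _

theorem lt_rpow_dyadicLevel_add_one {t : ℝ} (ht : 0 < t) :
    t < (2 : ℝ) ^ ((dyadicLevel t : ℝ) + 1) := by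
  rw [← Real.logb_lt_iff_lt_rpow one_lt_two ht]
  exact Int.lt_floor_add_one _

/-- The side of the cubes used at points whose radius has dyadic level `n`. -/
noncomputable def cubeSide (d : ℕ) (n : ℤ) : ℝ := (2 : ℝ) ^ (n : ℝ) / (2 * d)

/-- The dyadic level of the radius at a point, together with the cube containing the point in the
grid belonging to this level. -/
noncomputable def radiusCube (r : EuclideanSpace ℝ (Fin d) → ℝ) (x : EuclideanSpace ℝ (Fin d)) :
    ℤ × (Fin d → ℤ) :=
  (dyadicLevel (r x), fun i => ⌊x i / cubeSide d (dyadicLevel (r x))⌋)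

theorem measurable_radiusCube {r : EuclideanSpace ℝ (Fin d) → ℝ} (hr : Measurable r) :
    Measurable (radiusCube r) := by
  have h1 : Measurable fun x => dyadicLevel (r x) := by
    unfold dyadicLevel Real.logb
    exact Int.measurable_floor.comp (by fun_prop)
  refine h1.prodMk (measurable_pi_lambda _ fun i => Int.measurable_floor.comp ?_)
  have h2 : Measurable fun x => cubeSide d (dyadicLevel (r x)) :=
    (Measurable.of_discrete (f := cubeSide d)).comp h1
  have h3 : Measurable fun x : EuclideanSpace ℝ (Fin d) => x i := by fun_prop
  exact h3.div h2

variable {r : EuclideanSpace ℝ (Fin d) → ℝ}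

theorem cubeSide_pos (hd : 1 ≤ d) (n : ℤ) : 0 < cubeSide d n := by
  have : (0 : ℝ) < d := by exact_mod_cast hd
  unfold cubeSide; positivity

theorem dist_le_of_radiusCube_eq (hd : 1 ≤ d) (hr0 : ∀ x, 0 < r x)
    {x y : EuclideanSpace ℝ (Fin d)} (h : radiusCube r x = radiusCube r y) :
    dist x y ≤ r y / 2 := by
  have hd0 : (0 : ℝ) < d := by exact_mod_cast hd
  have h1 : dyadicLevel (r x) = dyadicLevel (r y) := congrArg Prod.fst h
  have hs := cubeSide_pos hd (dyadicLevel (r y))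
  have h2 : ∀ i, |(x - y) i| ≤ cubeSide d (dyadicLevel (r y)) := by
    intro i
    have h3 := congrFun (congrArg Prod.snd h) i
    simp only [radiusCube, h1] at h3
    exact (abs_sub_lt_of_floor_div_eq hs h3).le
  rw [dist_eq_norm]
  calc ‖x - y‖ ≤ d * cubeSide d (dyadicLevel (r y)) := norm_le_mul_of_coord_le hs.le h2
    _ = 2 ^ (dyadicLevel (r y) : ℝ) / 2 := by unfold cubeSide; field_simp
    _ ≤ r y / 2 := by
      have := rpow_dyadicLevel_le (hr0 y)
      linarith

/-- The colour of a cube: the parities of its level and of its position. -/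
def cubeColor (l : ℤ × (Fin d → ℤ)) : ZMod 2 × (Fin d → ZMod 2) :=
  (l.1, fun i => l.2 i)

/-- Distinct cubes of the same colour are separated: at equal levels by a full side, at different
levels because the radius changes by a factor of two. -/
theorem le_norm_sub_of_cubeColor_eq (hd : 1 ≤ d) (hr0 : ∀ x, 0 < r x)
    (hr : ∀ x y, r x ≤ r y + dist x y) {x y : EuclideanSpace ℝ (Fin d)}
    (hne : radiusCube r x ≠ radiusCube r y)
    (hcol : cubeColor (radiusCube r x) = cubeColor (radiusCube r y)) :
    1 / (4 * d) * max (r x) (r y) ≤ ‖x - y‖ := by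
  have hd0 : (1 : ℝ) ≤ d := by exact_mod_cast hd
  have hη : 1 / (4 * (d : ℝ)) ≤ 1 / 4 := by
    rw [div_le_div_iff₀ (by positivity) (by norm_num)]
    linarith
  have hlev : ∀ x y : EuclideanSpace ℝ (Fin d), dyadicLevel (r x) < dyadicLevel (r y) →
      ((dyadicLevel (r x) : ℤ) : ZMod 2) = ((dyadicLevel (r y) : ℤ) : ZMod 2) →
      1 / (4 * d) * max (r x) (r y) ≤ dist x y := by
    intro x y hlt hmod
    have h2 : dyadicLevel (r x) + 2 ≤ dyadicLevel (r y) := by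
      have hdvd := (ZMod.intCast_eq_intCast_iff_dvd_sub _ _ 2).1 hmod
      have := Int.le_of_dvd (by omega) hdvd
      push_cast at this
      omega
    have h3 : ((dyadicLevel (r x) : ℝ) + 1) + 1 ≤ dyadicLevel (r y) := by
      have : ((dyadicLevel (r x) + 2 : ℤ) : ℝ) ≤ dyadicLevel (r y) := by exact_mod_cast h2
      push_cast at this
      linarith
    have h4 : r x * 2 ≤ r y := by
      calc r x * 2 ≤ 2 ^ ((dyadicLevel (r x) : ℝ) + 1) * 2 := by
            gcongr
            exact (lt_rpow_dyadicLevel_add_one (hr0 x)).le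
        _ = (2 : ℝ) ^ (((dyadicLevel (r x) : ℝ) + 1) + 1) := by
            rw [Real.rpow_add_one two_ne_zero ((dyadicLevel (r x) : ℝ) + 1)]
        _ ≤ 2 ^ (dyadicLevel (r y) : ℝ) := Real.rpow_le_rpow_of_exponent_le one_le_two h3
        _ ≤ r y := rpow_dyadicLevel_le (hr0 y)
    have hx := hr0 x
    have hy := hr0 y
    have h5 := hr y x
    rw [dist_comm] at h5
    rw [max_eq_right (by linarith)]
    nlinarith
  have hcol1 : ((dyadicLevel (r x) : ℤ) : ZMod 2) = ((dyadicLevel (r y) : ℤ) : ZMod 2) :=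
    congrArg Prod.fst hcol
  rcases lt_trichotomy (dyadicLevel (r x)) (dyadicLevel (r y)) with hlt | heq | hgt
  · rw [← dist_eq_norm]
    exact hlev x y hlt hcol1
  · obtain ⟨i, hi⟩ : ∃ i, (radiusCube r x).2 i ≠ (radiusCube r y).2 i := by
      by_contra! hall
      exact hne (Prod.ext heq (funext hall))
    have hs := cubeSide_pos hd (dyadicLevel (r y))
    have hcol2 := congrFun (congrArg Prod.snd hcol) i
    simp only [cubeColor] at hcol2
    simp only [radiusCube, heq] at hi hcol2
    have h1 := le_abs_sub_of_floor_div hs hi hcol2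
    have h2 : |x i - y i| ≤ ‖x - y‖ := by
      have := PiLp.norm_apply_le (x - y) i
      rwa [Real.norm_eq_abs] at this
    have h3 : max (r x) (r y) ≤ 2 ^ (dyadicLevel (r y) : ℝ) * 2 := by
      rw [← Real.rpow_add_one two_ne_zero]
      exact max_le (heq ▸ (lt_rpow_dyadicLevel_add_one (hr0 x)).le)
        (lt_rpow_dyadicLevel_add_one (hr0 y)).le
    calc 1 / (4 * d) * max (r x) (r y) ≤ 1 / (4 * d) * (2 ^ (dyadicLevel (r y) : ℝ) * 2) := by
          gcongr
      _ = cubeSide d (dyadicLevel (r y)) := by unfold cubeSide; field_simp; norm_num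
      _ ≤ ‖x - y‖ := h1.trans h2
  · rw [max_comm, ← dist_eq_norm, dist_comm]
    exact hlev y x hgt hcol1.symm

/-- The colour of a truncated cube label; the merged cell has a colour of its own. -/
def truncColor {F : Finset (ℤ × (Fin d → ℤ))} (o : Option F) :
    Option (ZMod 2 × (Fin d → ZMod 2)) :=
  o.map fun l => cubeColor (l : ℤ × (Fin d → ℤ))

theorem measure_truncLabel_radiusCube_le [NeZero d] {μ : Measure (EuclideanSpace ℝ (Fin d))}
    [IsFiniteMeasure μ] [NullSingletonClass μ] {c : ℝ≥0∞} (hc0 : 0 < c) (hc : c < μ univ)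
    {F : Finset (ℤ × (Fin d → ℤ))}
    (hF : μ (truncLabel (radiusCube (localRadius μ c)) F ⁻¹' {none}) ≤ c) (o : Option F) :
    μ (truncLabel (radiusCube (localRadius μ c)) F ⁻¹' {o}) ≤ c := by
  have hd : 1 ≤ d := NeZero.one_le
  have hr0 := localRadius_pos hc0 hc (μ := μ)
  rcases o with _ | l
  · exact hF
  · rcases eq_empty_or_nonempty (truncLabel (radiusCube (localRadius μ c)) F ⁻¹' {some l})
      with he | ⟨y, hy⟩
    · rw [he, measure_empty]; exact zero_le
    · refine le_trans (measure_mono fun x hx => ?_)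
        (measure_closedBall_le_of_lt_localRadius (half_lt_self (hr0 y)))
      have hx' := truncLabel_eq_some.1 (show truncLabel _ F x = some l from hx)
      have hy' := truncLabel_eq_some.1 (show truncLabel _ F y = some l from hy)
      exact dist_le_of_radiusCube_eq hd hr0 (hx'.trans hy'.symm)

theorem separated_of_truncColor_eq [NeZero d] {μ : Measure (EuclideanSpace ℝ (Fin d))}
    [IsFiniteMeasure μ] [NullSingletonClass μ] {c : ℝ≥0∞} (hc0 : 0 < c) (hc : c < μ univ)
    {F : Finset (ℤ × (Fin d → ℤ))} {x y : EuclideanSpace ℝ (Fin d)}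
    (hne : truncLabel (radiusCube (localRadius μ c)) F x ≠
      truncLabel (radiusCube (localRadius μ c)) F y)
    (hcol : truncColor (truncLabel (radiusCube (localRadius μ c)) F x) =
      truncColor (truncLabel (radiusCube (localRadius μ c)) F y)) :
    1 / (4 * d) * max (localRadius μ c x) (localRadius μ c y) ≤ ‖x - y‖ := by
  rcases hx : truncLabel (radiusCube (localRadius μ c)) F x with _ | l <;>
    rcases hy : truncLabel (radiusCube (localRadius μ c)) F y with _ | l' <;>
    rw [hx, hy] at hne hcol
  · exact absurd rfl hne
  · exact absurd hcol (by simp [truncColor])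
  · exact absurd hcol (by simp [truncColor])
  · rw [truncLabel_eq_some] at hx hy
    refine le_norm_sub_of_cubeColor_eq NeZero.one_le (localRadius_pos hc0 hc)
      (localRadius_le_add_dist hc) ?_ ?_
    · rw [hx, hy]
      exact fun h => hne (congrArg some (Subtype.ext h))
    · rw [hx, hy]
      simpa [truncColor] using hcol

end Cells

/-! ### Intervals of equal mass, and fine grids -/

section Quantile

open Set Filter Topology

/-- A finite measure on the line without atoms has quantiles. -/
theorem exists_measure_Iic_eq (ν : Measure ℝ) [IsFiniteMeasure ν] [NullSingletonClass ν]
    {t : ℝ≥0∞} (ht0 : 0 < t) (ht : t < ν univ) : ∃ a, ν (Iic a) = t := by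
  have hmono : ∀ {a b : ℝ}, a ≤ b → ν (Iic a) ≤ ν (Iic b) := fun h =>
    measure_mono (Iic_subset_Iic.2 h)
  obtain ⟨b, hb⟩ : ∃ b, t < ν (Iic b) :=
    ((tendsto_measure_Iic_atTop ν).eventually (lt_mem_nhds ht)).exists
  have hne : {a | ν (Iic a) ≤ t}.Nonempty := by
    have h1 : Tendsto (fun n : ℕ => ν (Iic (-(n : ℝ)))) atTop (𝓝 (ν (⋂ n : ℕ, Iic (-(n : ℝ))))) :=
      tendsto_measure_iInter_atTop (fun n => measurableSet_Iic.nullMeasurableSet)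
        (fun m n h => Iic_subset_Iic.2 (neg_le_neg (by exact_mod_cast h))) ⟨0, measure_ne_top _ _⟩
    have h2 : (⋂ n : ℕ, Iic (-(n : ℝ))) = ∅ := by
      refine eq_empty_of_forall_notMem fun x hx => ?_
      obtain ⟨n, hn⟩ := exists_nat_gt (-x)
      have := mem_Iic.1 (mem_iInter.1 hx n)
      linarith
    rw [h2, measure_empty] at h1
    obtain ⟨n, hn⟩ := (h1.eventually (gt_mem_nhds ht0)).exists
    exact ⟨_, hn.le⟩
  have hbdd : BddAbove {a | ν (Iic a) ≤ t} := by
    refine ⟨b, fun a ha => ?_⟩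
    by_contra! h
    exact absurd (hb.trans_le (hmono h.le)) (not_lt.2 ha)
  refine ⟨sSup {a | ν (Iic a) ≤ t}, le_antisymm ?_ ?_⟩
  · set a := sSup {a | ν (Iic a) ≤ t} with ha
    have h1 : Tendsto (fun n : ℕ => ν (Iic (a - 1 / ((n : ℝ) + 1)))) atTop
        (𝓝 (ν (⋃ n : ℕ, Iic (a - 1 / ((n : ℝ) + 1))))) :=
      tendsto_measure_iUnion_atTop fun m n h => Iic_subset_Iic.2 (by
        have : (m : ℝ) ≤ n := by exact_mod_cast h
        gcongr)
    have h2 : (⋃ n : ℕ, Iic (a - 1 / ((n : ℝ) + 1))) = Iio a := by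
      ext x
      simp only [mem_iUnion, mem_Iic, mem_Iio]
      constructor
      · rintro ⟨n, hn⟩
        have : (0 : ℝ) < 1 / ((n : ℝ) + 1) := by positivity
        linarith
      · intro hx
        obtain ⟨n, hn⟩ := exists_nat_one_div_lt (sub_pos.2 hx)
        exact ⟨n, by linarith⟩
    rw [h2] at h1
    rw [← measure_congr (Iio_ae_eq_Iic (μ := ν) (a := a))]
    refine le_of_tendsto h1 (Eventually.of_forall fun n => ?_)
    have hlt : a - 1 / ((n : ℝ) + 1) < a := by
      have : (0 : ℝ) < 1 / ((n : ℝ) + 1) := by positivity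
      linarith
    obtain ⟨a', ha', hlt'⟩ := exists_lt_of_lt_csSup hne hlt
    exact (hmono hlt'.le).trans ha'
  · set a := sSup {a | ν (Iic a) ≤ t} with ha
    have h1 : Tendsto (fun n : ℕ => ν (Iic (a + 1 / ((n : ℝ) + 1)))) atTop
        (𝓝 (ν (⋂ n : ℕ, Iic (a + 1 / ((n : ℝ) + 1))))) :=
      tendsto_measure_iInter_atTop (fun n => measurableSet_Iic.nullMeasurableSet)
        (fun m n h => Iic_subset_Iic.2 (by
          have : (m : ℝ) ≤ n := by exact_mod_cast h
          gcongr)) ⟨0, measure_ne_top _ _⟩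
    have h2 : (⋂ n : ℕ, Iic (a + 1 / ((n : ℝ) + 1))) = Iic a := by
      ext x
      simp only [mem_iInter, mem_Iic]
      constructor
      · intro h
        refine le_of_forall_pos_le_add fun ε hε => ?_
        obtain ⟨n, hn⟩ := exists_nat_one_div_lt hε
        linarith [h n]
      · intro h n
        have : (0 : ℝ) < 1 / ((n : ℝ) + 1) := by positivity
        linarith
    rw [h2] at h1
    refine ge_of_tendsto h1 (Eventually.of_forall fun n => ?_)
    by_contra! h
    have := le_csSup hbdd (show a + 1 / ((n : ℝ) + 1) ∈ {a | ν (Iic a) ≤ t} from h.le)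
    have h3 : (0 : ℝ) < 1 / ((n : ℝ) + 1) := by positivity
    linarith

/-- A finite measure on the line without atoms is cut into `2 N` consecutive intervals of mass
`1 / 2` if its mass is `N`. -/
theorem exists_interval_labels (ν : Measure ℝ) [IsFiniteMeasure ν] [NullSingletonClass ν] {N : ℕ}
    (hN : N ≠ 0) (hν : ν univ = N) :
    ∃ g : ℝ → Fin (2 * N), Measurable g ∧ Monotone g ∧ ∀ j, ν (g ⁻¹' {j}) = 1 / 2 := by
  have hhalf : (2 : ℝ≥0∞) * (1 / 2) = 1 := ENNReal.mul_div_cancel two_ne_zero ENNReal.ofNat_ne_top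
  have hdivadd : ∀ k : ℕ, ((k + 1 : ℕ) : ℝ≥0∞) / 2 = k / 2 + 1 / 2 := fun k => by
    rw [← ENNReal.add_div]; norm_cast
  have hfin : ∀ k : ℕ, (k : ℝ≥0∞) / 2 ≠ ∞ := fun k =>
    ENNReal.div_ne_top (ENNReal.natCast_ne_top k) two_ne_zero
  have hq : ∀ k : ℕ, ∃ a : ℝ, 0 < k → k < 2 * N → ν (Iic a) = k / 2 := by
    intro k
    by_cases hk : 0 < k ∧ k < 2 * N
    · have hlt : (k : ℝ≥0∞) / 2 < ν univ := by
        rw [hν, ENNReal.div_lt_iff (Or.inl two_ne_zero) (Or.inl ENNReal.ofNat_ne_top)]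
        exact_mod_cast (mul_comm 2 N ▸ hk.2)
      have hpos : (0 : ℝ≥0∞) < (k : ℝ≥0∞) / 2 :=
        ENNReal.div_pos (by exact_mod_cast hk.1.ne') ENNReal.ofNat_ne_top
      obtain ⟨a, ha⟩ := exists_measure_Iic_eq ν hpos hlt
      exact ⟨a, fun _ _ => ha⟩
    · exact ⟨0, fun h1 h2 => absurd ⟨h1, h2⟩ hk⟩
  choose a ha using hq
  set S : ℕ → Set ℝ := fun k => if k = 0 then ∅ else if k < 2 * N then Iic (a k) else univ with hS
  have hSm : ∀ k, MeasurableSet (S k) := fun k => by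
    simp only [hS]
    split_ifs <;> measurability
  have hSlow : ∀ k x y, x ∈ S k → y ≤ x → y ∈ S k := by
    intro k x y hx hy
    simp only [hS] at hx ⊢
    split_ifs at hx ⊢
    · exact hx
    · exact hy.trans hx
    · trivial
  have hSν : ∀ k ≤ 2 * N, ν (S k) = k / 2 := by
    intro k hk
    simp only [hS]
    split_ifs with h1 h2
    · simp [h1]
    · exact ha k (Nat.pos_of_ne_zero h1) h2
    · obtain rfl : k = 2 * N := by omega
      rw [hν, Nat.cast_mul, mul_comm, Nat.cast_ofNat, ENNReal.mul_div_cancel_right two_ne_zero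
        ENNReal.ofNat_ne_top]
  have hSsucc : ∀ k, k < 2 * N → S k ⊆ S (k + 1) := by
    intro k hk x hx
    by_contra hx'
    have hsub : S (k + 1) ⊆ S k := fun y hy => by
      rcases le_total y x with h | h
      · exact hSlow k x y hx h
      · exact absurd (hSlow (k + 1) y x hy h) hx'
    have h1 := measure_mono (μ := ν) hsub
    rw [hSν k hk.le, hSν (k + 1) hk, hdivadd] at h1
    have h2 : (k : ℝ≥0∞) / 2 < k / 2 + 1 / 2 := ENNReal.lt_add_right (hfin k) (by simp)
    exact absurd h1 (not_le.2 h2)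
  have hSmono : ∀ k l, k ≤ l → l ≤ 2 * N → S k ⊆ S l := by
    intro k l hkl hl
    induction l, hkl using Nat.le_induction with
    | base => exact Subset.rfl
    | succ l hkl ih => exact (ih (by omega)).trans (hSsucc l (by omega))
  have hex : ∀ x, ∃ k, x ∈ S (k + 1) := fun x => ⟨2 * N - 1, by
    have h1 : 2 * N - 1 + 1 = 2 * N := by omega
    simp [hS, h1, hN]⟩
  classical
  have hlt : ∀ x, Nat.find (hex x) < 2 * N := fun x => by
    have h1 : Nat.find (hex x) ≤ 2 * N - 1 := Nat.find_min' _ (by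
      have h1 : 2 * N - 1 + 1 = 2 * N := by omega
      simp [hS, h1, hN])
    omega
  have hpre : ∀ j : Fin (2 * N), (fun x => (⟨Nat.find (hex x), hlt x⟩ : Fin (2 * N))) ⁻¹' {j} =
      S (j + 1) \ S j := by
    intro j
    ext x
    simp only [mem_preimage, mem_singleton_iff, Fin.ext_iff, Nat.find_eq_iff, Set.mem_sdiff]
    refine and_congr_right fun _ => ⟨fun h hx => ?_, fun h k hk hx => ?_⟩
    · rcases Nat.eq_zero_or_pos (j : ℕ) with h0 | h0
      · rw [h0] at hx
        simp [hS] at hx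
      · refine h (j - 1) (by omega) ?_
        rwa [Nat.sub_add_cancel h0]
    · exact h (hSmono (k + 1) j hk j.2.le hx)
  refine ⟨fun x => ⟨Nat.find (hex x), hlt x⟩, ?_, ?_, fun j => ?_⟩
  · refine measurable_to_countable' fun j => ?_
    rw [hpre]
    exact (hSm _).diff (hSm _)
  · intro x y hxy
    exact Nat.find_min' _ (hSlow _ y x (Nat.find_spec (hex y)) hxy)
  · rw [hpre, measure_sdiff (hSsucc j j.2) (hSm _).nullMeasurableSet (measure_ne_top _ _),
      hSν _ j.2, hSν _ j.2.le, hdivadd, ENNReal.add_sub_cancel_left (hfin j)]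

end Quantile

section Grid

open Set Filter Topology Metric

variable {d : ℕ}

/-- The label of the cube of the grid of side `h` that contains a point. -/
noncomputable def gridCube (h : ℝ) (x : EuclideanSpace ℝ (Fin d)) : Fin d → ℤ :=
  fun i => ⌊x i / h⌋

theorem measurable_gridCube (h : ℝ) :
    Measurable (gridCube h : EuclideanSpace ℝ (Fin d) → Fin d → ℤ) :=
  measurable_pi_lambda _ fun i => Int.measurable_floor.comp (by fun_prop)

theorem dist_le_of_gridCube_eq {h : ℝ} (hh : 0 < h) {x y : EuclideanSpace ℝ (Fin d)}
    (hxy : gridCube h x = gridCube h y) : dist x y ≤ d * h := by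
  rw [dist_eq_norm]
  exact norm_le_mul_of_coord_le hh.le fun i => (abs_sub_lt_of_floor_div_eq hh (congrFun hxy i)).le

/-- Finitely many cubes of a sufficiently fine grid, and the remaining cell far away, are such that
the cells that come too close to a given one, in terms of the local radius, have little mass in
total. -/
theorem exists_grid_labels [NeZero d] {μ : Measure (EuclideanSpace ℝ (Fin d))}
    [IsFiniteMeasure μ] [NullSingletonClass μ] {c : ℝ≥0∞} (hc0 : 0 < c) (hc : c < μ univ)
    {η : ℝ} (hη0 : 0 < η) (hη : η ≤ 1 / 4) :
    ∃ (h : ℝ) (F : Finset (Fin d → ℤ)), ∀ j : Option F,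
      μ (truncLabel (gridCube h) F ⁻¹' {k | j = k ∨ ∃ x y, truncLabel (gridCube h) F x = j ∧
        truncLabel (gridCube h) F y = k ∧
          ‖x - y‖ < η * max (localRadius μ c x) (localRadius μ c y)}) ≤ 2 * c := by
  have hd0 : (1 : ℝ) ≤ d := by exact_mod_cast (NeZero.one_le : 1 ≤ d)
  set R := localRadius μ c with hR
  have hRpos : ∀ x, 0 < R x := localRadius_pos hc0 hc
  have hRlip : ∀ x y, R x ≤ R y + dist x y := localRadius_le_add_dist hc
  -- Outside the ball of radius `L₀` there is little mass.
  obtain ⟨L₀, hL₀⟩ : ∃ L₀ : ℕ, μ (closedBall 0 (L₀ : ℝ))ᶜ ≤ c := by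
    have h1 : Tendsto (fun n : ℕ => μ (closedBall (0 : EuclideanSpace ℝ (Fin d)) (n : ℝ))ᶜ) atTop
        (𝓝 (μ (⋂ n : ℕ, (closedBall (0 : EuclideanSpace ℝ (Fin d)) (n : ℝ))ᶜ))) :=
      tendsto_measure_iInter_atTop
        (fun n => measurableSet_closedBall.compl.nullMeasurableSet)
        (fun m n h => compl_subset_compl.2
          (closedBall_subset_closedBall (by exact_mod_cast h))) ⟨0, measure_ne_top _ _⟩
    rw [← compl_iUnion, iUnion_closedBall_nat, compl_univ, measure_empty] at h1
    obtain ⟨n, hn⟩ := (h1.eventually (gt_mem_nhds hc0)).exists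
    exact ⟨n, hn.le⟩
  set L : ℝ := 2 * (R 0 + L₀ + 1) with hL
  have hR0 := hRpos 0
  have hL0 : 0 < L := by positivity
  -- The radius is bounded below on the bounded cells.
  set L₁ : ℝ := d * (L + 2) with hL₁
  obtain ⟨x₁, -, hx₁⟩ := (isCompact_closedBall (0 : EuclideanSpace ℝ (Fin d)) L₁).exists_isMinOn
    ⟨0, mem_closedBall_self (by positivity)⟩ (continuous_localRadius hc (μ := μ)).continuousOn
  set h : ℝ := min 1 (R x₁ / 8) / d with hh
  have hRx₁ := hRpos x₁
  have hh0 : 0 < h := by positivity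
  have hdh : d * h = min 1 (R x₁ / 8) := by rw [hh]; field_simp
  have hdh1 : d * h ≤ 1 := hdh.le.trans (min_le_left _ _)
  have hh1 : h ≤ 1 := (le_mul_of_one_le_left hh0.le hd0).trans hdh1
  set M : ℤ := ⌈L / h⌉ with hM
  have hM1 : L ≤ M * h := (div_le_iff₀ hh0).1 (Int.le_ceil _)
  have hM2 : (M : ℝ) * h < L + h := by
    have := Int.ceil_lt_add_one (L / h)
    calc (M : ℝ) * h < (L / h + 1) * h := by gcongr
      _ = L + h := by field_simp
  set F : Finset (Fin d → ℤ) := Finset.Icc (fun _ => -M) (fun _ => M) with hF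
  set g := truncLabel (gridCube h (d := d)) F with hg
  have hnear : ∀ x y (l : F), g x = some l → g y = some l → dist x y ≤ d * h := by
    intro x y l hx hy
    exact dist_le_of_gridCube_eq hh0 ((truncLabel_eq_some.1 hx).trans (truncLabel_eq_some.1 hy).symm)
  have hin : ∀ x (l : F), g x = some l → d * h ≤ R x / 8 := by
    intro x l hx
    have h1 : gridCube h x ∈ F := (truncLabel_eq_some.1 hx) ▸ l.2
    rw [hF, Finset.mem_Icc] at h1
    have h2 : ‖x‖ ≤ L₁ := by
      refine norm_le_mul_of_coord_le (by positivity) fun i => ?_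
      have h3 : -M ≤ ⌊x i / h⌋ := h1.1 i
      have h4 : ⌊x i / h⌋ ≤ M := h1.2 i
      have h5 : (-M : ℝ) ≤ x i / h := by
        have := Int.floor_le (x i / h)
        have h6 : ((-M : ℤ) : ℝ) ≤ ⌊x i / h⌋ := by exact_mod_cast h3
        push_cast at h6
        linarith
      have h6 : x i / h ≤ M + 1 := by
        have := Int.lt_floor_add_one (x i / h)
        have h6 : ((⌊x i / h⌋ : ℤ) : ℝ) ≤ M := by exact_mod_cast h4
        linarith
      rw [le_div_iff₀ hh0] at h5
      rw [div_le_iff₀ hh0] at h6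
      rw [abs_le]
      constructor <;> nlinarith
    have h3 : R x₁ ≤ R x := hx₁ (mem_closedBall_zero_iff.2 h2)
    rw [hdh]
    exact (min_le_right _ _).trans (by linarith)
  have hout : ∀ x, g x = none → L ≤ ‖x‖ := by
    intro x hx
    have h1 : gridCube h x ∉ F := truncLabel_eq_none.1 hx
    by_contra! hlt
    refine h1 (Finset.mem_Icc.2 ⟨fun i => ?_, fun i => ?_⟩)
    all_goals
      have h2 : |x i| ≤ ‖x‖ := by
        have := PiLp.norm_apply_le x i
        rwa [Real.norm_eq_abs] at this
      have h3 := abs_le.1 (h2.trans hlt.le)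
    · refine Int.le_floor.2 ?_
      rw [le_div_iff₀ hh0]
      push_cast
      linarith [h3.1]
    · refine Int.floor_le_iff.2 ?_
      rw [div_lt_iff₀ hh0]
      linarith [h3.2]
  -- A cell in conflict with the far cell has no points in the ball of radius `L₀`.
  have hfar : ∀ x y, g y = none → ‖x - y‖ < η * max (R x) (R y) → ‖x‖ > L₀ + 1 := by
    intro x y hy hxy
    by_contra! hx
    have h1 := hout y hy
    have h2 : R y ≤ R 0 + ‖y‖ := by simpa using hRlip y 0
    have h3 : R x ≤ R 0 + ‖x‖ := by simpa using hRlip x 0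
    have h4 : max (R x) (R y) ≤ R 0 + ‖y‖ := max_le (by linarith) h2
    have h5 : ‖y‖ - ‖x‖ ≤ ‖x - y‖ := by rw [norm_sub_rev]; exact norm_sub_norm_le _ _
    have h6 : η * max (R x) (R y) ≤ 1 / 4 * (R 0 + ‖y‖) :=
      mul_le_mul hη h4 (le_max_of_le_left (hRpos x).le) (by norm_num)
    linarith
  have htail : μ (g ⁻¹' {none}) ≤ c := by
    refine le_trans (measure_mono fun x hx => ?_) hL₀
    have := hout x hx
    simp only [mem_compl_iff, mem_closedBall_zero_iff, not_le]
    linarith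
  refine ⟨h, F, fun j => ?_⟩
  rcases j with _ | l
  · refine le_trans (measure_mono fun z hz => ?_) (hL₀.trans (le_mul_of_one_le_left' one_le_two))
    simp only [mem_compl_iff, mem_closedBall_zero_iff, not_le]
    have hnone : g z = none → (L₀ : ℝ) < ‖z‖ := fun hz => by
      have := hout z hz
      linarith
    rcases hz with hz | ⟨x, y, hx, hy, hxy⟩
    · exact hnone hz.symm
    · rcases hgz : g z with _ | l
      · exact hnone hgz
      · rw [norm_sub_rev, max_comm] at hxy
        have h1 := hfar y x hx hxy
        have h2 := hnear y z l (hy.trans hgz) hgz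
        have h3 : ‖y‖ - ‖z‖ ≤ dist y z := by rw [dist_eq_norm]; exact norm_sub_norm_le _ _
        linarith
  · rcases eq_empty_or_nonempty (g ⁻¹' {some l}) with he | ⟨x₀, hx₀⟩
    · have h1 : g ⁻¹' {k | some l = k ∨ ∃ x y, g x = some l ∧ g y = k ∧
          ‖x - y‖ < η * max (R x) (R y)} = ∅ := by
        have hno : ∀ x, g x ≠ some l := fun x hx => by
          have : x ∈ g ⁻¹' {some l} := hx
          rw [he] at this
          exact this
        refine eq_empty_of_forall_notMem fun z hz => ?_
        rcases hz with hz | ⟨x, y, hx, _, _⟩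
        · exact hno z hz.symm
        · exact hno x hx
      rw [h1, measure_empty]
      exact zero_le
    · have hx₀' : g x₀ = some l := hx₀
      have hsub : g ⁻¹' {k | some l = k ∨ ∃ x y, g x = some l ∧ g y = k ∧
          ‖x - y‖ < η * max (R x) (R y)} ⊆ closedBall x₀ (7 / 8 * R x₀) ∪ g ⁻¹' {none} := by
        intro z hz
        rcases hgz : g z with _ | l'
        · exact Or.inr hgz
        left
        have hRx₀ := hRpos x₀
        have hs := hin x₀ l hx₀'
        rw [mem_closedBall]
        rcases hz with hz | ⟨x, y, hx, hy, hxy⟩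
        · have := hnear z x₀ l hz.symm hx₀'
          linarith
        · have h1 := hnear x x₀ l hx hx₀'
          have h2 := hnear z y l' hgz (hy.trans hgz)
          have h3 := hin z l' hgz
          have h4 := hRlip x x₀
          have h5 := hRlip y x
          rw [dist_comm] at h5
          rw [← dist_eq_norm] at hxy
          have h6 : dist x y < 1 / 4 * max (R x) (R y) :=
            hxy.trans_le (by gcongr; exact le_max_of_le_left (hRpos x).le)
          have h7 : max (R x) (R y) ≤ R x + dist x y :=
            max_le (by linarith [dist_nonneg (x := x) (y := y)]) h5
          have h8 : dist x y < 1 / 3 * R x := by linarith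
          have h9 : dist z x₀ ≤ dist z y + dist y x + dist x x₀ := dist_triangle4 _ _ _ _
          rw [dist_comm y x] at h9
          linarith
      calc _ ≤ μ (closedBall x₀ (7 / 8 * R x₀)) + μ (g ⁻¹' {none}) :=
            (measure_mono hsub).trans (measure_union_le _ _)
        _ ≤ c + c := by
            refine add_le_add (measure_closedBall_le_of_lt_localRadius ?_) htail
            have := hRpos x₀
            linarith
        _ = 2 * c := (two_mul c).symm

end Grid

/-! ### The free energy of states supported on separated configurations -/

section Separated

open Set Metric Real

variable {d : ℕ} {w : EuclideanSpace ℝ (Fin d) → EReal} {ρ : EuclideanSpace ℝ (Fin d) → ℝ}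
  {μ : Measure (EuclideanSpace ℝ (Fin d))} [IsFiniteMeasure μ]
  {e : EuclideanSpace ℝ (Fin d) → ℝ≥0∞} {T : ℝ}

theorem pairEnergy_eq_zero_of_le_one {n : ℕ} (hn : n ≤ 1) (x : Fin n → EuclideanSpace ℝ (Fin d)) :
    pairEnergy w x = 0 := by
  refine Finset.sum_eq_zero fun j _ => Finset.sum_eq_zero fun k hk => ?_
  have := Finset.mem_Ioi.1 hk
  omega

open Classical in
theorem measure_preimage_eq_sum_labels {E J : Type*} [MeasurableSpace E] [MeasurableSpace J]
    [Fintype J] [DiscreteMeasurableSpace J] {ν : Measure E} {g : E → J} (hg : Measurable g)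
    (S : Set J) : ν (g ⁻¹' S) = ∑ k, if k ∈ S then ν (g ⁻¹' {k}) else 0 := by
  rw [measure_eq_sum_labels hg (hg (DiscreteMeasurableSpace.forall_measurableSet S))]
  refine Finset.sum_congr rfl fun k _ => ?_
  rw [← preimage_inter]
  split_ifs with hk
  · rw [inter_eq_right.2 (singleton_subset_iff.2 hk)]
  · rw [inter_singleton_eq_empty.2 hk, preimage_empty, measure_empty]

/-- If the mass is at most one, then a state with at most one particle has the required density. -/
theorem grandCanonicalFreeEnergy_le_of_mass_le_one (hT : 0 ≤ T) (hρm : Measurable ρ)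
    (hρ : ∀ x, 0 ≤ ρ x) (hρi : Integrable ρ)
    (hlog : 0 < T → Integrable fun x => ρ x * |log (ρ x)|)
    (hμ : μ = volume.withDensity fun x => ENNReal.ofReal (ρ x)) (hmass : μ univ ≤ 1) :
    grandCanonicalFreeEnergy w T ρ ≤ ((0 : ℝ≥0∞) : EReal) +
      ((T * (log 1 * (∫ x, ρ x) + ∫ x, ρ x * log (ρ x)) : ℝ) : EReal) := by
  have hm : ∀ j : Unit,
      Fintype.card Unit * μ ((fun _ : EuclideanSpace ℝ (Fin d) => ()) ⁻¹' {j}) ≤ 1 := by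
    simpa using hmass
  have key := grandCanonicalFreeEnergy_le_of_weights (w := w) (e := fun _ => 0) (K := 1) hT hρm hρ
    hρi hlog hμ (g := fun _ => ()) measurable_const
    (W := fun n f => occupationWeight
      (fun j => μ ((fun _ : EuclideanSpace ℝ (Fin d) => ()) ⁻¹' {j})) (id : Unit → Unit) f)
    (fun n σ f => occupationWeight_comp_perm σ f) (tsum_occupationWeight hm)
    (tsum_labelMean_occupationWeight hm) one_pos
    (fun n f => by simpa using factorial_mul_occupationWeight_le (Γ := Unit) f) measurable_const
    (fun n x hx => by
      have h1 := Fintype.card_le_of_injective _ (of_occupationWeight_ne_zero hx).1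
      rw [pairEnergy_eq_zero_of_le_one (by simpa using h1)]
      simp)
  simpa using key

/-- The grand-canonical state picks one colour of dyadic cubes uniformly at random and occupies
the cubes of that colour independently. -/
theorem grandCanonicalFreeEnergy_le_of_separated [NeZero d] [NullSingletonClass μ] (hT : 0 ≤ T)
    (hρm : Measurable ρ) (hρ : ∀ x, 0 ≤ ρ x) (hρi : Integrable ρ)
    (hlog : 0 < T → Integrable fun x => ρ x * |log (ρ x)|)
    (hμ : μ = volume.withDensity fun x => ENNReal.ofReal (ρ x)) {c : ℝ≥0∞} (hc0 : 0 < c)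
    (hc : c < μ univ) (hcK : ((2 ^ (d + 1) + 1 : ℕ) : ℝ≥0∞) * c ≤ 1) (he : Measurable e)
    (hE : ∀ n (x : Fin n → EuclideanSpace ℝ (Fin d)),
      (∀ i k, i ≠ k → 1 / (4 * d) * max (localRadius μ c (x i)) (localRadius μ c (x k)) ≤
        ‖x i - x k‖) → (pairEnergy w x).toENNReal ≤ ∑ i, e (x i)) :
    grandCanonicalFreeEnergy w T ρ ≤ ((∫⁻ x, e x ∂μ : ℝ≥0∞) : EReal) +
      ((T * (log ((2 ^ (d + 1) + 1 : ℕ) : ℝ) * (∫ x, ρ x) + ∫ x, ρ x * log (ρ x)) : ℝ) :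
        EReal) := by
  have hr : Measurable (radiusCube (localRadius μ c)) :=
    measurable_radiusCube (continuous_localRadius hc).measurable
  obtain ⟨F, hF⟩ := exists_measure_truncLabel_none_le (μ := μ) hr hc0
  let _ : MeasurableSpace (Option F) := ⊤
  have : DiscreteMeasurableSpace (Option F) := ⟨fun _ => trivial⟩
  have hcard : Fintype.card (Option (ZMod 2 × (Fin d → ZMod 2))) = 2 ^ (d + 1) + 1 := by
    simp only [Fintype.card_option, Fintype.card_prod, ZMod.card, Fintype.card_pi,
      Finset.prod_const, Finset.card_univ, Fintype.card_fin]
    ring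
  have hm : ∀ j, (Fintype.card (Option (ZMod 2 × (Fin d → ZMod 2))) : ℝ≥0∞) *
      μ (truncLabel (radiusCube (localRadius μ c)) F ⁻¹' {j}) ≤ 1 := fun j => by
    rw [hcard]
    exact (mul_le_mul_right (measure_truncLabel_radiusCube_le hc0 hc hF j) _).trans hcK
  refine grandCanonicalFreeEnergy_le_of_weights hT hρm hρ hρi hlog hμ
    (g := truncLabel (radiusCube (localRadius μ c)) F) (measurable_truncLabel hr)
    (W := fun n f => occupationWeight
      (fun j => μ (truncLabel (radiusCube (localRadius μ c)) F ⁻¹' {j})) truncColor f)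
    (fun n σ f => occupationWeight_comp_perm σ f) (tsum_occupationWeight hm)
    (tsum_labelMean_occupationWeight hm) (by positivity) (fun n f => ?_) he
    (fun n x hx => hE n x fun i k hik => ?_)
  · rw [ENNReal.ofReal_natCast, ← hcard]
    exact factorial_mul_occupationWeight_le f
  · obtain ⟨hinj, a, ha, -⟩ := of_occupationWeight_ne_zero hx
    exact separated_of_truncColor_eq hc0 hc (hinj.ne hik) ((ha i).trans (ha k).symm)

/-- There is a state without particles if the density vanishes. -/
theorem canonicalFreeEnergy_zero_le (hT : 0 ≤ T) (hρm : Measurable ρ)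
    (hρ : ∀ x, 0 ≤ ρ x) (hρi : Integrable ρ)
    (hlog : 0 < T → Integrable fun x => ρ x * |log (ρ x)|)
    (hμ : μ = volume.withDensity fun x => ENNReal.ofReal (ρ x)) (hmass : μ univ = 0) :
    canonicalFreeEnergy w T 0 ρ ≤ ((0 : ℝ≥0∞) : EReal) +
      ((T * (log 1 * (∫ x, ρ x) + ∫ x, ρ x * log (ρ x)) : ℝ) : EReal) := by
  have key := canonicalFreeEnergy_le_of_weights (w := w) (n := 0) (e := fun _ => 0) (K := 1) hT hρm
    hρ hρi hlog hμ (g := fun _ => ()) measurable_const (W := fun _ => 1)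
    (fun _ _ => rfl) (by simp) (fun j => by simp [labelMean, hmass]) one_pos
    (fun _ _ => by simp) measurable_const
    (fun x _ => by rw [pairEnergy_eq_zero_of_le_one zero_le_one]; simp)
  simpa using key

/-- At zero temperature, the canonical state lives on configurations without conflicts between
the cells of a fine grid. -/
theorem canonicalFreeEnergy_zero_temperature_le_of_separated [NeZero d] [NullSingletonClass μ]
    (hρm : Measurable ρ) (hρ : ∀ x, 0 ≤ ρ x) (hρi : Integrable ρ)
    (hμ : μ = volume.withDensity fun x => ENNReal.ofReal (ρ x)) {N : ℕ} (hN : N ≠ 0)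
    (hmass : μ univ = N) {c : ℝ} (hc0 : 0 < c) (hc : c < 1 / 4) {η : ℝ} (hη0 : 0 < η)
    (hη : η ≤ 1 / 4) (he : Measurable e)
    (hE : ∀ n (x : Fin n → EuclideanSpace ℝ (Fin d)),
      (∀ i k, i ≠ k → η * max (localRadius μ (ENNReal.ofReal c) (x i))
        (localRadius μ (ENNReal.ofReal c) (x k)) ≤ ‖x i - x k‖) →
      (pairEnergy w x).toENNReal ≤ ∑ i, e (x i)) :
    canonicalFreeEnergy w 0 N ρ ≤ ((∫⁻ x, e x ∂μ : ℝ≥0∞) : EReal) := by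
  classical
  have hc' : ENNReal.ofReal c < μ univ := by
    rw [hmass]
    refine lt_of_lt_of_le (b := 1) ?_ (by exact_mod_cast Nat.one_le_iff_ne_zero.2 hN)
    rw [← ENNReal.ofReal_one]
    exact (ENNReal.ofReal_lt_ofReal_iff one_pos).2 (by linarith)
  obtain ⟨h, F, hF⟩ := exists_grid_labels (μ := μ) (ENNReal.ofReal_pos.2 hc0) hc' hη0 hη
  let _ : MeasurableSpace (Option F) := ⊤
  have : DiscreteMeasurableSpace (Option F) := ⟨fun _ => trivial⟩
  set g := truncLabel (gridCube h : EuclideanSpace ℝ (Fin d) → Fin d → ℤ) F with hgdef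
  have hg : Measurable g := measurable_truncLabel (measurable_gridCube h)
  have hsum : ∑ j, μ (g ⁻¹' {j}) = N := by
    rw [← hmass, measure_eq_sum_labels hg MeasurableSet.univ]
    simp
  obtain ⟨W, hW, hW1, hWm, hWr⟩ := exists_conflictFree_weight (μ := μ) (g := g) hN hsum
    (fun j k => j = k ∨ ∃ x y, g x = j ∧ g y = k ∧ ‖x - y‖ < η *
      max (localRadius μ (ENNReal.ofReal c) x) (localRadius μ (ENNReal.ofReal c) y))
    (fun j => Or.inl rfl)
    (by
      rintro j k (rfl | ⟨x, y, hx, hy, hxy⟩)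
      · exact Or.inl rfl
      · exact Or.inr ⟨y, x, hy, hx, by rwa [norm_sub_rev, max_comm]⟩)
    (c := 2 * c) (by positivity) (by linarith)
    (fun j => by
      refine le_trans (le_of_eq ?_) ((hF j).trans_eq ?_)
      · rw [measure_preimage_eq_sum_labels hg]
        exact Finset.sum_congr rfl fun k _ => by congr
      · rw [ENNReal.ofReal_mul zero_le_two, ENNReal.ofReal_ofNat])
  have key := canonicalFreeEnergy_le_of_weights (w := w) (T := 0) (K := 1) le_rfl hρm hρ hρi
    (fun h => absurd h (lt_irrefl _)) hμ hg hW hW1 hWm one_pos (fun h => absurd h (lt_irrefl _)) he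
    (fun x hx => hE N x fun i k hik => by
      by_contra hlt
      exact hWr _ hx i k hik (Or.inr ⟨x i, x k, rfl, rfl, not_le.1 hlt⟩))
  simpa using key

/-- Two points in distinct cells of one parity have a full cell between them, so a ball around one
of them that reaches the other has mass at least `1 / 2`. -/
theorem localRadius_le_norm_sub_of_parity {μ : Measure (EuclideanSpace ℝ (Fin 1))}
    [IsFiniteMeasure μ] [NullSingletonClass μ] {c : ℝ≥0∞} (hc : c < 1 / 2) {M : ℕ}
    {g : ℝ → Fin M} (hg : Monotone g)
    (hm : ∀ j, μ ((fun x : EuclideanSpace ℝ (Fin 1) => g (x 0)) ⁻¹' {j}) = 1 / 2)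
    {x y : EuclideanSpace ℝ (Fin 1)} (hne : g (x 0) ≠ g (y 0))
    (hpar : (g (x 0) : ℕ) % 2 = (g (y 0) : ℕ) % 2) : localRadius μ c x ≤ ‖x - y‖ := by
  have hnorm : ∀ z : EuclideanSpace ℝ (Fin 1), ‖z‖ = |z 0| := fun z => by
    rw [EuclideanSpace.norm_eq, Fin.sum_univ_one, sqrt_sq (norm_nonneg _), norm_eq_abs]
  by_contra hlt
  have h1 := measure_closedBall_le_of_lt_localRadius (not_le.1 hlt)
  obtain ⟨j, hj⟩ : ∃ j : Fin M, (g (x 0) < j ∧ j < g (y 0)) ∨ (g (y 0) < j ∧ j < g (x 0)) := by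
    have hne' : (g (x 0) : ℕ) ≠ g (y 0) := fun h => hne (Fin.ext h)
    rcases lt_or_gt_of_ne hne' with h | h
    · exact ⟨⟨g (x 0) + 1, by have := (g (y 0)).2; omega⟩, Or.inl
        ⟨Fin.lt_def.2 (by simp), Fin.lt_def.2 (by simp; omega)⟩⟩
    · exact ⟨⟨g (y 0) + 1, by have := (g (x 0)).2; omega⟩, Or.inr
        ⟨Fin.lt_def.2 (by simp), Fin.lt_def.2 (by simp; omega)⟩⟩
  refine absurd ((hm j).symm.le.trans ((measure_mono fun z hz => ?_).trans h1)) (not_le.2 hc)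
  have hz' : g (z 0) = j := hz
  rw [mem_closedBall, dist_eq_norm, hnorm, hnorm]
  simp only [PiLp.sub_apply]
  rcases hj with ⟨ha, hb⟩ | ⟨ha, hb⟩
  · have h2 := hg.reflect_lt (hz'.symm ▸ ha)
    have h3 := hg.reflect_lt (hz'.symm ▸ hb)
    rw [abs_of_pos (by linarith), abs_of_neg (by linarith)]
    linarith
  · have h2 := hg.reflect_lt (hz'.symm ▸ ha)
    have h3 := hg.reflect_lt (hz'.symm ▸ hb)
    rw [abs_of_neg (by linarith), abs_of_pos (by linarith)]
    linarith

/-- In one dimension, the canonical state occupies every second cell of a partition of the line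
into `2 N` intervals of mass `1 / 2`, with the parity chosen at random. -/
theorem canonicalFreeEnergy_le_of_separated_line {w : EuclideanSpace ℝ (Fin 1) → EReal}
    {ρ : EuclideanSpace ℝ (Fin 1) → ℝ} {μ : Measure (EuclideanSpace ℝ (Fin 1))}
    [IsFiniteMeasure μ] [NullSingletonClass μ] {e : EuclideanSpace ℝ (Fin 1) → ℝ≥0∞}
    (hT : 0 ≤ T) (hρm : Measurable ρ) (hρ : ∀ x, 0 ≤ ρ x) (hρi : Integrable ρ)
    (hlog : 0 < T → Integrable fun x => ρ x * |log (ρ x)|)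
    (hμ : μ = volume.withDensity fun x => ENNReal.ofReal (ρ x)) {N : ℕ} (hN : N ≠ 0)
    (hmass : μ univ = N) {c : ℝ≥0∞} (hc : c < 1 / 2) (he : Measurable e)
    (hE : ∀ n (x : Fin n → EuclideanSpace ℝ (Fin 1)),
      (∀ i k, i ≠ k → max (localRadius μ c (x i)) (localRadius μ c (x k)) ≤ ‖x i - x k‖) →
      (pairEnergy w x).toENNReal ≤ ∑ i, e (x i)) :
    canonicalFreeEnergy w T N ρ ≤ ((∫⁻ x, e x ∂μ : ℝ≥0∞) : EReal) +
      ((T * (log 2 * (∫ x, ρ x) + ∫ x, ρ x * log (ρ x)) : ℝ) : EReal) := by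
  have hcoord : Measurable fun x : EuclideanSpace ℝ (Fin 1) => x 0 := by fun_prop
  have : NullSingletonClass (μ.map fun x => x 0) := ⟨fun a => by
    rw [Measure.map_apply hcoord (measurableSet_singleton a)]
    refine Set.Subsingleton.measure_zero (fun x hx y hy => ?_) μ
    ext i
    rw [Subsingleton.elim i 0]
    exact (mem_singleton_iff.1 hx).trans (mem_singleton_iff.1 hy).symm⟩
  obtain ⟨g, hgm, hg, hgj⟩ := exists_interval_labels (μ.map fun x => x 0) hN (by
    rw [Measure.map_apply hcoord MeasurableSet.univ, preimage_univ, hmass])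
  have hG : Measurable fun x : EuclideanSpace ℝ (Fin 1) => g (x 0) := hgm.comp hcoord
  have hmj : ∀ j, μ ((fun x : EuclideanSpace ℝ (Fin 1) => g (x 0)) ⁻¹' {j}) = 1 / 2 := fun j => by
    rw [← hgj j, Measure.map_apply hcoord (hgm (measurableSet_singleton j))]
    rfl
  let col : Fin (2 * N) → Fin 2 := fun j => ⟨j % 2, Nat.mod_lt _ two_pos⟩
  have hfull : ∀ j, (Fintype.card (Fin 2) : ℝ≥0∞) *
      μ ((fun x : EuclideanSpace ℝ (Fin 1) => g (x 0)) ⁻¹' {j}) = 1 := fun j => by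
    rw [hmj, Fintype.card_fin, Nat.cast_ofNat, one_div,
      ENNReal.mul_inv_cancel two_ne_zero ENNReal.ofNat_ne_top]
  have hcolcard : ∀ a : Fin 2, (Finset.univ.filter fun j => col j = a).card = N := by
    intro a
    have ha := a.2
    have : (Finset.univ.filter fun j => col j = a) = Finset.univ.image
        fun k : Fin N => (⟨2 * k + a, by omega⟩ : Fin (2 * N)) := by
      ext j
      simp only [col, Finset.mem_filter, Finset.mem_univ, true_and, Finset.mem_image, Fin.ext_iff]
      constructor
      · intro h
        exact ⟨⟨j / 2, by omega⟩, by simp only; omega⟩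
      · rintro ⟨k, hk⟩
        omega
    rw [this, Finset.card_image_of_injective, Finset.card_univ, Fintype.card_fin]
    intro k l hkl
    simp only [Fin.mk.injEq] at hkl
    exact Fin.ext (by omega)
  -- Every cell of the chosen colour is occupied with probability one, so there are `N` particles.
  have hzero : ∀ n, n ≠ N → ∀ f : Fin n → Fin (2 * N), occupationWeight
      (fun j => μ ((fun x : EuclideanSpace ℝ (Fin 1) => g (x 0)) ⁻¹' {j})) col f = 0 := by
    intro n hn f
    by_contra hf
    obtain ⟨hinj, a, ha, hocc⟩ := of_occupationWeight_ne_zero hf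
    refine hn ?_
    rw [← hcolcard a, ← Fintype.card_fin n, ← Finset.card_univ,
      ← Finset.card_image_of_injective _ hinj]
    congr 1
    ext j
    simp only [Finset.mem_image, Finset.mem_univ, true_and, Finset.mem_filter]
    exact ⟨fun ⟨i, hi⟩ => hi ▸ ha i, fun hj => hocc j hj (hfull j)⟩
  have h1 := tsum_occupationWeight (col := col) fun j => (hfull j).le
  rw [tsum_eq_single N fun n hn => Finset.sum_eq_zero fun f _ => by
    rw [hzero n hn f, zero_mul]] at h1
  have h2 := tsum_labelMean_occupationWeight (col := col) fun j => (hfull j).le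
  refine canonicalFreeEnergy_le_of_weights hT hρm hρ hρi hlog hμ hG
    (W := fun f => occupationWeight
      (fun j => μ ((fun x : EuclideanSpace ℝ (Fin 1) => g (x 0)) ⁻¹' {j})) col f)
    (fun σ f => occupationWeight_comp_perm σ f) h1 (fun j => ?_) two_pos (fun _ f => ?_) he
    (fun x hx => hE N x fun i k hik => ?_)
  · refine Eq.trans (Eq.symm (tsum_eq_single N fun n hn => ?_)) (h2 j)
    exact Finset.sum_eq_zero fun f _ => Finset.sum_eq_zero fun i _ => by
      simp only [hzero n hn f, zero_mul, ite_self]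
  · rw [ENNReal.ofReal_ofNat]
    simpa using factorial_mul_occupationWeight_le (col := col) f
  · obtain ⟨hinj, a, ha, -⟩ := of_occupationWeight_ne_zero hx
    have hpar := congrArg Fin.val ((ha i).trans (ha k).symm)
    refine max_le (localRadius_le_norm_sub_of_parity hc hg hmj (hinj.ne hik) hpar) ?_
    rw [norm_sub_rev]
    exact localRadius_le_norm_sub_of_parity hc hg hmj (hinj.ne hik).symm hpar.symm

end Separated

/-! ### The local upper bound -/

section LocalUpperBound

open Set Metric Real

variable {d : ℕ} {w : EuclideanSpace ℝ (Fin d) → EReal} {ρ ρ' : EuclideanSpace ℝ (Fin d) → ℝ}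

theorem withDensity_ofReal_congr (h : ρ =ᵐ[volume] ρ') :
    volume.withDensity (fun x => ENNReal.ofReal (ρ x)) =
      volume.withDensity fun x => ENNReal.ofReal (ρ' x) :=
  withDensity_congr_ae (h.mono fun x hx => by simp only [hx])

theorem canonicalFreeEnergy_congr (h : ρ =ᵐ[volume] ρ') (T : ℝ) (N : ℕ) :
    canonicalFreeEnergy w T N ρ = canonicalFreeEnergy w T N ρ' := by
  refine iInf_congr fun P => iInf_congr_Prop ⟨fun hP => ?_, fun hP => ?_⟩ fun _ => rfl
  · exact ⟨hP.mass, hP.symmetric, hP.density.trans (withDensity_ofReal_congr h)⟩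
  · exact ⟨hP.mass, hP.symmetric, hP.density.trans (withDensity_ofReal_congr h).symm⟩

theorem grandCanonicalFreeEnergy_congr (h : ρ =ᵐ[volume] ρ') (T : ℝ) :
    grandCanonicalFreeEnergy w T ρ = grandCanonicalFreeEnergy w T ρ' := by
  refine iInf_congr fun P => iInf_congr_Prop ⟨fun hP => ?_, fun hP => ?_⟩ fun _ => rfl
  · exact ⟨hP.mass, hP.symmetric, hP.density.trans (withDensity_ofReal_congr h)⟩
  · exact ⟨hP.mass, hP.symmetric, hP.density.trans (withDensity_ofReal_congr h).symm⟩

theorem localUpperBound_congr (h : ρ =ᵐ[volume] ρ') (C κ r₀ α T : ℝ) :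
    localUpperBound C κ r₀ α T ρ = localUpperBound C κ r₀ α T ρ' := by
  have h1 : ∫⁻ x, ENNReal.ofReal (ρ x ^ 2) = ∫⁻ x, ENNReal.ofReal (ρ' x ^ 2) :=
    lintegral_congr_ae (h.mono fun x hx => by simp only [hx])
  have h2 : ∫⁻ x, ENNReal.ofReal (ρ x ^ (1 + α / d)) = ∫⁻ x, ENNReal.ofReal (ρ' x ^ (1 + α / d)) :=
    lintegral_congr_ae (h.mono fun x hx => by simp only [hx])
  have h3 : ∫⁻ x, ENNReal.ofReal (ρ x ^ 2 * max (Real.log (r₀ ^ d * ρ x)) 0) =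
      ∫⁻ x, ENNReal.ofReal (ρ' x ^ 2 * max (Real.log (r₀ ^ d * ρ' x)) 0) :=
    lintegral_congr_ae (h.mono fun x hx => by simp only [hx])
  have h4 : ∫ x, ρ x * log (ρ x) = ∫ x, ρ' x * log (ρ' x) :=
    integral_congr_ae (h.mono fun x hx => by simp only [hx])
  rw [localUpperBound, localUpperBound, coreTerm, coreTerm, h1, h2, h3, h4, integral_congr_ae h]

theorem le_localUpperBound {X : EReal} {A : ℝ≥0∞} {B L κ r₀ α T : ℝ}
    (hκ : 0 ≤ κ) (hT : 0 ≤ T) (hρ : 0 ≤ ∫ x, ρ x)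
    (hX : X ≤ (A : EReal) + ((T * (L * (∫ x, ρ x) + ∫ x, ρ x * log (ρ x)) : ℝ) : EReal))
    (hA : A ≤ ENNReal.ofReal (B * κ) * (∫⁻ x, ENNReal.ofReal (ρ x ^ 2)) +
      ENNReal.ofReal B * coreTerm κ r₀ α ρ) {C : ℝ} (hBC : B ≤ C) (hLC : L ≤ C) :
    X ≤ localUpperBound C κ r₀ α T ρ := by
  have hA' : A ≤ ENNReal.ofReal (C * κ) * (∫⁻ x, ENNReal.ofReal (ρ x ^ 2)) +
      ENNReal.ofReal C * coreTerm κ r₀ α ρ := hA.trans (by gcongr)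
  have hA2 := EReal.coe_ennreal_le_coe_ennreal_iff.2 hA'
  rw [EReal.coe_ennreal_add] at hA2
  have hT' : T * (L * (∫ x, ρ x) + ∫ x, ρ x * log (ρ x)) ≤
      C * T * (∫ x, ρ x) + T * ∫ x, ρ x * log (ρ x) := by
    have := mul_le_mul_of_nonneg_right hLC (mul_nonneg hT hρ)
    linarith
  refine hX.trans ((add_le_add hA2 (EReal.coe_le_coe_iff.2 hT')).trans (le_of_eq ?_))
  rw [localUpperBound, EReal.coe_add]
  ac_rfl

end LocalUpperBound

theorem theorem2p6 (d : ℕ) (hd : 1 ≤ d) (α s : ℝ) (hα : (d : ℝ) ≤ α) (hs : (d : ℝ) < s) :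
    ∃ C : ℝ, 0 < C ∧
      ∀ (w : EuclideanSpace ℝ (Fin d) → EReal) (κ r₀ : ℝ), IsShortRangePotential w κ r₀ α s →
      ∀ (T : ℝ), 0 ≤ T →
      ∀ (ρ : EuclideanSpace ℝ (Fin d) → ℝ), 0 ≤ᵐ[volume] ρ → Integrable ρ volume →
        (0 < T → Integrable (fun x => ρ x * |Real.log (ρ x)|) volume) →
        grandCanonicalFreeEnergy w T ρ ≤ localUpperBound C κ r₀ α T ρ ∧
        ∀ N : ℕ, ∫ x, ρ x = (N : ℝ) → (d = 1 ∨ T = 0) →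
          canonicalFreeEnergy w T N ρ ≤ localUpperBound C κ r₀ α T ρ := by
  have : NeZero d := ⟨by omega⟩
  -- The number `K` of colours in the grand-canonical construction fixes the mass `1 / K` of the
  -- balls of local radius; that it is less than `1 / 4` is enough for the canonical ones.
  have hd1 : (1 : ℝ) ≤ d := by exact_mod_cast hd
  have hα0 : 0 ≤ α := by linarith
  have hη : (0 : ℝ) < 1 / (4 * d) := by positivity
  have hη4 : (1 : ℝ) / (4 * d) ≤ 1 / 4 := one_div_le_one_div_of_le (by norm_num) (by linarith)
  have hK : (8 : ℝ) ≤ ((2 ^ (d + 1) + 1 : ℕ) : ℝ) + 3 := by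
    have : 2 ^ 2 ≤ 2 ^ (d + 1) := Nat.pow_le_pow_right two_pos (by omega)
    exact_mod_cast (by omega : 8 ≤ 2 ^ (d + 1) + 1 + 3)
  set K : ℝ := ((2 ^ (d + 1) + 1 : ℕ) : ℝ) with hKdef
  have hc : 0 < 1 / K := one_div_pos.2 (by linarith)
  have hc5 : 1 / K ≤ 1 / 5 := one_div_le_one_div_of_le (by norm_num) (by linarith)
  obtain ⟨A, hA, hpair⟩ := exists_pairEnergy_le hd hα hs
  obtain ⟨B, hB, hone⟩ := exists_lintegral_radius_le (d := d) hd hα hη hc hA.le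
  have hlogK : 0 ≤ Real.log K := Real.log_nonneg (by linarith)
  have hlog2 : Real.log 2 ≤ Real.log K := Real.log_le_log two_pos (by linarith)
  refine ⟨B + Real.log K, by positivity, fun w κ r₀ hw T hT ρ₀ hρ₀ hρ₀i hlog₀ => ?_⟩
  -- Replace the density by a measurable and everywhere nonnegative version.
  obtain ⟨ρ, hρm, hρ, hρρ⟩ : ∃ ρ : EuclideanSpace ℝ (Fin d) → ℝ, Measurable ρ ∧ (∀ x, 0 ≤ ρ x) ∧
      ρ₀ =ᵐ[volume] ρ := by
    refine ⟨fun x => max (hρ₀i.1.aemeasurable.mk ρ₀ x) 0,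
      hρ₀i.1.aemeasurable.measurable_mk.max measurable_const, fun x => le_max_right _ _, ?_⟩
    filter_upwards [hρ₀, hρ₀i.1.aemeasurable.ae_eq_mk] with x h0 h1
    rw [← h1]
    exact (max_eq_left h0).symm
  have hρi : Integrable ρ := hρ₀i.congr hρρ
  have hlog : 0 < T → Integrable fun x => ρ x * |Real.log (ρ x)| := fun h =>
    (hlog₀ h).congr (hρρ.mono fun x hx => by simp only [hx])
  rw [grandCanonicalFreeEnergy_congr hρρ, localUpperBound_congr hρρ, integral_congr_ae hρρ]
  simp_rw [canonicalFreeEnergy_congr hρρ]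
  clear hlog₀ hρ₀ hρ₀i hρρ ρ₀
  have hint : 0 ≤ ∫ x, ρ x := integral_nonneg hρ
  obtain ⟨μ, hμ⟩ : ∃ μ, μ = volume.withDensity fun x => ENNReal.ofReal (ρ x) := ⟨_, rfl⟩
  have : IsFiniteMeasure μ := hμ ▸ isFiniteMeasure_withDensity_ofReal hρi.2
  have : NullSingletonClass μ := by rw [hμ]; infer_instance
  have hμuniv : μ Set.univ = ENNReal.ofReal (∫ x, ρ x) := by
    rw [hμ, withDensity_apply _ MeasurableSet.univ, Measure.restrict_univ,
      ofReal_integral_eq_lintegral_ofReal hρi (ae_of_all _ hρ)]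
  set R := localRadius μ (ENNReal.ofReal (1 / K)) with hR
  set e : EuclideanSpace ℝ (Fin d) → ℝ≥0∞ := fun x => ENNReal.ofReal
    (κ * (A * (2 / (1 / (4 * d) * R x)) ^ d + coreSum d α ((3 * r₀ / (1 / (4 * d) * R x)) ^ d)))
    with hedef
  -- The bounds for a mass above the threshold, where the local radius is positive.
  have hbig : ENNReal.ofReal (1 / K) < μ Set.univ → Measurable e ∧
      (∀ n (x : Fin n → EuclideanSpace ℝ (Fin d)),
        (∀ i k, i ≠ k → 1 / (4 * d) * max (R (x i)) (R (x k)) ≤ ‖x i - x k‖) →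
        (pairEnergy w x).toENNReal ≤ ∑ i, e (x i)) ∧
      ∫⁻ x, e x ∂μ ≤ ENNReal.ofReal (B * κ) * (∫⁻ x, ENNReal.ofReal (ρ x ^ 2)) +
        ENNReal.ofReal B * coreTerm κ r₀ α ρ := by
    intro hlt
    have hRm : Measurable R := (continuous_localRadius hlt).measurable
    have hRpos : ∀ x, 0 < R x := localRadius_pos (ENNReal.ofReal_pos.2 hc) hlt
    refine ⟨?_, fun n x hx => ?_, ?_⟩
    · have := (continuous_coreSum d hα0).measurable
      fun_prop
    · exact hpair w κ r₀ hw _ hη n x (fun i => R (x i)) (fun i => hRpos _) hx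
    · have := hone κ r₀ hw.kappa_pos hw.r₀_nonneg ρ hρm hρ hρi R hRm hRpos fun x => by
        rw [← hμ]
        exact le_measure_closedBall_localRadius hlt x
      rwa [← hμ] at this
  constructor
  · rcases le_or_gt (μ Set.univ) (ENNReal.ofReal (1 / K)) with hle | hlt
    · refine le_localUpperBound (B := B) hw.kappa_pos.le hT hint
        (grandCanonicalFreeEnergy_le_of_mass_le_one hT hρm hρ hρi hlog hμ (hle.trans ?_)) zero_le
        (by linarith) (by rw [Real.log_one]; linarith)
      exact ENNReal.ofReal_le_one.2 (by linarith)
    · obtain ⟨hem, hE, hint'⟩ := hbig hlt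
      refine le_localUpperBound (B := B) hw.kappa_pos.le hT hint
        (grandCanonicalFreeEnergy_le_of_separated hT hρm hρ hρi hlog hμ (ENNReal.ofReal_pos.2 hc)
          hlt ?_ hem hE) hint' (by linarith) (by linarith)
      rw [← ENNReal.ofReal_natCast, ← hKdef, ← ENNReal.ofReal_mul (by linarith),
        mul_one_div_cancel (by linarith), ENNReal.ofReal_one]
  · intro N hN hcase
    rw [hN, ENNReal.ofReal_natCast] at hμuniv
    rcases eq_or_ne N 0 with rfl | hN0
    · exact le_localUpperBound (B := B) hw.kappa_pos.le hT hint
        (canonicalFreeEnergy_zero_le hT hρm hρ hρi hlog hμ (by simpa using hμuniv)) zero_le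
        (by linarith) (by rw [Real.log_one]; linarith)
    have hlt : ENNReal.ofReal (1 / K) < μ Set.univ := by
      rw [hμuniv]
      refine lt_of_lt_of_le (ENNReal.ofReal_lt_one.2 (by linarith)) ?_
      exact_mod_cast Nat.one_le_iff_ne_zero.2 hN0
    obtain ⟨hem, hE, hint'⟩ := hbig hlt
    rcases hcase with rfl | rfl
    · refine le_localUpperBound (B := B) hw.kappa_pos.le hT hint
        (canonicalFreeEnergy_le_of_separated_line hT hρm hρ hρi hlog hμ hN0 hμuniv
          (c := ENNReal.ofReal (1 / K)) ?_ hem fun n x hx => hE n x fun i k hik => ?_) hint'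
        (by linarith) (by linarith)
      · rw [one_div (2 : ℝ≥0∞), ← ENNReal.ofReal_ofNat 2, ← ENNReal.ofReal_inv_of_pos two_pos]
        exact (ENNReal.ofReal_lt_ofReal_iff (by norm_num)).2 (by linarith)
      · refine le_trans (mul_le_of_le_one_left (le_max_of_le_left ?_) (by linarith)) (hx i k hik)
        exact (localRadius_pos (ENNReal.ofReal_pos.2 hc) hlt _).le
    · refine le_localUpperBound (B := B) (L := 0) hw.kappa_pos.le le_rfl hint
        (A := ∫⁻ x, e x ∂μ) ?_ hint' (by linarith) (by linarith)
      simpa using canonicalFreeEnergy_zero_temperature_le_of_separated hρm hρ hρi hμ hN0 hμuniv hc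
        (by linarith) hη hη4 hem hE
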